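/- **Setting.** Let $n\ge 3$ and $r=n-2$. For $N\ge1$ let $B_l=B_l^{(N)}$ and $B_l^\vee$ both be the set of arrays $x=(x_1,\dots,x_N)\in(\mathbb Z_{\ge0})^N$ with $x_1+\cdots+x_N=l$ (indices in $\mathbb Z/N$; $x_i$ is the number of letters $i$, resp. $\bar i$, in the tableau word of $x$), and let $\mathrm{Aff}(B)=\{z^dx\mid d\in\mathbb Z,\ x\in B\}$. Put $$Q_i(x,y)=\min_{1\le k\le N}\Big(\sum_{j=1}^{k-1}x_{i+j}+\sum_{j=k+1}^{N}y_{i+j}\Big),\qquad P_i(x,y)=\min(x_{i+1},y_{i+1}).$$ For an energy $H$, the combinatorial $R$'s are the maps $z^dx\otimes z^ey\mapsto z^{e+H(x\otimes y)}\tilde y\otimes z^{d-H(x\otimes y)}\tilde x$ with * $R$ on $\mathrm{Aff}(B_l)\otimes\mathrm{Aff}(B_m)$: $\tilde x_i=x_i+Q_i(x,y)-Q_{i-1}(x,y)$, $\tilde y_i=y_i+Q_{i-1}(x,y)-Q_i(x,y)$; * $R^\vee$ on $\mathrm{Aff}(B_l)\otimes\mathrm{Aff}(B_m^\vee)$: $\tilde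 x_i=x_i+P_i(x,y)-P_{i-1}(x,y)$, $\tilde y_i=y_i+P_i(x,y)-P_{i-1}(x,y)$; * $R^{\vee\vee}$ on $\mathrm{Aff}(B^\vee_l)\otimes\mathrm{Aff}(B_m^\vee)$: $\tilde x_i=x_i+Q_{i-1}(y,x)-Q_i(y,x)$, $\tilde y_i=y_i+Q_i(y,x)-Q_{i-1}(y,x)$. Isomorphisms $\simeq$ below are composed from the maps $x\otimes y\mapsto\tilde y\otimes\tilde x$. **Automaton.** Take $N=n$, $B=B_1\otimes B_1^\vee$, and let $\kappa:B_l\to B_l^\vee$ be one of: Rotateleft $(x_2,\dots,x_n,x_1)$; for even $n$, Switch$_{1n}$ $(x_n,x_3,x_2,x_5,x_4,\dots,x_{n-1},x_{n-2},x_1)$; for even $n$, Switch$_{12}$ $(x_2,x_1,x_4,x_3,\dots,x_n,x_{n-1})$. Let $u_k=(k,0,\dots,0)\in B_k$, $u_k^\vee=\kappa(u_k)$ and $\mathrm{vac}=1\otimes\kappa(1)$. A state is $p=\cdots\otimes p_2\otimes p_1$ with $p_j\in B$ and $p_j=\mathrm{vac}$ for $j\gg1$. For $k\ge1$, $T_k(p)$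 is defined by $u_k\otimes p\simeq p^\dagger\otimes v$ and $p^\dagger\otimes\kappa(v)\simeq u_k^\vee\otimes T_k(p)$. **Solitons.** Let $B'_l,B'^\vee_l$ denote $B_l,B_l^\vee$ for $N=r$. Let $s=1$ for Rotateleft and Switch$_{1n}$, $s=2$ for Switch$_{12}$, and write $\mathrm{vac}=1\otimes\bar c$. A right soliton of length $l$ and label $x=i_1\cdots i_l\in B'_l$ ($1\le i_1\le\dots\le i_l\le r$) is the block $\imath_l(x)=((i_l+s)\otimes\bar c)\otimes\cdots\otimes((i_1+s)\otimes\bar c)$; a left soliton with label $x=\bar i_1\cdots\bar i_l\in B'^\vee_l$ is the block $\imath_l(x)=(1\otimes\overline{i_1+s})\otimes\cdots\otimes(1\otimes\overline{i_l+s})$. If it is followed by exactly $i$ local states on its right, its position is $i+1$ (right soliton) or $1-i-l$ (left soliton), and its phase $d$ at time $t$ under $T_k$ is defined by: position $=-\min(k,l)\,t+d$. Its scattering data is $z^dx\in\mathrm{Aff}(B'_l)$ (right) or $z^{-d}x\in\mathrm{Aff}(B'^\vee_l)$ (left). A separated two-soliton state $\cdots\mathrm{vac}\otimes\imath_l(x)\otimes\mathrm{vac}^{\otimes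 g}\otimes\imath_m(y)\otimes\mathrm{vac}^{\otimes M}$, where $g\ge l$ (right–right), $g\ge m$ (left–left), $g\ge l+m$ (right–left), $g\ge 0$ (left–right), has as data the tensor product, from left to right, of the data of its solitons. Multiplying both factors by $z^c$ translates the solitons by $c$ sites away from the end. **Scattering.** For two solitons of lengths $l,m\ge1$ with data $a\otimes b$, say that $T_k$ scatters $a\otimes b$ into $b'\otimes a'$ (the soliton of $b$ being now on the left) if the following holds far from the end: for every $t_1\in\mathbb Z$, for all sufficiently large $t_2$, and for all sufficiently large $c$ (depending on $t_2$), whenever $p$ is a separated two-soliton state with data $z^ca\otimes z^cb$ at time $t_1$, then $T_k^{t_2-t_1}(p)$ is a separated two-soliton state with data $z^cb'\otimes z^ca'$ at time $t_2$. The scattering operators are then defined, with $T_k$, as follows. * $S^\vee:\mathrm{Aff}(B'_l)\otimes\mathrm{Aff}(B'^\vee_m)\to\mathrm{Aff}(B'^\vee_m)\otimes\mathrm{Aff}(B'_l)$, $k\ge1$: $S^\vee(a\otimes b)=b'\otimes a'$ iff $a\otimes b$ is scattered into $b'\otimes a'$. * $S:\mathrm{Aff}(B'_l)\otimes\mathrm{Aff}(B'_m)\to\mathrm{Aff}(B'_m)\otimes\mathrm{Aff}(B'_l)$,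 $l\ne m$, $k>\min(l,m)$: $S(a\otimes b)=b'\otimes a'$ iff $a\otimes b$ is scattered into $b'\otimes a'$ (case $l>m$), resp. $b'\otimes a'$ is scattered into $a\otimes b$ (case $l<m$, where the longer soliton is the one initially on the left in the collision). * $S^{\vee\vee}:\mathrm{Aff}(B'^\vee_l)\otimes\mathrm{Aff}(B'^\vee_m)\to\mathrm{Aff}(B'^\vee_m)\otimes\mathrm{Aff}(B'^\vee_l)$, $l\ne m$, $k>\min(l,m)$: likewise, with $a\otimes b$ scattered into $b'\otimes a'$ for $l<m$, and $b'\otimes a'$ scattered into $a\otimes b$ for $l>m$. **Theorem.** Let $R',R'^\vee,R'^{\vee\vee}$ be the maps $R,R^\vee,R^{\vee\vee}$ for $N=r=n-2$ with $H$ equal to $$\Delta(x\otimes y)=\begin{cases}2\min(l,m)-Q_0(x,y)&\text{for }R',\\-P_0(x,y)&\text{for }R'^\vee,\\2\min(l,m)-Q_0(y,x)&\text{for }R'^{\vee\vee}.\end{cases}$$ Then, for each of the choices of $\kappa$, and for each $k>\min(l,m)$ in the case of $S,S^{\vee\vee}$ (with $l\neq m$) and each $k\ge1$ in the case of $S^\vee$,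 the scattering operators are well-defined maps, independent of $\kappa$ and $k$, and $$S=R',\qquad S^\vee=R'^\vee,\qquad S^{\vee\vee}=R'^{\vee\vee}.$$ -/

import Mathlib

/-! ### Crystals of type `A_{n-1}^{(1)}` for symmetric tensors and their duals -/

/-- The underlying set of both `B_l` and its dual `B_l^∨` for `U_q(ŝl_n)`: arrays
`(x_1, …, x_n)` of non-negative integers with sum `l`, indexed by `ℤ/nℤ`
(so index `n` is index `0`). -/
def Crystal (n l : ℕ) [NeZero n] : Type :=
  {x : ZMod n → ℕ // ∑ i, x i = l}

/-- An element `z^deg · elt` of the affinization of a crystal. -/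
@[ext] structure Aff (X : Type) where
  deg : ℤ
  elt : X

/-- `Q_i(x,y) = min_{1 ≤ k ≤ n} (∑_{j=1}^{k-1} x_{i+j} + ∑_{j=k+1}^{n} y_{i+j})`. -/
def crystalQ {n : ℕ} [NeZero n] (i : ZMod n) (x y : ZMod n → ℕ) : ℕ :=
  (Finset.Icc 1 n).inf' (Finset.nonempty_Icc.2 (NeZero.one_le))
    fun k => ∑ j ∈ Finset.Icc 1 (k - 1), x (i + (j : ZMod n))
      + ∑ j ∈ Finset.Icc (k + 1) n, y (i + (j : ZMod n))

/-- `P_i(x,y) = min(x_{i+1}, y_{i+1})`. -/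
def crystalP {n : ℕ} (i : ZMod n) (x y : ZMod n → ℕ) : ℕ :=
  min (x (i + 1)) (y (i + 1))

theorem sum_shift_eq {n : ℕ} [NeZero n] (x : ZMod n → ℕ) (i : ZMod n) :
    ∑ j ∈ Finset.Icc 1 n, x (i + (j : ZMod n)) = ∑ j, x j := by
  refine Finset.sum_bij (fun j _ => i + (j : ZMod n)) (fun _ _ => Finset.mem_univ _) ?_ ?_
    (fun _ _ => rfl)
  · intro a ha b hb h
    have h' : (a : ZMod n) = (b : ZMod n) := add_left_cancel h
    rw [ZMod.natCast_eq_natCast_iff] at h'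
    rw [Finset.mem_Icc] at ha hb
    have h2 : (n : ℤ) ∣ (b : ℤ) - a := (Nat.modEq_iff_dvd).1 h'
    have h3 : (b : ℤ) - a = 0 := by
      apply Int.eq_zero_of_abs_lt_dvd h2
      rw [abs_lt]; constructor <;> omega
    omega
  · intro c _
    have hn : 0 < n := Nat.pos_of_ne_zero (NeZero.ne n)
    by_cases h : c - i = 0
    · refine ⟨n, Finset.mem_Icc.2 ⟨hn, le_rfl⟩, ?_⟩
      rw [ZMod.natCast_self, add_zero]; exact (sub_eq_zero.1 h).symm
    · refine ⟨(c - i).val, Finset.mem_Icc.2 ⟨?_, (ZMod.val_lt _).le⟩, ?_⟩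
      · exact Nat.pos_of_ne_zero fun h0 => h ((ZMod.val_eq_zero _).1 h0)
      · rw [ZMod.natCast_zmod_val]; ring

theorem sum_shift_pred_eq {n : ℕ} [NeZero n] (x : ZMod n → ℕ) (i : ZMod n) (a b : ℕ) :
    ∑ j ∈ Finset.Icc (a + 1) (b + 1), x (i - 1 + (j : ZMod n))
      = ∑ j ∈ Finset.Icc a b, x (i + (j : ZMod n)) := by
  rw [← Finset.map_add_right_Icc a b 1, Finset.sum_map]
  refine Finset.sum_congr rfl fun j _ => ?_
  simp only [addRightEmbedding_apply, Nat.cast_add, Nat.cast_one]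
  congr 1; ring

theorem crystalQ_le {n : ℕ} [NeZero n] (i : ZMod n) (x y : ZMod n → ℕ) {k : ℕ}
    (h1 : 1 ≤ k) (h2 : k ≤ n) :
    crystalQ i x y ≤ ∑ j ∈ Finset.Icc 1 (k - 1), x (i + (j : ZMod n))
      + ∑ j ∈ Finset.Icc (k + 1) n, y (i + (j : ZMod n)) :=
  Finset.inf'_le _ (Finset.mem_Icc.2 ⟨h1, h2⟩)

theorem exists_crystalQ_eq {n : ℕ} [NeZero n] (i : ZMod n) (x y : ZMod n → ℕ) :
    ∃ k, 1 ≤ k ∧ k ≤ n ∧ crystalQ i x y = ∑ j ∈ Finset.Icc 1 (k - 1), x (i + (j : ZMod n))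
      + ∑ j ∈ Finset.Icc (k + 1) n, y (i + (j : ZMod n)) := by
  obtain ⟨k, hk, h⟩ := Finset.exists_mem_eq_inf' (s := Finset.Icc 1 n)
    (Finset.nonempty_Icc.2 (NeZero.one_le))
    (fun k => ∑ j ∈ Finset.Icc 1 (k - 1), x (i + (j : ZMod n))
      + ∑ j ∈ Finset.Icc (k + 1) n, y (i + (j : ZMod n)))
  exact ⟨k, (Finset.mem_Icc.1 hk).1, (Finset.mem_Icc.1 hk).2, h⟩

/-- The differences in the combinatorial `R` below are never truncated. -/
theorem crystalQ_pred_le {n : ℕ} [NeZero n] (i : ZMod n) (x y : ZMod n → ℕ) :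
    crystalQ (i - 1) x y ≤ x i + crystalQ i x y := by
  obtain ⟨k, h1, h2, hk⟩ := exists_crystalQ_eq i x y
  obtain ⟨k, rfl⟩ := Nat.exists_eq_add_of_le' h1
  rw [hk]
  have e0 : x i + ∑ j ∈ Finset.Icc 1 k, x (i + (j : ZMod n))
      = ∑ j ∈ Finset.Icc 1 (k + 1), x (i - 1 + (j : ZMod n)) := by
    rw [← Finset.sum_Ioc_add_eq_sum_Icc (show 1 ≤ k + 1 by omega),
      ← Finset.Icc_succ_left_eq_Ioc, ← sum_shift_pred_eq x i 1 k]
    simp [add_comm]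
  rw [Nat.add_sub_cancel, ← add_assoc, e0]
  rcases h2.lt_or_eq with h | h
  · refine (crystalQ_le (i - 1) x y (k := k + 2) (by omega) (by omega)).trans ?_
    have := sum_shift_pred_eq y i (k + 1 + 1) n
    rw [Finset.sum_Icc_succ_top (by omega)] at this
    have e : k + 2 - 1 = k + 1 := by omega
    rw [e]
    have e' : k + 2 + 1 = k + 1 + 1 + 1 := rfl
    rw [e']
    omega
  · refine (crystalQ_le (i - 1) x y (k := n) NeZero.one_le le_rfl).trans ?_
    rw [Finset.Icc_eq_empty (a := n + 1) (by omega), Finset.sum_empty, add_zero]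
    refine le_trans (Finset.sum_le_sum_of_subset ?_) (Nat.le_add_right _ _)
    exact Finset.Icc_subset_Icc le_rfl (by omega)

theorem crystalQ_le_pred {n : ℕ} [NeZero n] (i : ZMod n) (x y : ZMod n → ℕ) :
    crystalQ i x y ≤ y i + crystalQ (i - 1) x y := by
  obtain ⟨k, h1, h2, hk⟩ := exists_crystalQ_eq (i - 1) x y
  obtain ⟨k, rfl⟩ := Nat.exists_eq_add_of_le' h1
  rw [hk]
  have e0 : y i + ∑ j ∈ Finset.Icc (k + 1 + 1) n, y (i - 1 + (j : ZMod n))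
      = ∑ j ∈ Finset.Icc (k + 1) n, y (i + (j : ZMod n)) := by
    rw [← sum_shift_pred_eq y i (k + 1) n, Finset.sum_Icc_succ_top (by omega)]
    simp [add_comm]
  rw [Nat.add_sub_cancel, add_left_comm, e0]
  rcases Nat.eq_zero_or_pos k with rfl | h
  · refine (crystalQ_le i x y (k := 1) le_rfl NeZero.one_le).trans ?_
    simp only [Nat.sub_self]
    refine add_le_add (by simp) (Finset.sum_le_sum_of_subset ?_)
    exact Finset.Icc_subset_Icc (by omega) le_rfl
  · refine (crystalQ_le i x y (k := k) h (by omega)).trans ?_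
    refine add_le_add ?_ le_rfl
    rw [← sum_shift_pred_eq x i 1 (k - 1), Nat.sub_add_cancel h]
    exact Finset.sum_le_sum_of_subset (Finset.Icc_subset_Icc (by omega) le_rfl)

theorem sum_transfer {n : ℕ} [NeZero n] (x f : ZMod n → ℕ) (h : ∀ i, f (i - 1) ≤ x i + f i) :
    ∑ i, (x i + f i - f (i - 1)) = ∑ i, x i := by
  have e : ∑ i, f (i - 1) = ∑ i, f i := Equiv.sum_comp (Equiv.subRight (1 : ZMod n)) f
  have : ∑ i, (x i + f i - f (i - 1)) + ∑ i, f (i - 1) = ∑ i, x i + ∑ i, f i := by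
    rw [← Finset.sum_add_distrib, ← Finset.sum_add_distrib]
    exact Finset.sum_congr rfl fun i _ => Nat.sub_add_cancel (h i)
  omega

theorem sum_transfer' {n : ℕ} [NeZero n] (y f : ZMod n → ℕ) (h : ∀ i, f i ≤ y i + f (i - 1)) :
    ∑ i, (y i + f (i - 1) - f i) = ∑ i, y i := by
  have e : ∑ i, f (i - 1) = ∑ i, f i := Equiv.sum_comp (Equiv.subRight (1 : ZMod n)) f
  have : ∑ i, (y i + f (i - 1) - f i) + ∑ i, f i = ∑ i, y i + ∑ i, f (i - 1) := by
    rw [← Finset.sum_add_distrib, ← Finset.sum_add_distrib]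
    exact Finset.sum_congr rfl fun i _ => Nat.sub_add_cancel (h i)
  omega

theorem crystalP_pred_le {n : ℕ} (i : ZMod n) (x y : ZMod n → ℕ) :
    crystalP (i - 1) x y ≤ x i ∧ crystalP (i - 1) x y ≤ y i := by
  simp [crystalP]

/-! ### Combinatorial `R` -/

/-- Classical part of `R : B_l ⊗ B_m → B_m ⊗ B_l`, `x ⊗ y ↦ ỹ ⊗ x̃`. -/
def classicalR {n l m : ℕ} [NeZero n] (x : Crystal n l) (y : Crystal n m) :
    Crystal n m × Crystal n l :=
  (⟨fun i => y.1 i + crystalQ (i - 1) x.1 y.1 - crystalQ i x.1 y.1,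
    (sum_transfer' y.1 (fun i => crystalQ i x.1 y.1)
      fun i => crystalQ_le_pred i x.1 y.1).trans y.2⟩,
   ⟨fun i => x.1 i + crystalQ i x.1 y.1 - crystalQ (i - 1) x.1 y.1,
    (sum_transfer x.1 (fun i => crystalQ i x.1 y.1)
      fun i => crystalQ_pred_le i x.1 y.1).trans x.2⟩)

/-- Classical part of `R^∨ : B_l ⊗ B_m^∨ → B_m^∨ ⊗ B_l`, `x ⊗ y ↦ ỹ ⊗ x̃`. -/
def classicalRv {n l m : ℕ} [NeZero n] (x : Crystal n l) (y : Crystal n m) :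
    Crystal n m × Crystal n l :=
  (⟨fun i => y.1 i + crystalP i x.1 y.1 - crystalP (i - 1) x.1 y.1,
    (sum_transfer y.1 (fun i => crystalP i x.1 y.1)
      fun i => (crystalP_pred_le i x.1 y.1).2.trans (Nat.le_add_right _ _)).trans y.2⟩,
   ⟨fun i => x.1 i + crystalP i x.1 y.1 - crystalP (i - 1) x.1 y.1,
    (sum_transfer x.1 (fun i => crystalP i x.1 y.1)
      fun i => (crystalP_pred_le i x.1 y.1).1.trans (Nat.le_add_right _ _)).trans x.2⟩)

/-- Classical part of `R^∨∨ : B_l^∨ ⊗ B_m^∨ → B_m^∨ ⊗ B_l^∨`, `x ⊗ y ↦ ỹ ⊗ x̃`. -/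
def classicalRvv {n l m : ℕ} [NeZero n] (x : Crystal n l) (y : Crystal n m) :
    Crystal n m × Crystal n l :=
  (⟨fun i => y.1 i + crystalQ i y.1 x.1 - crystalQ (i - 1) y.1 x.1,
    (sum_transfer y.1 (fun i => crystalQ i y.1 x.1)
      fun i => crystalQ_pred_le i y.1 x.1).trans y.2⟩,
   ⟨fun i => x.1 i + crystalQ (i - 1) y.1 x.1 - crystalQ i y.1 x.1,
    (sum_transfer' x.1 (fun i => crystalQ i y.1 x.1)
      fun i => crystalQ_le_pred i y.1 x.1).trans x.2⟩)

/-- The affine map `z^d x ⊗ z^e y ↦ z^{e+H(x⊗y)} ỹ ⊗ z^{d-H(x⊗y)} x̃` with classical part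
`c : x ⊗ y ↦ ỹ ⊗ x̃` and energy `H`. -/
def affinize {X Y : Type} (c : X → Y → Y × X) (H : X → Y → ℤ) (a : Aff X) (b : Aff Y) :
    Aff Y × Aff X :=
  (⟨b.deg + H a.elt b.elt, (c a.elt b.elt).1⟩, ⟨a.deg - H a.elt b.elt, (c a.elt b.elt).2⟩)

/-- `R` with its energy replaced by `2 min(l,m) - Q_0(x,y)`. -/
def modifiedR {n l m : ℕ} [NeZero n] :
    Aff (Crystal n l) → Aff (Crystal n m) → Aff (Crystal n m) × Aff (Crystal n l) :=
  affinize classicalR fun x y => 2 * (min l m : ℤ) - crystalQ 0 x.1 y.1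

/-- `R^∨` with energy `-P_0(x,y)`. -/
def modifiedRv {n l m : ℕ} [NeZero n] :
    Aff (Crystal n l) → Aff (Crystal n m) → Aff (Crystal n m) × Aff (Crystal n l) :=
  affinize classicalRv fun x y => -(crystalP 0 x.1 y.1 : ℤ)

/-- `R^∨∨` with its energy replaced by `2 min(l,m) - Q_0(y,x)`. -/
def modifiedRvv {n l m : ℕ} [NeZero n] :
    Aff (Crystal n l) → Aff (Crystal n m) → Aff (Crystal n m) × Aff (Crystal n l) :=
  affinize classicalRvv fun x y => 2 * (min l m : ℤ) - crystalQ 0 y.1 x.1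

/-! ### The boundary map `κ` -/

/-- The three reflecting boundaries; the two switches exist only for even `n`. -/
inductive Boundary (n : ℕ) : Type
  | rotateLeft : Boundary n
  | switch1n (h : Even n) : Boundary n
  | switch12 (h : Even n) : Boundary n

/-- The coordinate permutation `s` with `κ(x)_i = x_{s(i)}`. With coordinates read modulo `n`
(even in the last two cases), Rotateleft is `(x_2, …, x_n, x_1)`, Switch_{1n} is
`(x_n, x_3, x_2, x_5, x_4, …, x_{n-1}, x_{n-2}, x_1)` and Switch_{12} is
`(x_2, x_1, x_4, x_3, …, x_n, x_{n-1})`. -/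
def Boundary.index {n : ℕ} : Boundary n → ZMod n → ZMod n
  | .rotateLeft, i => i + 1
  | .switch1n _, i => if Even i.val then i + 1 else i - 1
  | .switch12 _, i => if Even i.val then i - 1 else i + 1

theorem even_val_add_one {n : ℕ} [NeZero n] (h : Even n) (i : ZMod n) :
    Even (i + 1).val ↔ ¬ Even i.val := by
  have hd : 2 ∣ n := even_iff_two_dvd.1 h
  have par : ∀ j : ZMod n, Even j.val ↔ ZMod.castHom hd (ZMod 2) j = 0 := fun j => by
    rw [ZMod.castHom_apply, ZMod.cast_eq_val, ZMod.natCast_eq_zero_iff_even]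
  rw [par, par, map_add, map_one]
  generalize ZMod.castHom hd (ZMod 2) i = c
  revert c
  decide

theorem Boundary.index_bijective {n : ℕ} [NeZero n] (κ : Boundary n) :
    Function.Bijective κ.index := by
  have key : ∀ (h : Even n) (i : ZMod n), Even (i - 1).val ↔ ¬ Even i.val := fun h i => by
    have := even_val_add_one h (i - 1)
    rw [sub_add_cancel] at this
    tauto
  cases κ with
  | rotateLeft => exact (Equiv.addRight (1 : ZMod n)).bijective
  | switch1n h =>
    refine Function.Involutive.bijective fun i => ?_
    by_cases hi : Even i.val <;> simp [Boundary.index, hi, even_val_add_one h, key h]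
  | switch12 h =>
    refine Function.Involutive.bijective fun i => ?_
    by_cases hi : Even i.val <;> simp [Boundary.index, hi, even_val_add_one h, key h]

/-- `κ : B_l → B_l^∨`. -/
def Boundary.map {n l : ℕ} [NeZero n] (κ : Boundary n) (x : Crystal n l) : Crystal n l :=
  ⟨fun i => x.1 (κ.index i), (κ.index_bijective.sum_comp x.1).trans x.2⟩

/-! ### The automaton on the semi-infinite lattice -/

/-- The element of `B_l` (or `B_l^∨`) whose only non-zero coordinate is the `i`-th one. -/
def multiple {n : ℕ} [NeZero n] (l : ℕ) (i : ZMod n) : Crystal n l :=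
  ⟨Pi.single i l, by simp⟩

/-- The element `i ∈ B_1`, or `ī ∈ B_1^∨`. -/
def letter {n : ℕ} [NeZero n] (i : ZMod n) : Crystal n 1 := multiple 1 i

/-- Local states `B = B_1 ⊗ B_1^∨`. -/
abbrev LocalState (n : ℕ) [NeZero n] : Type := Crystal n 1 × Crystal n 1

/-- `vac = 1 ⊗ κ(1)`. -/
def vac {n : ℕ} [NeZero n] (κ : Boundary n) : LocalState n := (letter 1, κ.map (letter 1))

/-- Assignments of local states to the half line. The entry with index `j` sits at the site
with coordinate `j + 1`; the reflecting end is to the right of index `0` and the index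
increases to the left. A configuration is a state of the automaton if it is `vac` at all
sufficiently large indices. -/
abbrev Config (n : ℕ) [NeZero n] : Type := ℕ → LocalState n

/-- The isomorphism `B_k ⊗ B ≃ B ⊗ B_k`. -/
def passRight {n k : ℕ} [NeZero n] (v : Crystal n k) (b : LocalState n) :
    LocalState n × Crystal n k :=
  let r := classicalR v b.1
  let r' := classicalRv r.2 b.2
  ((r.1, r'.1), r'.2)

/-- The isomorphism `B ⊗ B_k^∨ ≃ B_k^∨ ⊗ B`. -/
def passLeft {n k : ℕ} [NeZero n] (b : LocalState n) (w : Crystal n k) :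
    Crystal n k × LocalState n :=
  let r := classicalRvv b.2 w
  let r' := classicalRv b.1 r.1
  (r'.1, (r'.2, r.2))

/-- The carrier between the indices `j` and `j - 1` in `u_k ⊗ p ≃ p† ⊗ v`, if it starts
as `u_k` to the left of all indices `< N`. -/
def rightCarrier {n : ℕ} [NeZero n] (k : ℕ) (p : Config n) (N j : ℕ) : Crystal n k :=
  if j < N then (passRight (rightCarrier k p N (j + 1)) (p j)).2 else multiple k 1
termination_by N - j

/-- The carrier `w` moving back to the left in `p† ⊗ w_0 ≃ u_k^∨ ⊗ T_k(p)`, just before it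
passes the entry with index `j`. -/
def leftCarrier {n k : ℕ} [NeZero n] (q : Config n) (w₀ : Crystal n k) : ℕ → Crystal n k
  | 0 => w₀
  | j + 1 => (passLeft (q j) (leftCarrier q w₀ j)).1

/-- The time evolution `T_k`: `u_k ⊗ p ≃ p† ⊗ v` and `p† ⊗ κ(v) ≃ u_k^∨ ⊗ T_k(p)`.
As `u_k ⊗ vac ≃ vac ⊗ u_k`, the first isomorphism only involves the indices `< N`, where `N`
is such that a state `p` is `vac` from index `N` on.
(For a configuration that is not a state the value has no meaning.) -/
noncomputable def timeEvolution {n : ℕ} [NeZero n] (κ : Boundary n) (k : ℕ) (p : Config n) :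
    Config n :=
  let N := sInf {N : ℕ | ∀ j, N ≤ j → p j = vac κ}
  let pDagger : Config n := fun j => (passRight (rightCarrier k p N (j + 1)) (p j)).1
  fun j => (passLeft (pDagger j) (leftCarrier pDagger (κ.map (rightCarrier k p N 0)) j)).2

/-! ### Solitons and scattering data for `U_q(ŝl_{r+2})`, labelled by crystals of
`U_q(ŝl_r)` -/

/-- A soliton moves to the right (label in `B'_l`) or to the left (label in `B'^∨_l`). -/
inductive Direction : Type
  | right : Direction
  | left : Direction

/-- The tableau word `i_1 ≤ i_2 ≤ … ≤ i_l` of a label, with letters in `{1, …, r}`. -/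
def word {r l : ℕ} [NeZero r] (x : Crystal r l) : List ℕ :=
  (List.range' 1 r).flatMap fun i : ℕ => List.replicate (x.1 (i : ZMod r)) i

/-- The embedding of the letters `{1, …, r}` into `{1, …, r + 2}`: `i ↦ i + 1` for Rotateleft
and Switch_{1n}, `i ↦ i + 2` for Switch_{12}. -/
def Boundary.shift {n : ℕ} : Boundary n → ℕ
  | .rotateLeft => 1
  | .switch1n _ => 1
  | .switch12 _ => 2

/-- The injection `ι_l` on `B'_l` (`right`) and on `B'^∨_l` (`left`), as the list of tensor
factors from left to right. -/
def soliton {r l : ℕ} [NeZero r] (κ : Boundary (r + 2)) :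
    Direction → Crystal r l → List (LocalState (r + 2))
  | .right, x => (word x).reverse.map fun i =>
      (letter ((i + κ.shift : ℕ) : ZMod (r + 2)), κ.map (letter 1))
  | .left, x => (word x).map fun i =>
      (letter 1, letter ((i + κ.shift : ℕ) : ZMod (r + 2)))

/-- The configuration `⋯ ⊗ vac ⊗ vac ⊗ L`, `L` being read from left to right and ending at
the reflecting end. -/
def ofList {n : ℕ} [NeZero n] (κ : Boundary n) (L : List (LocalState n)) : Config n :=
  fun j => L.reverse.getD j (vac κ)

/-- The position of a soliton of length `l` with `i` sites between it and the end. -/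
def position : Direction → ℕ → ℕ → ℤ
  | .right, _, i => i + 1
  | .left, l, i => 1 - i - l

/-- The phase of a soliton with scattering data `z^e x`: `e` or `-e`. -/
def phase : Direction → ℤ → ℤ
  | .right, e => e
  | .left, e => -e

/-- Number of `vac`'s between neighbouring solitons that makes them well separated. -/
def minGap : Direction → Direction → ℕ → ℕ → ℕ
  | .right, .right, l, _ => l
  | .left, .left, _, m => m
  | .right, .left, l, m => l + m
  | .left, .right, _, _ => 0

/-- At time `t` of the evolution by `T_k`, the configuration `p` is a state
`⋯ vac ⊗ ι_l(x) ⊗ vac^{⊗ g} ⊗ ι_m(y) ⊗ vac^{⊗ M}` of two separated solitons of directions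
`σ`, `τ` with scattering data `a ⊗ b = z^{±d₁} x ⊗ z^{±d₂} y`. Here the phase `d` of a soliton
of length `l` is determined by `position = - min(k,l) t + d`. -/
def HasScatteringData {r l m : ℕ} [NeZero r] (κ : Boundary (r + 2)) (k : ℕ) (t : ℤ)
    (σ τ : Direction) (a : Aff (Crystal r l)) (b : Aff (Crystal r m))
    (p : Config (r + 2)) : Prop :=
  ∃ g M : ℕ, minGap σ τ l m ≤ g ∧
    p = ofList κ (soliton κ σ a.elt ++ List.replicate g (vac κ) ++ soliton κ τ b.elt
      ++ List.replicate M (vac κ)) ∧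
    position σ l (M + m + g) = -(min k l : ℤ) * t + phase σ a.deg ∧
    position τ m M = -(min k m : ℤ) * t + phase τ b.deg

/-- Multiplication by `z^c`. On the scattering data of a soliton (right or left) this is the
translation of the soliton by `c` sites away from the reflecting end. -/
def Aff.translate {X : Type} (c : ℤ) (a : Aff X) : Aff X := ⟨a.deg + c, a.elt⟩

/-- Two solitons of directions `σ`, `τ` (left one, right one) with data `a ⊗ b` are scattered
by `T_k` into solitons with data `out.1 ⊗ out.2`, the soliton of direction `τ` being now on the
left. The scattering takes place far from the end: whenever the initial solitons are separated
at time `t₁`, then for all late times `t₂`, and after translating everything sufficiently far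
away from the end, the time evolution from `t₁` to `t₂` carries the state with data `a ⊗ b` into
one with data `out`. -/
def Scatters {r l m : ℕ} [NeZero r] (κ : Boundary (r + 2)) (k : ℕ) (σ τ : Direction)
    (a : Aff (Crystal r l)) (b : Aff (Crystal r m))
    (out : Aff (Crystal r m) × Aff (Crystal r l)) : Prop :=
  ∀ t₁ : ℤ, ∀ᶠ t₂ : ℤ in Filter.atTop, ∀ᶠ c : ℤ in Filter.atTop, ∀ p : Config (r + 2),
    HasScatteringData κ k t₁ σ τ (a.translate c) (b.translate c) p →
    HasScatteringData κ k t₂ τ σ (out.1.translate c) (out.2.translate c)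
      ((timeEvolution κ k)^[(t₂ - t₁).toNat] p)

/-- `S (a ⊗ b) = out` for two right solitons of lengths `l ≠ m`. Right solitons collide only if
the longer one comes from the left. Thus for `l > m` the collision turns `a ⊗ b` into `out`, and
for `l < m` the solitons with data `a ⊗ b` are those that emerge from the collision of `out`. -/
def ScattersRR {r l m : ℕ} [NeZero r] (κ : Boundary (r + 2)) (k : ℕ)
    (a : Aff (Crystal r l)) (b : Aff (Crystal r m))
    (out : Aff (Crystal r m) × Aff (Crystal r l)) : Prop :=
  (m < l ∧ Scatters κ k .right .right a b out) ∨
  (l < m ∧ Scatters κ k .right .right out.1 out.2 (a, b))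

/-- `S^∨∨ (a ⊗ b) = out` for two left solitons of lengths `l ≠ m`. Left solitons collide only if
the longer one comes from the right. Thus for `l < m` the collision turns `a ⊗ b` into `out`, and
for `l > m` the solitons with data `a ⊗ b` are those that emerge from the collision of `out`. -/
def ScattersLL {r l m : ℕ} [NeZero r] (κ : Boundary (r + 2)) (k : ℕ)
    (a : Aff (Crystal r l)) (b : Aff (Crystal r m))
    (out : Aff (Crystal r m) × Aff (Crystal r l)) : Prop :=
  (l < m ∧ Scatters κ k .left .left a b out) ∨
  (m < l ∧ Scatters κ k .left .left out.1 out.2 (a, b))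

/-- `S^∨ (a ⊗ b) = out` for a right soliton coming from the left and a left soliton coming from
the right. -/
def ScattersRL {r l m : ℕ} [NeZero r] (κ : Boundary (r + 2)) (k : ℕ)
    (a : Aff (Crystal r l)) (b : Aff (Crystal r m))
    (out : Aff (Crystal r m) × Aff (Crystal r l)) : Prop :=
  Scatters κ k .right .left a b out

/-!
The dynamics is taken apart by a normal form. Moving every component in `B_1^∨` of a word of local
states to the left of every component in `B_1`, by means of `R^∨`, turns the word into a pair
consisting of a word of elements of `B_1^∨` and a word of elements of `B_1`. This map is injective
on words (`normalForm_injective`). By the Yang–Baxter equation on `B_k ⊗ B_1 ⊗ B_1^∨`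
(`mixedYangBaxter`), a carrier acts on the normal form of a word as it acts on the word. As long as
the words end in enough vacuum letters, a carrier `u_k` goes through the word of the other kind
without any effect, so that `T_k` acts on the pair as two independent box-ball systems, one running
to the right and one to the left (`timeEvolution_iterate`). Since `R^{∨∨}` is the mirror image of
`R`, a single evolution `passWord e k`, with `e` the vacuum letter, covers both; the choice of `κ`
enters only through `e` and the labelling of the other letters.

*Solitons of the same direction.* The evolutions `passWord e k` for different `k` commute
(`passWord_comm`), by the Yang–Baxter equation on `B_k ⊗ B_l ⊗ B_1`, which is obtained from the
queue recursion for the functions `Q_i` (`crystalQ_rec`). Let `m < l` be the lengths of the solitons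
`x`, `y`. Their collision under `u_k` need not be followed step by step. Under `u_l` they keep their
labels, and the gap shrinks by `l - m` at each step, even when the carrier contains both solitons,
until the gap is `m - Q_0(x, y)`; at this gap one step of `u_l` produces the combinatorial `R` of
the labels in one stroke (`passWord_collision`). Under `u_{m+1}` the gap changes by one at each
step. Hence every state with a large gap is the image, under powers of the evolutions with carriers
`u_{m+1}` and `u_l`, of a state with a much larger gap, on which `u_k` acts freely; by commutativity
these powers can be applied afterwards, and they can be chosen so that the gap `m - Q_0(x, y)` is
met exactly (`iterate_collision`). Comparing the positions gives the energy `2 m - Q_0(x, y)`.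

*A right and a left soliton.* In the normal form of a state before the collision the words of the
two solitons have already crossed each other, which happens letter by letter: two equal letters `v`
both turn into `v - 1` (`crossLetter`). This yields the combinatorial `R^∨` of the labels, and the
letters that leave the range of the labels account for a shift by `P_0(x, y)`
(`crossWord_solitons`). After that, the two words move freely. The normal form of a state after the
collision just separates the components (`normalForm_left_right`), and the injectivity of the normal
form identifies the state reached (`timeEvolution_right_left`).

*The scattering operators.* Scattering data are determined by the state, and separated initial
states exist, so a scattering has at most one outcome (`scatters_iff`). Where the operator is
defined by the inverse of a collision, the claim follows as `R` and `R^{∨∨}` with their energies are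
involutive for `l ≠ m` (`modifiedR_involutive`, `modifiedRvv_involutive`); this rests on the
uniqueness of periodic solutions of the queue recursion (`queue_unique`).
-/

/-! ### The queue recursion and the involutivity of the combinatorial `R` -/

theorem window_succ_right {n : ℕ} (x y : ZMod n → ℕ) (i : ZMod n) {k : ℕ} (h1 : 1 ≤ k) :
    x i + (∑ j ∈ Finset.Icc 1 (k - 1), x (i + (j : ZMod n))
      + ∑ j ∈ Finset.Icc (k + 1) n, y (i + (j : ZMod n)))
    = ∑ j ∈ Finset.range k, x (i + (j : ZMod n))
      + ∑ j ∈ Finset.Icc (k + 1) n, y (i + (j : ZMod n)) := by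
  obtain ⟨k, rfl⟩ := Nat.exists_eq_add_of_le' h1
  have e : ∑ j ∈ Finset.range (k + 1), x (i + (j : ZMod n))
      = x i + ∑ j ∈ Finset.Icc 1 k, x (i + (j : ZMod n)) := by
    rw [Finset.range_eq_Ico, Finset.sum_eq_sum_Ico_succ_bot (by omega)]
    simp only [Nat.cast_zero, add_zero, zero_add]
    rfl
  rw [e, Nat.add_sub_cancel, ← add_assoc]

theorem window_pred_right {n : ℕ} [NeZero n] (x y : ZMod n → ℕ) (i : ZMod n) {k : ℕ}
    (h2 : k < n) :
    y i + (∑ j ∈ Finset.Icc 1 (k + 1 - 1), x (i - 1 + (j : ZMod n))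
      + ∑ j ∈ Finset.Icc (k + 1 + 1) n, y (i - 1 + (j : ZMod n)))
    = ∑ j ∈ Finset.range k, x (i + (j : ZMod n))
      + ∑ j ∈ Finset.Icc (k + 1) n, y (i + (j : ZMod n)) := by
  have e1 : ∑ j ∈ Finset.Icc 1 k, x (i - 1 + (j : ZMod n))
      = ∑ j ∈ Finset.range k, x (i + (j : ZMod n)) := by
    have h0 : Finset.Icc 1 k = Finset.Ico 1 (k + 1) := rfl
    rw [h0, Finset.sum_Ico_eq_sum_range]
    refine Finset.sum_congr rfl fun j _ => ?_
    congr 1; push_cast; ring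
  have e0 : y i + ∑ j ∈ Finset.Icc (k + 1 + 1) n, y (i - 1 + (j : ZMod n))
      = ∑ j ∈ Finset.Icc (k + 1) n, y (i + (j : ZMod n)) := by
    rw [← sum_shift_pred_eq y i (k + 1) n, Finset.sum_Icc_succ_top (by omega)]
    simp [add_comm]
  rw [Nat.add_sub_cancel, e1, ← e0]
  omega

theorem sum_range_shift {n : ℕ} [NeZero n] (x : ZMod n → ℕ) (i : ZMod n) :
    ∑ j ∈ Finset.range n, x (i + (j : ZMod n)) = ∑ j, x j := by
  rw [← sum_shift_eq x (i - 1)]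
  have h0 : Finset.Icc 1 n = Finset.Ico 1 (n + 1) := rfl
  rw [h0, Finset.sum_Ico_eq_sum_range]
  refine Finset.sum_congr rfl fun j _ => ?_
  congr 1; push_cast; ring

theorem add_crystalQ_le_left {n : ℕ} [NeZero n] (x y : ZMod n → ℕ) (i : ZMod n) :
    x i + crystalQ i x y ≤ ∑ j, x j := by
  have h := crystalQ_le i x y (k := n) NeZero.one_le le_rfl
  have h' := window_succ_right x y i (k := n) NeZero.one_le
  rw [sum_range_shift, Finset.Icc_eq_empty (a := n + 1) (by omega), Finset.sum_empty] at h'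
  rw [Finset.Icc_eq_empty (a := n + 1) (by omega), Finset.sum_empty] at h
  omega

theorem add_crystalQ_le_right {n : ℕ} [NeZero n] (x y : ZMod n → ℕ) (i : ZMod n) :
    y i + crystalQ (i - 1) x y ≤ ∑ j, y j := by
  have h := crystalQ_le (i - 1) x y (k := 0 + 1) le_rfl NeZero.one_le
  have h' := window_pred_right x y i (k := 0) (Nat.pos_of_ne_zero (NeZero.ne n))
  rw [Finset.range_zero, Finset.sum_empty, zero_add, zero_add, sum_shift_eq] at h'
  simp only [zero_add] at h h'
  omega

/-- The differences of consecutive `Q_i` obey a queue recursion: this is the tropical form of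
the telescoping identity `x_i Q_i + ∏ y = y_i Q_{i-1} + ∏ x`. -/
theorem crystalQ_rec {n : ℕ} [NeZero n] (x y : ZMod n → ℕ) (i : ZMod n) :
    min (x i + crystalQ i x y) (∑ j, y j) = min (y i + crystalQ (i - 1) x y) (∑ j, x j) := by
  have a1 := add_crystalQ_le_left x y i
  have a2 := add_crystalQ_le_right x y i
  obtain ⟨k, h1, h2, hk⟩ := exists_crystalQ_eq (i - 1) x y
  obtain ⟨k, rfl⟩ := Nat.exists_eq_add_of_le' h1
  have b1 := window_pred_right x y i (k := k) (by omega)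
  rw [← hk] at b1
  obtain ⟨k', h1', h2', hk'⟩ := exists_crystalQ_eq i x y
  have b2 := window_succ_right x y i h1'
  rw [← hk'] at b2
  apply le_antisymm
  · refine le_min ?_ ((min_le_left _ _).trans a1)
    rcases Nat.eq_zero_or_pos k with rfl | h
    · rw [Finset.range_zero, Finset.sum_empty, zero_add, zero_add, sum_shift_eq] at b1
      exact (min_le_right _ _).trans b1.ge
    · refine (min_le_left _ _).trans ?_
      have := crystalQ_le i x y h (by omega)
      have c := window_succ_right x y i h
      omega
  · refine le_min ?_ ((min_le_left _ _).trans a2)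
    rcases h2'.lt_or_eq with h | h
    · refine (min_le_left _ _).trans ?_
      have := crystalQ_le (i - 1) x y (k := k' + 1) (by omega) h
      have c := window_pred_right x y i h
      omega
    · subst h
      rw [sum_range_shift, Finset.Icc_eq_empty (a := k' + 1) (by omega), Finset.sum_empty] at b2
      exact (min_le_right _ _).trans (by omega)

theorem crystalQ_rec_of_le {n l m : ℕ} [NeZero n] (x : Crystal n l) (y : Crystal n m)
    (h : m ≤ l) (i : ZMod n) :
    y.1 i + crystalQ (i - 1) x.1 y.1 = min (x.1 i + crystalQ i x.1 y.1) m := by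
  have h0 := crystalQ_rec x.1 y.1 i
  have h1 := add_crystalQ_le_right x.1 y.1 i
  rw [x.2, y.2] at h0
  rw [y.2] at h1
  omega

theorem crystalQ_rec_of_ge {n l m : ℕ} [NeZero n] (x : Crystal n l) (y : Crystal n m)
    (h : l ≤ m) (i : ZMod n) :
    x.1 i + crystalQ i x.1 y.1 = min (y.1 i + crystalQ (i - 1) x.1 y.1) l := by
  have h0 := crystalQ_rec x.1 y.1 i
  have h1 := add_crystalQ_le_left x.1 y.1 i
  rw [x.2, y.2] at h0
  rw [x.2] at h1
  omega

theorem classicalR_fst {n l m : ℕ} [NeZero n] (x : Crystal n l) (y : Crystal n m) (i : ZMod n) :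
    (classicalR x y).1.1 i + crystalQ i x.1 y.1 = y.1 i + crystalQ (i - 1) x.1 y.1 :=
  Nat.sub_add_cancel (crystalQ_le_pred i x.1 y.1)

theorem classicalR_snd {n l m : ℕ} [NeZero n] (x : Crystal n l) (y : Crystal n m) (i : ZMod n) :
    (classicalR x y).2.1 i + crystalQ (i - 1) x.1 y.1 = x.1 i + crystalQ i x.1 y.1 :=
  Nat.sub_add_cancel (crystalQ_pred_le i x.1 y.1)

theorem classicalR_conserves {n l m : ℕ} [NeZero n] (x : Crystal n l) (y : Crystal n m)
    (i : ZMod n) :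
    (classicalR x y).1.1 i + (classicalR x y).2.1 i = x.1 i + y.1 i := by
  have := classicalR_fst x y i
  have := classicalR_snd x y i
  omega

theorem classicalRv_fst {n l m : ℕ} [NeZero n] (x : Crystal n l) (y : Crystal n m) (i : ZMod n) :
    (classicalRv x y).1.1 i + crystalP (i - 1) x.1 y.1 = y.1 i + crystalP i x.1 y.1 :=
  Nat.sub_add_cancel ((crystalP_pred_le i x.1 y.1).2.trans (Nat.le_add_right _ _))

theorem classicalRv_snd {n l m : ℕ} [NeZero n] (x : Crystal n l) (y : Crystal n m) (i : ZMod n) :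
    (classicalRv x y).2.1 i + crystalP (i - 1) x.1 y.1 = x.1 i + crystalP i x.1 y.1 :=
  Nat.sub_add_cancel ((crystalP_pred_le i x.1 y.1).1.trans (Nat.le_add_right _ _))

theorem crystalP_pred {n : ℕ} (i : ZMod n) (x y : ZMod n → ℕ) :
    crystalP (i - 1) x y = min (x i) (y i) := by simp [crystalP]

theorem crystalP_comm {n : ℕ} (i : ZMod n) (x y : ZMod n → ℕ) :
    crystalP i x y = crystalP i y x := min_comm _ _

theorem Crystal.ext {n l : ℕ} [NeZero n] {x y : Crystal n l} (h : ∀ i, x.1 i = y.1 i) : x = y :=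
  Subtype.ext (funext h)

theorem classicalRv_swap {n l m : ℕ} [NeZero n] (x : Crystal n l) (y : Crystal n m) :
    (classicalRv x y).swap = classicalRv y x := by
  have h : ∀ i, crystalP i x.1 y.1 = crystalP i y.1 x.1 := fun i => crystalP_comm i _ _
  refine Prod.ext (Crystal.ext fun i => ?_) (Crystal.ext fun i => ?_) <;>
    simp only [classicalRv, Prod.fst_swap, Prod.snd_swap, h]

theorem classicalRvv_eq_swap {n l m : ℕ} [NeZero n] (x : Crystal n l) (y : Crystal n m) :
    classicalRvv x y = (classicalR y x).swap := rfl

theorem exists_eq_one {n : ℕ} [NeZero n] (b : Crystal n 1) : ∃ i, b.1 i = 1 := by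
  by_contra! h
  have h0 : ∀ i, b.1 i = 0 := fun i => by
    have h1 : b.1 i ≤ ∑ j, b.1 j := Finset.single_le_sum (fun _ _ => Nat.zero_le _)
      (Finset.mem_univ i)
    have h2 := b.2
    have := h i
    omega
  have := b.2
  simp [h0] at this

theorem add_le_of_ne {n l : ℕ} [NeZero n] (b : Crystal n l) {i j : ZMod n} (h : i ≠ j) :
    b.1 i + b.1 j ≤ l := by
  calc b.1 i + b.1 j = ∑ a ∈ {i, j}, b.1 a := (Finset.sum_pair h).symm
    _ ≤ ∑ a, b.1 a := Finset.sum_le_sum_of_subset (Finset.subset_univ _)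
    _ = l := b.2

theorem apply_le {n l : ℕ} [NeZero n] (b : Crystal n l) (i : ZMod n) : b.1 i ≤ l := by
  exact (Finset.single_le_sum (fun _ _ => Nat.zero_le _) (Finset.mem_univ i)).trans b.2.le

/-- A property that passes from `i` to `i - 1` spreads around the cycle. -/
theorem cyclic_induction {n : ℕ} [NeZero n] {p : ZMod n → Prop} {i₀ : ZMod n} (h0 : p i₀)
    (hs : ∀ i, p i → p (i - 1)) (i : ZMod n) : p i := by
  have key : ∀ t : ℕ, p (i₀ - t) := by
    intro t
    induction t with
    | zero => simpa using h0
    | succ t ih =>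
      have := hs _ ih
      push_cast
      rwa [← sub_sub]
  have := key (i₀ - i).val
  rwa [ZMod.natCast_zmod_val, sub_sub_cancel] at this

/-- For a single letter `b` the queue recursion has only one solution. -/
theorem eq_crystalQ_of_rec {n k : ℕ} [NeZero n] (hk : 1 ≤ k) (x : Crystal n k) (b : Crystal n 1)
    (f : ZMod n → ℕ) (hf : ∀ i, f (i - 1) + b.1 i = min (x.1 i + f i) 1) (i : ZMod n) :
    f i = crystalQ i x.1 b.1 := by
  obtain ⟨i₀, h0⟩ := exists_eq_one b
  have hq := crystalQ_rec_of_le x b hk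
  refine cyclic_induction (p := fun i => f i = crystalQ i x.1 b.1) (i₀ := i₀ - 1) ?_ ?_ i
  · have := hf i₀; have := hq i₀; omega
  · intro j hj
    have := hf j; have := hq j
    omega

/-- For `k < l` the queue recursion has only one periodic solution: two different solutions would
differ everywhere, and the smaller one would never reach the capacity `k`. -/
theorem queue_unique {n k l : ℕ} [NeZero n] (hkl : k < l) (x : Crystal n k) (y : Crystal n l)
    (f g : ZMod n → ℕ) (hf : ∀ i, x.1 i + f i = min (y.1 i + f (i - 1)) k)
    (hg : ∀ i, x.1 i + g i = min (y.1 i + g (i - 1)) k) : f = g := by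
  have key : ∀ f g : ZMod n → ℕ, (∀ i, x.1 i + f i = min (y.1 i + f (i - 1)) k) →
      (∀ i, x.1 i + g i = min (y.1 i + g (i - 1)) k) → ∀ i, f i ≤ g i := by
    intro f g hf hg i
    by_contra! hi
    have hall : ∀ j, g j < f j := cyclic_induction (i₀ := i) hi fun j hj => by
      have := hf j; have := hg j; omega
    have hsum : ∑ j, (x.1 j + g j) = ∑ j, (y.1 j + g (j - 1)) :=
      Finset.sum_congr rfl fun j _ => by
        have := hf j; have := hg j; have := hall j; omega
    have hg : ∑ j, g (j - 1) = ∑ j, g j := Equiv.sum_comp (Equiv.subRight (1 : ZMod n)) g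
    rw [Finset.sum_add_distrib, Finset.sum_add_distrib, x.2, y.2, hg] at hsum
    omega
  funext i
  exact le_antisymm (key f g hf hg i) (key g f hg hf i)

theorem crystalQ_classicalR_of_lt {n l m : ℕ} [NeZero n] (h : m < l) (x : Crystal n l)
    (y : Crystal n m) (i : ZMod n) :
    crystalQ i (classicalR x y).1.1 (classicalR x y).2.1 = crystalQ i x.1 y.1 := by
  refine congrFun (queue_unique h (classicalR x y).1 (classicalR x y).2 _
    (fun i => crystalQ i x.1 y.1)
    (crystalQ_rec_of_ge (classicalR x y).1 (classicalR x y).2 h.le) fun i => ?_) i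
  have := crystalQ_rec_of_le x y h.le i
  have := classicalR_fst x y i
  have := classicalR_snd x y i
  omega

/-- The recursion of `queue_unique` with `x` and `y` interchanged, in the other direction. -/
theorem queue_unique' {n k l : ℕ} [NeZero n] (hkl : k < l) (x : Crystal n l) (y : Crystal n k)
    (f g : ZMod n → ℕ) (hf : ∀ i, y.1 i + f (i - 1) = min (x.1 i + f i) k)
    (hg : ∀ i, y.1 i + g (i - 1) = min (x.1 i + g i) k) : f = g := by
  have key : ∀ f g : ZMod n → ℕ, (∀ i, y.1 i + f (i - 1) = min (x.1 i + f i) k) →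
      (∀ i, y.1 i + g (i - 1) = min (x.1 i + g i) k) → ∀ i, f i ≤ g i := by
    intro f g hf hg i
    by_contra! hi
    have hall : ∀ j, g j < f j := by
      have h1 : ∀ j, g j < f j → g (j - 1) < f (j - 1) ∨ g (j - 1) = f (j - 1) := fun j hj => by
        have := hf j; have := hg j; omega
      have h2 : ∀ j, ¬ g j < f j → ¬ g (j - 1) < f (j - 1) := fun j hj => by
        have := hf j; have := hg j; omega
      intro j
      by_contra hj
      exact (cyclic_induction (p := fun j => ¬ g j < f j) (i₀ := j) hj h2 i) hi
    have hsum : ∑ j, (x.1 j + g j) = ∑ j, (y.1 j + g (j - 1)) :=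
      Finset.sum_congr rfl fun j _ => by
        have := hf j; have := hg j; have := hall j; have := hall (j - 1); omega
    have hg : ∑ j, g (j - 1) = ∑ j, g j := Equiv.sum_comp (Equiv.subRight (1 : ZMod n)) g
    rw [Finset.sum_add_distrib, Finset.sum_add_distrib, x.2, y.2, hg] at hsum
    omega
  funext i
  exact le_antisymm (key f g hf hg i) (key g f hg hf i)

/-- The functions `Q_i` are invariant under the combinatorial `R`, since both families solve the
same queue recursion. -/
theorem crystalQ_classicalR {n l m : ℕ} [NeZero n] (h : l ≠ m) (x : Crystal n l)
    (y : Crystal n m) (i : ZMod n) :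
    crystalQ i (classicalR x y).1.1 (classicalR x y).2.1 = crystalQ i x.1 y.1 := by
  rcases h.lt_or_gt with h | h
  · refine congrFun (queue_unique' h (classicalR x y).1 (classicalR x y).2
      (fun i => crystalQ i (classicalR x y).1.1 (classicalR x y).2.1)
      (fun i => crystalQ i x.1 y.1)
      (crystalQ_rec_of_le (classicalR x y).1 (classicalR x y).2 h.le) fun i => ?_) i
    have := crystalQ_rec_of_ge x y h.le i
    have := classicalR_fst x y i
    have := classicalR_snd x y i
    omega
  · exact crystalQ_classicalR_of_lt h x y i

theorem classicalR_involutive {n l m : ℕ} [NeZero n] (h : l ≠ m) (x : Crystal n l)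
    (y : Crystal n m) :
    classicalR (classicalR x y).1 (classicalR x y).2 = (x, y) := by
  refine Prod.ext (Crystal.ext fun i => ?_) (Crystal.ext fun i => ?_)
  · have h1 := classicalR_fst (classicalR x y).1 (classicalR x y).2 i
    rw [crystalQ_classicalR h, crystalQ_classicalR h] at h1
    have := classicalR_snd x y i
    simp only
    omega
  · have h1 := classicalR_snd (classicalR x y).1 (classicalR x y).2 i
    rw [crystalQ_classicalR h, crystalQ_classicalR h] at h1
    have := classicalR_fst x y i
    simp only
    omega

theorem modifiedR_involutive {n l m : ℕ} [NeZero n] (h : l ≠ m) (a : Aff (Crystal n l))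
    (b : Aff (Crystal n m)) :
    modifiedR (modifiedR a b).1 (modifiedR a b).2 = (a, b) := by
  have h1 := classicalR_involutive h a.elt b.elt
  have h2 := crystalQ_classicalR h a.elt b.elt 0
  refine Prod.ext (Aff.ext ?_ (congrArg Prod.fst h1)) (Aff.ext ?_ (congrArg Prod.snd h1)) <;>
  · simp only [modifiedR, affinize, h2, min_comm (m : ℤ)]
    ring

theorem modifiedRvv_involutive {n l m : ℕ} [NeZero n] (h : l ≠ m) (a : Aff (Crystal n l))
    (b : Aff (Crystal n m)) :
    modifiedRvv (modifiedRvv a b).1 (modifiedRvv a b).2 = (a, b) := by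
  have h1 := classicalR_involutive h.symm b.elt a.elt
  have h2 := crystalQ_classicalR h.symm b.elt a.elt 0
  refine Prod.ext (Aff.ext ?_ (congrArg Prod.snd h1)) (Aff.ext ?_ (congrArg Prod.fst h1)) <;>
  · simp only [modifiedRvv, affinize, classicalRvv_eq_swap, Prod.fst_swap, Prod.snd_swap, h2,
      min_comm (m : ℤ)]
    ring

/-! ### The Yang–Baxter equation on `B_k ⊗ B_l ⊗ B_1` -/

/-- `SwapQueue q x y y' x'` says that `x ⊗ y ↦ y' ⊗ x'` is the combinatorial `R` for `k < l`,
written as a queue recursion whose queue `q` stands for the functions `Q_i`. -/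
def SwapQueue {n k l : ℕ} [NeZero n] (q : ZMod n → ℤ) (x : Crystal n k) (y y' : Crystal n l)
    (x' : Crystal n k) : Prop :=
  ∀ i, q i + x.1 i = min (y.1 i + q (i - 1)) k ∧ x'.1 i + q (i - 1) = x.1 i + q i ∧
    y'.1 i + q i = y.1 i + q (i - 1)

set_option maxHeartbeats 2000000 in
/-- What is needed at one index for the Yang–Baxter equation on `B_k ⊗ B_l ⊗ B_1`. The variables
`q₀, f₀, g₀, f₀'` are the values of `q, f, g, f'` at the preceding index. -/
theorem yangBaxter_local {k x y x' y' b d f f₀ g g₀ : ℕ} {q₀ q : ℤ}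
    (hq : q + x = min (y + q₀) k) (hx' : x' + q₀ = x + q) (hy' : y' + q = y + q₀)
    (hq₀ : q₀ ≤ k) (hb : b ≤ 1)
    (hf : b + f₀ = min (y + f) 1) (hd : d + f = b + f₀) (hg : d + g₀ = min (x + g) 1)
    (hf1 : f ≤ 1) (hg1 : g ≤ 1)
    (hi : ¬ (f = 0 ∧ g = 0 ∧ q = k)) (hi₀ : ¬ (f₀ = 0 ∧ g₀ = 0 ∧ q₀ = k)) :
    ∀ f' f₀' : ℕ, (f' = 0 ∧ f = 1 ∧ g = 0 ∧ q = k ∨ f' = f ∧ ¬ (f = 1 ∧ g = 0 ∧ q = k)) →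
    (f₀' = 0 ∧ f₀ = 1 ∧ g₀ = 0 ∧ q₀ = k ∨ f₀' = f₀ ∧ ¬ (f₀ = 1 ∧ g₀ = 0 ∧ q₀ = k)) →
    f₀' + b = min (x' + f') 1 ∧ (∀ d' : ℕ, d' + f' = b + f₀' →
      f₀ + g₀ - f₀' + d' = min (y' + (f + g - f')) 1) ∧
      q + f' - g + (x + g - g₀) = min (y + f - f₀ + (q₀ + f₀' - g₀)) k := by
  have hf01 : f₀ ≤ 1 := by omega
  have hg01 : g₀ ≤ 1 := by omega
  rintro f' f₀' (⟨rfl, hf'⟩ | ⟨rfl, hf'⟩) (⟨rfl, hf₀'⟩ | ⟨rfl, hf₀'⟩) <;>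
    refine ⟨?_, fun d' hd' => ?_, ?_⟩ <;> rcases min_choice (y + q₀) (k : ℤ) with hm | hm <;>
    rw [hm] at hq <;> omega

/-- The Yang–Baxter equation on `B_k ⊗ B_l ⊗ B_1`: after both carriers have passed the letter `b`,
in either order, the carriers are again related by the combinatorial `R`, with a new queue `q'`. -/
theorem swapQueue_step {n k l : ℕ} [NeZero n] (hk : 1 ≤ k) (hl : 1 ≤ l) {q : ZMod n → ℤ}
    {x : Crystal n k} {y y' : Crystal n l} {x' : Crystal n k} (h : SwapQueue q x y y' x')
    (b : Crystal n 1) :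
    (classicalR x (classicalR y b).1).1 = (classicalR y' (classicalR x' b).1).1 ∧
    ∃ q', SwapQueue q' (classicalR x (classicalR y b).1).2 (classicalR y b).2
      (classicalR y' (classicalR x' b).1).2 (classicalR x' b).2 := by
  set d := (classicalR y b).1 with hd
  have hf := crystalQ_rec_of_le y b hl
  have hg := crystalQ_rec_of_le x d hk
  have hy1 := classicalR_snd y b
  have hd1 := classicalR_fst y b
  have hx1 := classicalR_snd x d
  have he1 := classicalR_fst x d
  rw [← hd] at hd1
  obtain ⟨f, hF⟩ : ∃ f : ZMod n → ℕ, ∀ i, crystalQ i y.1 b.1 = f i := ⟨_, fun _ => rfl⟩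
  obtain ⟨g, hG⟩ : ∃ g : ZMod n → ℕ, ∀ i, crystalQ i x.1 d.1 = g i := ⟨_, fun _ => rfl⟩
  simp only [hF, hG] at hf hg hy1 hd1 hx1 he1
  have hbl : ∀ i, b.1 i ≤ 1 := apply_le b
  have hf1 : ∀ i, f i ≤ 1 := fun i => by
    have := hf (i + 1); rw [add_sub_cancel_right] at this; omega
  have hg1 : ∀ i, g i ≤ 1 := fun i => by
    have := hg (i + 1); rw [add_sub_cancel_right] at this; omega
  have hqk : ∀ i, q i ≤ k := fun i => by have := (h i).1; omega
  -- the carriers are never in the state excluded here, or they would be so everywhere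
  have hinv : ∀ i, ¬ (f i = 0 ∧ g i = 0 ∧ q i = k) := by
    intro i hi
    have hall := cyclic_induction (p := fun i => f i = 0 ∧ g i = 0 ∧ q i = k) (i₀ := i) hi
      fun j hj => by
        have := (h j).1; have := hf j; have := hg j; have := hd1 j; have := hqk (j - 1)
        have := hbl j
        omega
    have hz : ∀ j, x.1 j = 0 := fun j => by
      have := (h j).1; have := hall j; omega
    have := x.2
    simp [hz] at this
    omega
  -- `f'` is the queue of `x'` and `b`: it agrees with the queue `f` of `y` and `b`, except where `f`
  -- is occupied, the queue `g` of `x` and `d` is empty, and `q` is full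
  obtain ⟨f', hfd⟩ : ∃ f' : ZMod n → ℕ, ∀ i, f' i = 0 ∧ f i = 1 ∧ g i = 0 ∧ q i = k ∨
      f' i = f i ∧ ¬ (f i = 1 ∧ g i = 0 ∧ q i = k) :=
    ⟨fun i => if f i = 1 ∧ g i = 0 ∧ q i = k then 0 else f i, fun i => by
      dsimp only; split_ifs with h
      · exact Or.inl ⟨rfl, h⟩
      · exact Or.inr ⟨rfl, h⟩⟩
  have hle : ∀ i, f' i ≤ f i := fun i => by have := hfd i; omega
  have key := fun i => yangBaxter_local (h i).1 (h i).2.1 (h i).2.2 (hqk (i - 1)) (hbl i) (hf i)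
    (hd1 i) (hg i) (hf1 i) (hg1 i) (hinv i) (hinv (i - 1)) (f' i) (f' (i - 1)) (hfd _) (hfd _)
  have hf' : ∀ i, f' i = crystalQ i x'.1 b.1 := eq_crystalQ_of_rec hk x' b f' fun i => (key i).1
  have hd1' := classicalR_fst x' b
  have hx1' := classicalR_snd x' b
  set d' := (classicalR x' b).1 with hd'
  simp only [← hf'] at hd1' hx1'
  have hg' : ∀ i, f i + g i - f' i = crystalQ i y'.1 d'.1 :=
    eq_crystalQ_of_rec hl y' d' _ fun i => (key i).2.1 _ (hd1' i)
  have he1' := classicalR_fst y' d'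
  have hy1' := classicalR_snd y' d'
  simp only [← hg'] at he1' hy1'
  refine ⟨Crystal.ext fun i => ?_, fun i => q i + f' i - g i, fun i => ?_⟩
  · have := he1 i; have := he1' i; have := hd1 i; have := hd1' i
    have := hle i; have := hle (i - 1)
    omega
  · have h1 := (key i).2.2
    have := h i; have := hx1' i; have := hx1 i; have := hy1 i; have := hy1' i
    have := hle i; have := hle (i - 1)
    have e3 : ((classicalR x d).2.1 i : ℤ) = x.1 i + g i - g (i - 1) := by omega
    have e4 : ((classicalR y b).2.1 i : ℤ) = y.1 i + f i - f (i - 1) := by omega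
    have e5 : ((f i + g i - f' i : ℕ) : ℤ) = f i + g i - f' i := by omega
    have e6 : ((f (i - 1) + g (i - 1) - f' (i - 1) : ℕ) : ℤ) = f (i - 1) + g (i - 1) - f' (i - 1) :=
      by omega
    dsimp only
    refine ⟨?_, by omega, by omega⟩
    rw [e3, e4]
    exact h1

/-! ### The Yang–Baxter equation on `B_k ⊗ B_1 ⊗ B_1^∨` -/

theorem add_le_one_cases {x y z : ℕ} (h : x + y + z ≤ 1) :
    (x = 0 ∧ y = 0 ∧ z = 0) ∨ (x = 0 ∧ y = 0 ∧ z = 1) ∨ (x = 0 ∧ y = 1 ∧ z = 0) ∨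
      (x = 1 ∧ y = 0 ∧ z = 0) := by omega

set_option maxHeartbeats 2000000 in
/-- What is needed at one index for the Yang–Baxter equation on `B_k ⊗ B_1 ⊗ B_1^∨`. The suffixes
`₀, ₁, ₂` refer to three consecutive indices. -/
theorem mixedYangBaxter_local {v₀ v₁ v₂ b₀ b₁ b₂ a₀ a₁ a₂ f f₀ f₁ f₂ w₀ w₁ d₀ c₀ c₁ v' b' : ℕ}
    {P P₀ P₁ R R₀ S S₀ : ℕ}
    (ha : a₀ + a₁ + a₂ ≤ 1) (hb : b₀ + b₁ + b₂ ≤ 1)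
    (hf₀ : b₀ + f = min (v₀ + f₀) 1) (hf₁ : b₁ + f₀ = min (v₁ + f₁) 1)
    (hf₂ : b₂ + f₁ = min (v₂ + f₂) 1)
    (hw₀ : w₀ + f = v₀ + f₀) (hw₁ : w₁ + f₀ = v₁ + f₁)
    (hd₀ : d₀ + f₀ = b₀ + f)
    (hP : P = min w₀ a₀) (hP₀ : P₀ = min w₁ a₁)
    (hR : R = min b₀ a₀) (hR₀ : R₀ = min b₁ a₁) (hP₁ : P₁ = min b₂ a₂)
    (hc₀ : c₀ + R = a₀ + R₀) (hc₁ : c₁ + R₀ = a₁ + P₁)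
    (hS : S = min v₀ c₀) (hS₀ : S₀ = min v₁ c₁)
    (hv' : v' + S = v₀ + S₀) (hb' : b' + R = b₀ + R₀) :
    P + min d₀ (a₀ + P₀ - P) = R + S ∧ S ≤ f + P ∧ S₀ ≤ f₀ + P₀ ∧
      b' + (f + P - S) = min (v' + (f₀ + P₀ - S₀)) 1 := by
  obtain ⟨rfl, rfl, rfl⟩ | ⟨rfl, rfl, rfl⟩ | ⟨rfl, rfl, rfl⟩ | ⟨rfl, rfl, rfl⟩ :=
    add_le_one_cases ha <;> clear ha <;>
  obtain ⟨rfl, rfl, rfl⟩ | ⟨rfl, rfl, rfl⟩ | ⟨rfl, rfl, rfl⟩ | ⟨rfl, rfl, rfl⟩ :=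
    add_le_one_cases hb <;> clear hb <;>
  simp only [Nat.min_zero, Nat.zero_min, Nat.zero_add, min_self] at * <;>
  subst_vars <;>
  simp only [Nat.min_zero, Nat.add_zero, Nat.zero_add] at * <;>
  subst_vars <;>
  omega

theorem add_add_le_of_ne {n l : ℕ} [NeZero n] (b : Crystal n l) {i j k : ZMod n} (h : i ≠ j)
    (h' : i ≠ k) (h'' : j ≠ k) : b.1 i + b.1 j + b.1 k ≤ l := by
  calc b.1 i + b.1 j + b.1 k = ∑ a ∈ {i, j, k}, b.1 a := by
        rw [Finset.sum_insert (by simp [h, h']), Finset.sum_pair h'', add_assoc]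
    _ ≤ ∑ a, b.1 a := Finset.sum_le_sum_of_subset (Finset.subset_univ _)
    _ = l := b.2

theorem one_two_ne {n : ℕ} (hn : 3 ≤ n) (i : ZMod n) : i ≠ i + 1 ∧ i ≠ i + 1 + 1 ∧
    i + 1 ≠ i + 1 + 1 := by
  have h1 : (1 : ZMod n) ≠ 0 := by
    have := ZMod.natCast_eq_zero_iff 1 n
    rw [Nat.cast_one] at this
    rw [Ne, this]
    intro h; have := Nat.le_of_dvd one_pos h; omega
  have h2 : (1 + 1 : ZMod n) ≠ 0 := by
    have := ZMod.natCast_eq_zero_iff 2 n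
    push_cast at this
    rw [one_add_one_eq_two, Ne, this]
    intro h; have := Nat.le_of_dvd two_pos h; omega
  refine ⟨?_, ?_, ?_⟩
  · simpa using h1
  · rw [add_assoc]; simpa using h2
  · simpa using h1

/-- The Yang–Baxter equation on `B_k ⊗ B_1 ⊗ B_1^∨`. -/
theorem mixedYangBaxter {n k : ℕ} [NeZero n] (hn : 3 ≤ n) (hk : 1 ≤ k) (v : Crystal n k)
    (b a : Crystal n 1) :
    let r := classicalR v b
    let r' := classicalRv r.2 a
    let r'' := classicalRv r.1 r'.1
    let s := classicalRv b a
    let s' := classicalRv v s.1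
    let s'' := classicalR s'.2 s.2
    r''.1 = s'.1 ∧ r''.2 = s''.1 ∧ r'.2 = s''.2 := by
  intro r r' r'' s s' s''
  have hf := crystalQ_rec_of_le v b hk
  have hr1 := classicalR_fst v b
  have hr2 := classicalR_snd v b
  have key := fun i => by
    obtain ⟨n1, n2, n3⟩ := one_two_ne hn i
    have e1 := hf (i + 1); have e2 := hf (i + 1 + 1)
    have e3 := hr2 (i + 1)
    have p0 := crystalP_pred i r.2.1 a.1
    have p1 := crystalP_pred (i + 1) r.2.1 a.1
    have q0 := crystalP_pred i b.1 a.1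
    have q1 := crystalP_pred (i + 1) b.1 a.1
    have q2 := crystalP_pred (i + 1 + 1) b.1 a.1
    have s0 := crystalP_pred i v.1 s.1.1
    have s1 := crystalP_pred (i + 1) v.1 s.1.1
    have t0 := classicalRv_fst b a i
    have t1 := classicalRv_fst b a (i + 1)
    have u0 := classicalRv_snd v s.1 i
    have w0 := classicalRv_snd b a i
    rw [add_sub_cancel_right] at e1 e2 e3 p1 q1 q2 s1 t1
    exact mixedYangBaxter_local (add_add_le_of_ne a n1 n2 n3) (add_add_le_of_ne b n1 n2 n3)
      (hf i) e1 e2 (hr2 i) e3 (hr1 i) p0 p1 q0 q1 q2 t0 t1 s0 s1 u0 w0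
  have hP2 : ∀ i, crystalP i r.2.1 a.1 + crystalP i r.1.1 r'.1.1
      = crystalP i b.1 a.1 + crystalP i v.1 s.1.1 := fun i => by
    have h := (key (i + 1)).1
    have h' := crystalP_pred (i + 1) r.1.1 r'.1.1
    have h'' := classicalRv_fst r.2 a (i + 1)
    rw [add_sub_cancel_right] at h h' h''
    have e : r'.1.1 (i + 1) = a.1 (i + 1) + crystalP (i + 1) r.2.1 a.1 - crystalP i r.2.1 a.1 := by
      change (classicalRv r.2 a).1.1 (i + 1) = _
      omega
    rw [h', e]
    exact h
  have hle : ∀ i, crystalP i v.1 s.1.1 ≤ crystalQ i v.1 b.1 + crystalP i r.2.1 a.1 :=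
    fun i => (key i).2.2.1
  have hf'' := eq_crystalQ_of_rec hk s'.2 s.2
    (fun i => crystalQ i v.1 b.1 + crystalP i r.2.1 a.1 - crystalP i v.1 s.1.1)
    fun i => by
      rw [add_comm]; exact (key i).2.2.2
  have h1 : ∀ i, r''.1.1 i + crystalP (i - 1) r.1.1 r'.1.1 = r'.1.1 i + crystalP i r.1.1 r'.1.1 :=
    classicalRv_fst _ _
  have h2 : ∀ i, r'.1.1 i + crystalP (i - 1) r.2.1 a.1 = a.1 i + crystalP i r.2.1 a.1 :=
    classicalRv_fst _ _
  have h3 : ∀ i, s.1.1 i + crystalP (i - 1) b.1 a.1 = a.1 i + crystalP i b.1 a.1 :=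
    classicalRv_fst _ _
  have h4 : ∀ i, s'.1.1 i + crystalP (i - 1) v.1 s.1.1 = s.1.1 i + crystalP i v.1 s.1.1 :=
    classicalRv_fst _ _
  have g1 : ∀ i, r''.2.1 i + crystalP (i - 1) r.1.1 r'.1.1 = r.1.1 i + crystalP i r.1.1 r'.1.1 :=
    classicalRv_snd _ _
  have g2 : ∀ i, r'.2.1 i + crystalP (i - 1) r.2.1 a.1 = r.2.1 i + crystalP i r.2.1 a.1 :=
    classicalRv_snd _ _
  have g3 : ∀ i, s.2.1 i + crystalP (i - 1) b.1 a.1 = b.1 i + crystalP i b.1 a.1 :=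
    classicalRv_snd _ _
  have g4 : ∀ i, s'.2.1 i + crystalP (i - 1) v.1 s.1.1 = v.1 i + crystalP i v.1 s.1.1 :=
    classicalRv_snd _ _
  have k1 : ∀ i, s''.1.1 i + crystalQ i s'.2.1 s.2.1 = s.2.1 i + crystalQ (i - 1) s'.2.1 s.2.1 :=
    classicalR_fst _ _
  have k2 : ∀ i, s''.2.1 i + crystalQ (i - 1) s'.2.1 s.2.1 = s'.2.1 i + crystalQ i s'.2.1 s.2.1 :=
    classicalR_snd _ _
  have hr1' : ∀ i, r.1.1 i + crystalQ i v.1 b.1 = b.1 i + crystalQ (i - 1) v.1 b.1 := hr1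
  have hr2' : ∀ i, r.2.1 i + crystalQ (i - 1) v.1 b.1 = v.1 i + crystalQ i v.1 b.1 := hr2
  simp only [← hf''] at k1 k2
  clear_value r r' r'' s s' s''
  clear key hf hr1 hr2 hf''
  refine ⟨Crystal.ext fun i => ?_, Crystal.ext fun i => ?_, Crystal.ext fun i => ?_⟩
  · have := h1 i; have := h2 i; have := h3 i; have := h4 i; have := hP2 i; have := hP2 (i - 1)
    omega
  · have := g1 i; have := hr1' i; have := g3 i; have := k1 i; have := hP2 i; have := hP2 (i - 1)
    have := hle i; have := hle (i - 1)
    omega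
  · have := g2 i; have := hr2' i; have := g4 i; have := k2 i; have := hP2 i; have := hP2 (i - 1)
    have := hle i; have := hle (i - 1)
    omega

/-! ### Carriers passing words -/

/-- A carrier in `B_k` passes, from left to right, a word of elements of `B_1`. -/
def runR {n k : ℕ} [NeZero n] (v : Crystal n k) :
    List (Crystal n 1) → List (Crystal n 1) × Crystal n k
  | [] => ([], v)
  | b :: L => ((classicalR v b).1 :: (runR (classicalR v b).2 L).1, (runR (classicalR v b).2 L).2)

/-- An element of `B_k` passes, from left to right, a word of elements of `B_1^∨`. -/
def cross {n k : ℕ} [NeZero n] (v : Crystal n k) :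
    List (Crystal n 1) → List (Crystal n 1) × Crystal n k
  | [] => ([], v)
  | a :: L =>
    ((classicalRv v a).1 :: (cross (classicalRv v a).2 L).1, (cross (classicalRv v a).2 L).2)

/-- The normal form of a word of local states: all elements of `B_1^∨` are moved to the left of
all elements of `B_1`. -/
def normalForm {n : ℕ} [NeZero n] :
    List (LocalState n) → List (Crystal n 1) × List (Crystal n 1)
  | [] => ([], [])
  | s :: L => ((cross s.1 (s.2 :: (normalForm L).1)).1,
      (cross s.1 (s.2 :: (normalForm L).1)).2 :: (normalForm L).2)

/-- A carrier in `B_k` passes, from left to right, a word of local states. -/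
def runState {n k : ℕ} [NeZero n] (v : Crystal n k) :
    List (LocalState n) → List (LocalState n) × Crystal n k
  | [] => ([], v)
  | b :: L => ((passRight v b).1 :: (runState (passRight v b).2 L).1,
      (runState (passRight v b).2 L).2)

/-- The Yang–Baxter equation on `B_k ⊗ B_1 ⊗ (B_1^∨)^{⊗ L}`. -/
theorem cross_runR_comm {n k : ℕ} [NeZero n] (hn : 3 ≤ n) (hk : 1 ≤ k) (Λ : List (Crystal n 1)) :
    ∀ (v : Crystal n k) (b : Crystal n 1),
    (cross (classicalR v b).1 (cross (classicalR v b).2 Λ).1).1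
      = (cross v (cross b Λ).1).1 ∧
    (cross (classicalR v b).1 (cross (classicalR v b).2 Λ).1).2
      = (classicalR (cross v (cross b Λ).1).2 (cross b Λ).2).1 ∧
    (cross (classicalR v b).2 Λ).2 = (classicalR (cross v (cross b Λ).1).2 (cross b Λ).2).2 := by
  induction Λ with
  | nil => intro v b; simp [cross]
  | cons a Λ ih =>
    intro v b
    obtain ⟨h1, h2, h3⟩ := mixedYangBaxter hn hk v b a
    have h := ih (classicalRv v (classicalRv b a).1).2 (classicalRv b a).2
    simp only [cross]
    rw [h3, h2, h1]
    exact ⟨congrArg _ h.1, h.2⟩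

/-- Carriers act on the normal form of a word in the same way as on the word. -/
theorem normalForm_runState {n k : ℕ} [NeZero n] (hn : 3 ≤ n) (hk : 1 ≤ k)
    (L : List (LocalState n)) : ∀ v : Crystal n k,
    normalForm (runState v L).1 = ((cross v (normalForm L).1).1,
      (runR (cross v (normalForm L).1).2 (normalForm L).2).1) ∧
    (runState v L).2 = (runR (cross v (normalForm L).1).2 (normalForm L).2).2 := by
  induction L with
  | nil => intro v; simp [normalForm, cross, runR, runState]
  | cons s L ih =>
    intro v
    have h := ih (passRight v s).2
    have hc := cross_runR_comm hn hk (s.2 :: (normalForm L).1) v s.1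
    simp only [runState, normalForm, h.1, runR]
    rw [← hc.1, ← hc.2.1, ← hc.2.2]
    exact ⟨rfl, h.2⟩

/-- A carrier in `B_k^∨` passes, from right to left, a word of elements of `B_1`. -/
def crossLeft {n k : ℕ} [NeZero n] (w : Crystal n k) :
    List (Crystal n 1) → List (Crystal n 1) × Crystal n k
  | [] => ([], w)
  | b :: L => ((classicalRv b (crossLeft w L).2).2 :: (crossLeft w L).1,
      (classicalRv b (crossLeft w L).2).1)

/-- A carrier in `B_k^∨` passes, from right to left, a word of elements of `B_1^∨`. -/
def runLeft {n k : ℕ} [NeZero n] (w : Crystal n k) :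
    List (Crystal n 1) → List (Crystal n 1) × Crystal n k
  | [] => ([], w)
  | a :: L => ((classicalRvv a (runLeft w L).2).2 :: (runLeft w L).1,
      (classicalRvv a (runLeft w L).2).1)

/-- A carrier in `B_k^∨` passes, from right to left, a word of local states. -/
def runStateLeft {n k : ℕ} [NeZero n] (w : Crystal n k) :
    List (LocalState n) → List (LocalState n) × Crystal n k
  | [] => ([], w)
  | s :: L => ((passLeft s (runStateLeft w L).2).2 :: (runStateLeft w L).1,
      (passLeft s (runStateLeft w L).2).1)

/-- The Yang–Baxter equation on `B_1 ⊗ (B_1^∨)^{⊗ L} ⊗ B_k^∨`. By the symmetry between `R` and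
`R^{∨∨}` it is again an instance of `mixedYangBaxter`. -/
theorem cross_runLeft_comm {n k : ℕ} [NeZero n] (hn : 3 ≤ n) (hk : 1 ≤ k)
    (Λ : List (Crystal n 1)) : ∀ (w : Crystal n k) (b : Crystal n 1),
    (runLeft (classicalRv (cross b Λ).2 w).1 (cross b Λ).1).1
      = (cross (classicalRv b (runLeft w Λ).2).2 (runLeft w Λ).1).1 ∧
    (classicalRv (cross b Λ).2 w).2
      = (cross (classicalRv b (runLeft w Λ).2).2 (runLeft w Λ).1).2 ∧
    (runLeft (classicalRv (cross b Λ).2 w).1 (cross b Λ).1).2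
      = (classicalRv b (runLeft w Λ).2).1 := by
  induction Λ with
  | nil => intro w b; simp [cross, runLeft]
  | cons a Λ ih =>
    intro w b
    have h := ih w (classicalRv b a).2
    obtain ⟨h1, h2, h3⟩ := mixedYangBaxter hn hk (runLeft w Λ).2 a b
    simp only [cross, runLeft, classicalRvv_eq_swap, Prod.fst_swap, Prod.snd_swap]
    rw [h.1, h.2.1, h.2.2, ← classicalRv_swap a b, Prod.snd_swap, Prod.fst_swap,
      ← classicalRv_swap (runLeft w Λ).2, Prod.snd_swap, Prod.fst_swap,
      ← classicalRv_swap _ b, Prod.snd_swap, Prod.fst_swap,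
      ← classicalRv_swap (classicalR (runLeft w Λ).2 a).1, Prod.snd_swap, Prod.fst_swap,
      h1, h2, h3]
    exact ⟨rfl, rfl, rfl⟩

theorem normalForm_runStateLeft {n k : ℕ} [NeZero n] (hn : 3 ≤ n) (hk : 1 ≤ k)
    (L : List (LocalState n)) : ∀ w : Crystal n k,
    normalForm (runStateLeft w L).1
      = ((runLeft (crossLeft w (normalForm L).2).2 (normalForm L).1).1,
        (crossLeft w (normalForm L).2).1) ∧
    (runStateLeft w L).2 = (runLeft (crossLeft w (normalForm L).2).2 (normalForm L).1).2 := by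
  induction L with
  | nil => intro v; simp [normalForm, crossLeft, runLeft, runStateLeft]
  | cons s L ih =>
    intro w
    have h := ih w
    have hc := cross_runLeft_comm hn hk (s.2 :: (normalForm L).1)
      (crossLeft w (normalForm L).2).2 s.1
    simp only [runStateLeft, normalForm, h.1, crossLeft]
    rw [hc.1, hc.2.1, hc.2.2]
    simp only [passLeft, h.2, runLeft, and_self]

/-! ### Carriers on words: conservation, relaxation, commutation -/

theorem runR_append {n k : ℕ} [NeZero n] (v : Crystal n k) (L L' : List (Crystal n 1)) :
    runR v (L ++ L') = ((runR v L).1 ++ (runR (runR v L).2 L').1, (runR (runR v L).2 L').2) := by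
  induction L generalizing v with
  | nil => simp [runR]
  | cons b L ih => simp [runR, ih]

theorem length_runR {n k : ℕ} [NeZero n] (v : Crystal n k) (L : List (Crystal n 1)) :
    (runR v L).1.length = L.length := by
  induction L generalizing v with
  | nil => rfl
  | cons b L ih => simp [runR, ih]

theorem runR_conserves {n k : ℕ} [NeZero n] (v : Crystal n k) (L : List (Crystal n 1))
    (i : ZMod n) :
    (runR v L).2.1 i + ((runR v L).1.map fun b => b.1 i).sum
      = v.1 i + (L.map fun b => b.1 i).sum := by
  induction L generalizing v with
  | nil => rfl
  | cons b L ih =>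
    have := ih (classicalR v b).2
    have := classicalR_conserves v b i
    simp only [runR, List.map_cons, List.sum_cons]
    omega

theorem runR_avoids {n k : ℕ} [NeZero n] {c : ZMod n} {v : Crystal n k}
    {L : List (Crystal n 1)} (hv : v.1 c = 0) (hL : ∀ b ∈ L, b.1 c = 0) :
    ∀ b ∈ (runR v L).1, b.1 c = 0 := by
  induction L generalizing v with
  | nil => simp [runR]
  | cons b L ih =>
    have h1 := classicalR_conserves v b c
    have h2 := hL b (by simp)
    intro b' hb'
    simp only [runR, List.mem_cons] at hb'
    rcases hb' with rfl | hb'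
    · omega
    · exact ih (by omega) (fun a ha => hL a (by simp [ha])) b' hb'

theorem runLeft_eq {n k : ℕ} [NeZero n] (w : Crystal n k) (L : List (Crystal n 1)) :
    runLeft w L = ((runR w L.reverse).1.reverse, (runR w L.reverse).2) := by
  induction L with
  | nil => rfl
  | cons a L ih =>
    simp [runLeft, ih, runR_append, runR, classicalRvv_eq_swap]

theorem runR_comm_of_swapQueue {n k l : ℕ} [NeZero n] (hk : 1 ≤ k) (hl : 1 ≤ l)
    (L : List (Crystal n 1)) : ∀ {q : ZMod n → ℤ} {x : Crystal n k} {y y' : Crystal n l}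
    {x' : Crystal n k}, SwapQueue q x y y' x' →
    (runR x (runR y L).1).1 = (runR y' (runR x' L).1).1 := by
  induction L with
  | nil => intros; rfl
  | cons b L ih =>
    intro q x y y' x' h
    obtain ⟨h1, q', h2⟩ := swapQueue_step hk hl h b
    simp only [runR, h1, ih h2]

/-- The word that results when the carrier `u_k` (all letters equal to `e`) passes a word. -/
def passWord {n : ℕ} [NeZero n] (e : ZMod n) (k : ℕ) (L : List (Crystal n 1)) :
    List (Crystal n 1) :=
  (runR (multiple k e) L).1

theorem multiple_apply {n : ℕ} [NeZero n] (l : ℕ) (i j : ZMod n) :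
    (multiple l i).1 j = if j = i then l else 0 := by
  simp [multiple, Pi.single_apply]

theorem passWord_comm_of_lt {n k l : ℕ} [NeZero n] (hk : 1 ≤ k) (hkl : k < l) (e : ZMod n)
    (L : List (Crystal n 1)) :
    passWord e k (passWord e l L) = passWord e l (passWord e k L) := by
  refine runR_comm_of_swapQueue (q := 0) hk (hk.trans hkl.le) L fun i => ?_
  simp only [multiple_apply, Pi.zero_apply, add_zero, and_true]
  split_ifs
  · simp; omega
  · simp

/-- The time evolutions with different carriers commute. -/
theorem passWord_comm {n k l : ℕ} [NeZero n] (hk : 1 ≤ k) (hl : 1 ≤ l) (e : ZMod n) :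
    Function.Commute (passWord e k) (passWord (n := n) e l) := by
  intro L
  rcases lt_trichotomy k l with h | rfl | h
  · exact passWord_comm_of_lt hk h e L
  · rfl
  · exact (passWord_comm_of_lt hl h e L).symm

theorem classicalR_multiple_letter {n k : ℕ} [NeZero n] (hk : 1 ≤ k) (e : ZMod n) :
    classicalR (multiple k e) (letter e) = (letter e, multiple k e) := by
  have hq := eq_crystalQ_of_rec hk (multiple k e) (letter e) (fun _ => 0) fun i => by
    simp only [letter, multiple_apply]
    split_ifs <;> omega
  refine Prod.ext (Crystal.ext fun i => ?_) (Crystal.ext fun i => ?_)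
  · have := classicalR_fst (multiple k e) (letter e) i
    rw [← hq, ← hq] at this
    simpa using this
  · have := classicalR_snd (multiple k e) (letter e) i
    rw [← hq, ← hq] at this
    simpa using this

theorem runR_multiple_replicate {n k : ℕ} [NeZero n] (hk : 1 ≤ k) (e : ZMod n) (M : ℕ) :
    runR (multiple k e) (List.replicate M (letter e))
      = (List.replicate M (letter e), multiple k e) := by
  induction M with
  | zero => rfl
  | succ M ih => simp [List.replicate_succ, runR, classicalR_multiple_letter hk, ih]

theorem cyclic_induction_up {n : ℕ} [NeZero n] {p : ZMod n → Prop} {i₀ : ZMod n} (h0 : p i₀)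
    (hs : ∀ i, p i → p (i + 1)) (i : ZMod n) : p i := by
  have key : ∀ t : ℕ, p (i₀ + t) := by
    intro t
    induction t with
    | zero => simpa using h0
    | succ t ih =>
      have := hs _ ih
      push_cast
      rwa [← add_assoc]
  have := key (i - i₀).val
  rwa [ZMod.natCast_zmod_val, add_sub_cancel] at this

theorem eq_multiple {n k : ℕ} [NeZero n] {e : ZMod n} {v : Crystal n k} (h : k ≤ v.1 e) :
    v = multiple k e := by
  refine Crystal.ext fun i => ?_
  rw [multiple_apply]
  split_ifs with hi
  · subst hi; exact le_antisymm (apply_le v i) h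
  · have := add_le_of_ne v hi; omega

/-- Each vacuum letter makes a carrier drop a letter different from the vacuum, if there is one. -/
theorem classicalR_letter_relax {n k : ℕ} [NeZero n] (hk : 1 ≤ k) (e : ZMod n)
    (v : Crystal n k) : min (v.1 e + 1) k ≤ (classicalR v (letter e)).2.1 e := by
  have hf := crystalQ_rec_of_le v (letter e) hk
  have h2 := classicalR_snd v (letter e) e
  have he : (letter e).1 e = 1 := by simp [letter, multiple_apply]
  have hf0 := hf e
  by_cases h0 : crystalQ e v.1 (letter e).1 = 0
  · have hall := cyclic_induction_up (p := fun i => crystalQ i v.1 (letter e).1 = 0) h0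
      fun i hi => by
        by_cases hie : i + 1 = e
        · rw [hie]; exact h0
        · have := hf (i + 1)
          rw [add_sub_cancel_right, hi] at this
          have h1 : (letter e).1 (i + 1) = 0 := by simp [letter, multiple_apply, hie]
          omega
    have hz : ∀ i, i ≠ e → v.1 i = 0 := fun i hi => by
      have := hf i
      rw [hall, hall] at this
      have h1 : (letter e).1 i = 0 := by simp [letter, multiple_apply, hi]
      omega
    have hs : ∑ i, v.1 i = v.1 e := Fintype.sum_eq_single e hz
    have := v.2
    omega
  · omega

theorem runR_replicate_relax {n k : ℕ} [NeZero n] (hk : 1 ≤ k) (e : ZMod n) (M : ℕ) :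
    ∀ v : Crystal n k, k ≤ v.1 e + M →
      (runR v (List.replicate M (letter e))).2 = multiple k e := by
  induction M with
  | zero => intro v hv; exact (eq_multiple (by simpa using hv) : v = multiple k e)
  | succ M ih =>
    intro v hv
    have := classicalR_letter_relax hk e v
    exact ih _ (by have := apply_le v e; omega)

/-- The carrier is back in its initial state after `k` vacuum letters at the end of the word, and
further vacuum letters are not affected. -/
theorem runR_trailing {n k : ℕ} [NeZero n] (hk : 1 ≤ k) (e : ZMod n) (L : List (Crystal n 1))
    {M : ℕ} (hM : k ≤ M) :
    (runR (multiple k e) (L ++ List.replicate M (letter e))).2 = multiple k e ∧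
    passWord e k (L ++ List.replicate M (letter e))
      = passWord e k (L ++ List.replicate k (letter e)) ++ List.replicate (M - k) (letter e) := by
  obtain ⟨M, rfl⟩ := Nat.exists_eq_add_of_le hM
  have h : (runR (multiple k e) (L ++ List.replicate k (letter e))).2 = multiple k e := by
    rw [runR_append]
    exact runR_replicate_relax hk e k _ (Nat.le_add_left _ _)
  rw [List.replicate_add, ← List.append_assoc, passWord, runR_append, h,
    runR_multiple_replicate hk, Nat.add_sub_cancel_left]
  exact ⟨rfl, rfl⟩

/-- Each time step uses up at most `k` of the vacuum letters at the end of the word. -/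
theorem runR_iterate_passWord {n k : ℕ} [NeZero n] (hk : 1 ≤ k) (e : ZMod n) (s : ℕ) :
    ∀ (L : List (Crystal n 1)) {M : ℕ}, (s + 1) * k ≤ M →
    (runR (multiple k e) ((passWord e k)^[s] (L ++ List.replicate M (letter e)))).2
      = multiple k e := by
  induction s with
  | zero => intro L M hM; exact (runR_trailing hk e L (by simpa using hM)).1
  | succ s ih =>
    intro L M hM
    have : (s + 1 + 1) * k = (s + 1) * k + k := by ring
    rw [Function.iterate_succ_apply, (runR_trailing hk e L (by omega)).2]
    exact ih _ (by omega)

theorem passWord_replicate {n k : ℕ} [NeZero n] (hk : 1 ≤ k) (e : ZMod n) (M : ℕ) :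
    passWord e k (List.replicate M (letter e)) = List.replicate M (letter e) := by
  rw [passWord, runR_multiple_replicate hk]

/-! ### Words without interaction, injectivity of the normal form -/

theorem classicalRv_of_disjoint {n l m : ℕ} [NeZero n] {x : Crystal n l} {y : Crystal n m}
    (h : ∀ i, min (x.1 i) (y.1 i) = 0) : classicalRv x y = (y, x) := by
  have hP : ∀ i, crystalP i x.1 y.1 = 0 := fun i => h (i + 1)
  refine Prod.ext (Crystal.ext fun i => ?_) (Crystal.ext fun i => ?_)
  · have := classicalRv_fst x y i
    rw [hP, hP] at this
    simpa using this
  · have := classicalRv_snd x y i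
    rw [hP, hP] at this
    simpa using this

theorem cross_of_disjoint {n k : ℕ} [NeZero n] {v : Crystal n k} {Λ : List (Crystal n 1)}
    (h : ∀ a ∈ Λ, ∀ i, min (v.1 i) (a.1 i) = 0) : cross v Λ = (Λ, v) := by
  induction Λ with
  | nil => rfl
  | cons a Λ ih =>
    simp only [cross, classicalRv_of_disjoint (h a (by simp)),
      ih fun a ha => h a (by simp [ha])]

theorem crossLeft_of_disjoint {n k : ℕ} [NeZero n] {w : Crystal n k} {X : List (Crystal n 1)}
    (h : ∀ b ∈ X, ∀ i, min (b.1 i) (w.1 i) = 0) : crossLeft w X = (X, w) := by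
  induction X with
  | nil => rfl
  | cons a Λ ih =>
    simp only [crossLeft, ih fun a ha => h a (by simp [ha]),
      classicalRv_of_disjoint (h a (by simp))]

theorem min_multiple_eq_zero {n k : ℕ} [NeZero n] {c : ZMod n} {b : Crystal n 1}
    (h : b.1 c = 0) (i : ZMod n) : min ((multiple k c).1 i) (b.1 i) = 0 := by
  rw [multiple_apply]
  split_ifs with hi
  · rw [hi, h, min_eq_right (Nat.zero_le _)]
  · simp

theorem classicalRv_injective {n l m : ℕ} [NeZero n] {x x' : Crystal n l} {y y' : Crystal n m}
    (h : classicalRv x y = classicalRv x' y') : x = x' ∧ y = y' := by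
  have hP : ∀ (x : Crystal n l) (y : Crystal n m) i, crystalP i x.1 y.1
      = min ((classicalRv x y).1.1 i) ((classicalRv x y).2.1 i) := fun x y i => by
    have := classicalRv_fst x y i; have := classicalRv_snd x y i
    have := crystalP_pred i x.1 y.1
    omega
  have e : ∀ i, crystalP i x.1 y.1 = crystalP i x'.1 y'.1 := fun i => by rw [hP, hP, h]
  refine ⟨Crystal.ext fun i => ?_, Crystal.ext fun i => ?_⟩
  · have h1 := classicalRv_snd x y i; have := classicalRv_snd x' y' i
    rw [h, e, e] at h1
    omega
  · have h1 := classicalRv_fst x y i; have := classicalRv_fst x' y' i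
    rw [h, e, e] at h1
    omega

theorem cross_injective {n k : ℕ} [NeZero n] (Λ : List (Crystal n 1)) :
    ∀ (Λ' : List (Crystal n 1)) {v v' : Crystal n k}, cross v Λ = cross v' Λ' →
      v = v' ∧ Λ = Λ' := by
  induction Λ with
  | nil =>
    intro Λ' v v' h
    cases Λ' with
    | nil => exact ⟨congrArg Prod.snd h, rfl⟩
    | cons a Λ' => simp [cross] at h
  | cons a Λ ih =>
    intro Λ' v v' h
    cases Λ' with
    | nil => simp [cross] at h
    | cons a' Λ' =>
      simp only [cross, Prod.mk.injEq, List.cons.injEq] at h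
      obtain ⟨h1, rfl⟩ := ih Λ' (Prod.ext h.1.2 h.2)
      obtain ⟨rfl, rfl⟩ := classicalRv_injective (Prod.ext h.1.1 h1)
      exact ⟨rfl, rfl⟩

theorem normalForm_injective {n : ℕ} [NeZero n] :
    Function.Injective (normalForm : List (LocalState n) → _) := by
  intro L
  induction L with
  | nil =>
    intro L' h
    cases L' with
    | nil => rfl
    | cons s L' => simp [normalForm] at h
  | cons s L ih =>
    intro L' h
    cases L' with
    | nil => simp [normalForm] at h
    | cons s' L' =>
      simp only [normalForm, Prod.mk.injEq, List.cons.injEq] at h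
      obtain ⟨h1, h2⟩ := cross_injective _ _ (Prod.ext h.1 h.2.1)
      simp only [List.cons.injEq] at h2
      rw [Prod.ext h1 h2.1, ih (Prod.ext h2.2 h.2.2)]

/-! ### Time evolution of words -/

/-- The letter `c` with `vac = 1 ⊗ c̄`. -/
def Boundary.dualVac {n : ℕ} : Boundary n → ZMod n
  | .rotateLeft => 0
  | .switch1n _ => 0
  | .switch12 _ => 2

theorem map_multiple_one {n : ℕ} [NeZero n] (hn : 3 ≤ n) (κ : Boundary n) (k : ℕ) :
    κ.map (multiple k 1) = multiple k κ.dualVac := by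
  have v1 : (1 : ZMod n).val = 1 := by
    have := ZMod.val_natCast_of_lt (show 1 < n by omega)
    rwa [Nat.cast_one] at this
  have key : κ.index κ.dualVac = 1 := by
    cases κ with
    | rotateLeft => simp [Boundary.index, Boundary.dualVac]
    | switch1n h => simp [Boundary.index, Boundary.dualVac]
    | switch12 h =>
      have h2 : ((2 : ZMod n)).val = 2 := by
        have := ZMod.val_natCast_of_lt (show 2 < n by omega)
        exact_mod_cast this
      simp only [Boundary.index, Boundary.dualVac, h2]
      norm_num
  refine Crystal.ext fun i => ?_
  rw [multiple_apply]
  change (multiple k 1).1 (κ.index i) = _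
  rw [multiple_apply]
  refine if_congr ?_ rfl rfl
  rw [← key, κ.index_bijective.1.eq_iff]

theorem vac_eq {n : ℕ} [NeZero n] (hn : 3 ≤ n) (κ : Boundary n) :
    vac κ = (letter 1, letter κ.dualVac) := by
  rw [vac, letter, map_multiple_one hn]; rfl

theorem one_ne_dualVac {n : ℕ} (hn : 3 ≤ n) (κ : Boundary n) : (1 : ZMod n) ≠ κ.dualVac := by
  have h0 := (one_two_ne hn 0).1
  have h1 := (one_two_ne hn 0).2.2
  rw [zero_add] at h0 h1
  cases κ with
  | rotateLeft => exact h0.symm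
  | switch1n h => exact h0.symm
  | switch12 h => rwa [Boundary.dualVac, ← one_add_one_eq_two]

theorem letter_apply {n : ℕ} [NeZero n] (i j : ZMod n) :
    (letter i).1 j = if j = i then 1 else 0 := multiple_apply 1 i j

theorem passRight_vac {n k : ℕ} [NeZero n] (hn : 3 ≤ n) (hk : 1 ≤ k) (κ : Boundary n) :
    passRight (multiple k 1) (vac κ) = (vac κ, multiple k 1) := by
  have h := classicalRv_of_disjoint (min_multiple_eq_zero (k := k) (c := (1 : ZMod n))
    (b := letter κ.dualVac) (by rw [letter_apply, if_neg (one_ne_dualVac hn κ)]))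
  simp only [vac_eq hn, passRight, classicalR_multiple_letter hk, h]

theorem passLeft_vac {n k : ℕ} [NeZero n] (hn : 3 ≤ n) (hk : 1 ≤ k) (κ : Boundary n) :
    passLeft (vac κ) (multiple k κ.dualVac) = (multiple k κ.dualVac, vac κ) := by
  have h := classicalRv_of_disjoint (x := letter 1) (y := multiple k κ.dualVac) fun i => by
    rw [min_comm]
    exact min_multiple_eq_zero (by rw [letter_apply, if_neg (one_ne_dualVac hn κ).symm]) i
  simp only [vac_eq hn, passLeft, classicalRvv_eq_swap, classicalR_multiple_letter hk,
    Prod.swap_prod_mk, h]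

theorem ofList_cons_of_lt {n : ℕ} [NeZero n] (κ : Boundary n) (s : LocalState n)
    (L : List (LocalState n)) {j : ℕ} (h : j < L.length) :
    ofList κ (s :: L) j = ofList κ L j := by
  simp only [ofList, List.reverse_cons]
  rw [List.getD_append _ _ _ _ (by simpa using h)]

theorem ofList_cons_length {n : ℕ} [NeZero n] (κ : Boundary n) (s : LocalState n)
    (L : List (LocalState n)) : ofList κ (s :: L) L.length = s := by
  simp [ofList]

theorem ofList_of_le {n : ℕ} [NeZero n] (κ : Boundary n) {L : List (LocalState n)} {j : ℕ}
    (h : L.length ≤ j) : ofList κ L j = vac κ := by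
  simp [ofList, List.getD_eq_getElem?_getD, h]

theorem ofList_vac_append {n : ℕ} [NeZero n] (κ : Boundary n) (L : List (LocalState n)) (A : ℕ) :
    ofList κ (List.replicate A (vac κ) ++ L) = ofList κ L := by
  induction A with
  | zero => rfl
  | succ A ih =>
    rw [← ih]
    funext j
    rw [List.replicate_succ, List.cons_append]
    rcases lt_trichotomy j (List.replicate A (vac κ) ++ L).length with h | h | h
    · exact ofList_cons_of_lt κ _ _ h
    · rw [h, ofList_cons_length, ofList_of_le κ le_rfl]
    · rw [ofList_of_le κ h.le, ofList_of_le κ (by simpa using h)]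

theorem runState_append {n k : ℕ} [NeZero n] (v : Crystal n k) (L L' : List (LocalState n)) :
    runState v (L ++ L') = ((runState v L).1 ++ (runState (runState v L).2 L').1,
      (runState (runState v L).2 L').2) := by
  induction L generalizing v with
  | nil => simp [runState]
  | cons b L ih => simp [runState, ih]

theorem length_runState {n k : ℕ} [NeZero n] (v : Crystal n k) (L : List (LocalState n)) :
    (runState v L).1.length = L.length := by
  induction L generalizing v with
  | nil => rfl
  | cons b L ih => simp [runState, ih]

theorem length_runStateLeft {n k : ℕ} [NeZero n] (v : Crystal n k) (L : List (LocalState n)) :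
    (runStateLeft v L).1.length = L.length := by
  induction L with
  | nil => rfl
  | cons b L ih => simp [runStateLeft, ih]

theorem rightCarrier_of_le {n k : ℕ} [NeZero n] {p : Config n} {N j : ℕ} (h : N ≤ j) :
    rightCarrier k p N j = multiple k 1 := by
  rw [rightCarrier, if_neg (by omega)]

theorem rightCarrier_of_lt {n k : ℕ} [NeZero n] {p : Config n} {N j : ℕ} (h : j < N) :
    rightCarrier k p N j = (passRight (rightCarrier k p N (j + 1)) (p j)).2 := by
  rw [rightCarrier, if_pos h]

theorem rightCarrier_succ {n k : ℕ} [NeZero n] {p p' : Config n} {N : ℕ}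
    (h : ∀ j, p' (j + 1) = p j) (d : ℕ) : ∀ {j : ℕ}, N = j + d →
    rightCarrier k p' (N + 1) (j + 1) = rightCarrier k p N j := by
  induction d with
  | zero => intro j hj; rw [rightCarrier_of_le (by omega), rightCarrier_of_le (by omega)]
  | succ d ih =>
    intro j hj
    rw [rightCarrier_of_lt (by omega), rightCarrier_of_lt (j := j) (by omega), h,
      ih (by omega : N = j + 1 + d)]

theorem rightCarrier_eq_of_vac {n k : ℕ} [NeZero n] (hn : 3 ≤ n) (hk : 1 ≤ k) {κ : Boundary n}
    {p : Config n} {N : ℕ} (h : ∀ j, N ≤ j → p j = vac κ) (N' d : ℕ) : ∀ {j : ℕ}, N' ≤ j + d →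
    N ≤ N' → rightCarrier k p N' j = rightCarrier k p N j := by
  induction d with
  | zero => intro j hj hN; rw [rightCarrier_of_le (by omega), rightCarrier_of_le (by omega)]
  | succ d ih =>
    intro j hj hN
    rcases le_or_gt N' j with h1 | h1
    · rw [rightCarrier_of_le h1, rightCarrier_of_le (by omega)]
    · rw [rightCarrier_of_lt h1, ih (j := j + 1) (by omega) hN]
      rcases le_or_gt N j with h2 | h2
      · rw [rightCarrier_of_le h2, rightCarrier_of_le (by omega), h j h2, passRight_vac hn hk]
      · rw [rightCarrier_of_lt h2]

theorem ofList_concat_zero {n : ℕ} [NeZero n] (κ : Boundary n) (L : List (LocalState n))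
    (s : LocalState n) : ofList κ (L ++ [s]) 0 = s := by simp [ofList]

theorem ofList_concat_succ {n : ℕ} [NeZero n] (κ : Boundary n) (L : List (LocalState n))
    (s : LocalState n) (j : ℕ) : ofList κ (L ++ [s]) (j + 1) = ofList κ L j := by
  simp [ofList]

theorem rightCarrier_ofList {n k : ℕ} [NeZero n] (κ : Boundary n)
    (L : List (LocalState n)) :
    rightCarrier k (ofList κ L) L.length 0 = (runState (multiple k 1) L).2 ∧
    ∀ j, j < L.length →
      (passRight (rightCarrier k (ofList κ L) L.length (j + 1)) (ofList κ L j)).1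
        = ofList κ (runState (multiple k 1) L).1 j := by
  induction L using List.reverseRecOn with
  | nil => exact ⟨rightCarrier_of_le le_rfl, by simp⟩
  | append_singleton L s ih =>
    have hs : ∀ j, j ≤ L.length →
        rightCarrier k (ofList κ (L ++ [s])) (L ++ [s]).length (j + 1)
        = rightCarrier k (ofList κ L) L.length j := fun j hj => by
      rw [List.length_append]
      exact rightCarrier_succ (ofList_concat_succ κ L s) (L.length - j) (by omega)
    rw [runState_append]
    simp only [runState]
    refine ⟨?_, fun j hj => ?_⟩
    · rw [rightCarrier_of_lt (by simp), hs 0 (Nat.zero_le _), ofList_concat_zero, ih.1]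
    · cases j with
      | zero => rw [hs 0 (Nat.zero_le _), ofList_concat_zero, ofList_concat_zero, ih.1]
      | succ j =>
        have : j < L.length := by simpa using hj
        rw [hs (j + 1) this, ofList_concat_succ, ofList_concat_succ, ih.2 j this]

theorem leftCarrier_congr {n k : ℕ} [NeZero n] {q q' : Config n} (w : Crystal n k) {j : ℕ}
    (h : ∀ i, i < j → q i = q' i) : leftCarrier q w j = leftCarrier q' w j := by
  induction j with
  | zero => rfl
  | succ j ih =>
    rw [leftCarrier, leftCarrier, h j (by omega), ih fun i hi => h i (by omega)]

theorem leftCarrier_ofList {n k : ℕ} [NeZero n] (κ : Boundary n) (w : Crystal n k)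
    (L : List (LocalState n)) :
    leftCarrier (ofList κ L) w L.length = (runStateLeft w L).2 ∧
    ∀ j, j < L.length → (passLeft (ofList κ L j) (leftCarrier (ofList κ L) w j)).2
        = ofList κ (runStateLeft w L).1 j := by
  induction L with
  | nil => exact ⟨rfl, by simp⟩
  | cons s L ih =>
    have hs : ∀ j, j ≤ L.length → leftCarrier (ofList κ (s :: L)) w j
        = leftCarrier (ofList κ L) w j := fun j hj =>
      leftCarrier_congr w fun i hi => ofList_cons_of_lt κ s L (by omega)
    simp only [runStateLeft]
    refine ⟨?_, fun j hj => ?_⟩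
    · rw [List.length_cons, leftCarrier, hs _ le_rfl, ofList_cons_length, ih.1]
    · rw [List.length_cons, Nat.lt_succ_iff] at hj
      rw [hs j hj]
      rcases hj.lt_or_eq with h | rfl
      · rw [ofList_cons_of_lt κ _ _ h, ih.2 j h,
          ofList_cons_of_lt κ _ _ (by rwa [length_runStateLeft])]
      · rw [ofList_cons_length, ih.1, ← length_runStateLeft w L, ofList_cons_length]

/-- For a state given by a finite word, `T_k` is one run of the carrier `u_k` to the right and one
of `κ(u_k)` back to the left, provided that both carriers come back to their initial states. -/
theorem timeEvolution_ofList {n k : ℕ} [NeZero n] (hn : 3 ≤ n) (hk : 1 ≤ k) (κ : Boundary n)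
    (L : List (LocalState n))
    (h : (runState (multiple k 1) L).2 = multiple k 1)
    (h' : (runStateLeft (multiple k κ.dualVac) (runState (multiple k 1) L).1).2
      = multiple k κ.dualVac) :
    timeEvolution κ k (ofList κ L)
      = ofList κ (runStateLeft (multiple k κ.dualVac) (runState (multiple k 1) L).1).1 := by
  have hmem : L.length ∈ {N : ℕ | ∀ j, N ≤ j → ofList κ L j = vac κ} :=
    fun j hj => ofList_of_le κ hj
  have hN := Nat.sInf_mem ⟨_, hmem⟩
  have hle := Nat.sInf_le hmem
  simp only [timeEvolution]
  generalize sInf {N : ℕ | ∀ j, N ≤ j → ofList κ L j = vac κ} = N at *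
  have hc : ∀ j, rightCarrier k (ofList κ L) N j = rightCarrier k (ofList κ L) L.length j :=
    fun j => (rightCarrier_eq_of_vac hn hk hN L.length L.length (by omega) hle).symm
  simp only [hc]
  obtain ⟨h1, h2⟩ := rightCarrier_ofList (k := k) κ L
  have hp : (fun j => (passRight (rightCarrier k (ofList κ L) L.length (j + 1))
      (ofList κ L j)).1) = ofList κ (runState (multiple k 1) L).1 := by
    funext j
    rcases lt_or_ge j L.length with hj | hj
    · exact h2 j hj
    · rw [rightCarrier_of_le (by omega), ofList_of_le κ hj, passRight_vac hn hk,
        ofList_of_le κ (by rwa [length_runState])]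
  rw [hp, h1, h, map_multiple_one hn]
  obtain ⟨h3, h4⟩ := leftCarrier_ofList κ (multiple k κ.dualVac) (runState (multiple k 1) L).1
  have hout : ∀ d, leftCarrier (ofList κ (runState (multiple k 1) L).1) (multiple k κ.dualVac)
      ((runState (multiple k 1) L).1.length + d) = multiple k κ.dualVac := fun d => by
    induction d with
    | zero => rw [add_zero, h3, h']
    | succ d ih =>
      rw [← add_assoc, leftCarrier, ih, ofList_of_le κ (Nat.le_add_right _ _),
        passLeft_vac hn hk]
  funext j
  have hpj := congrFun hp j
  beta_reduce at hpj
  rw [hpj]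
  rcases lt_or_ge j (runState (multiple k 1) L).1.length with hj | hj
  · exact h4 j hj
  · obtain ⟨d, rfl⟩ := Nat.exists_eq_add_of_le hj
    rw [hout, ofList_of_le κ hj, passLeft_vac hn hk,
      ofList_of_le κ (by rwa [length_runStateLeft])]

/-! ### Decoupling of the time evolution on normal forms -/

/-- One time step on the normal form. A carrier `u_k` contains only vacuum letters, which the word
of the other kind avoids, so it goes through that word unchanged. -/
theorem timeEvolution_normalForm {n k : ℕ} [NeZero n] (hn : 3 ≤ n) (hk : 1 ≤ k) (κ : Boundary n)
    {L : List (LocalState n)} {Λ X : List (Crystal n 1)} (hL : normalForm L = (Λ.reverse, X))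
    (hΛ : ∀ a ∈ Λ, a.1 1 = 0) (hX : ∀ b ∈ X, b.1 κ.dualVac = 0)
    (cX : (runR (multiple k 1) X).2 = multiple k 1)
    (cΛ : (runR (multiple k κ.dualVac) Λ).2 = multiple k κ.dualVac) :
    ∃ L' : List (LocalState n), timeEvolution κ k (ofList κ L) = ofList κ L' ∧
      normalForm L' = ((passWord κ.dualVac k Λ).reverse, passWord 1 k X) := by
  obtain ⟨h1, h2⟩ := normalForm_runState hn hk L (multiple k 1)
  have hc : cross (multiple k (1 : ZMod n)) Λ.reverse = (Λ.reverse, multiple k 1) :=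
    cross_of_disjoint fun a ha => min_multiple_eq_zero (hΛ a (List.mem_reverse.1 ha))
  rw [hL, hc] at h1 h2
  rw [cX] at h2
  obtain ⟨h3, h4⟩ := normalForm_runStateLeft hn hk (runState (multiple k 1) L).1
    (multiple k κ.dualVac)
  have hX' : ∀ b ∈ (runR (multiple k 1) X).1, b.1 κ.dualVac = 0 :=
    runR_avoids (by rw [multiple_apply, if_neg (one_ne_dualVac hn κ).symm]) hX
  have hc' : crossLeft (multiple k κ.dualVac) (runR (multiple k 1) X).1
      = ((runR (multiple k 1) X).1, multiple k κ.dualVac) :=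
    crossLeft_of_disjoint fun b hb i => by
      rw [min_comm]; exact min_multiple_eq_zero (hX' b hb) i
  rw [h1] at h3 h4
  simp only [hc', runLeft_eq, List.reverse_reverse] at h3 h4
  exact ⟨_, timeEvolution_ofList hn hk κ L h2 (h4.trans cΛ), h3⟩

theorem passWord_iterate_avoids {n k : ℕ} [NeZero n] {c e : ZMod n} (h : c ≠ e)
    {X : List (Crystal n 1)} (hX : ∀ b ∈ X, b.1 c = 0) (T : ℕ) :
    ∀ b ∈ (passWord e k)^[T] X, b.1 c = 0 := by
  induction T with
  | zero => exact hX
  | succ T ih =>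
    rw [Function.iterate_succ_apply']
    exact runR_avoids (by rw [multiple_apply, if_neg h]) ih

/-- On the normal form, the time evolution acts on the two components separately. The words must
end with sufficiently many vacuum letters for the carriers to return to their initial states. -/
theorem timeEvolution_iterate {n k : ℕ} [NeZero n] (hn : 3 ≤ n) (hk : 1 ≤ k) (κ : Boundary n)
    {L : List (LocalState n)} {Λ X : List (Crystal n 1)} {T M M' : ℕ}
    (hL : normalForm L
      = ((Λ ++ List.replicate M' (letter κ.dualVac)).reverse, X ++ List.replicate M (letter 1)))
    (hΛ : ∀ a ∈ Λ, a.1 1 = 0) (hX : ∀ b ∈ X, b.1 κ.dualVac = 0)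
    (hM : T * k ≤ M) (hM' : T * k ≤ M') :
    ∃ L' : List (LocalState n), (timeEvolution κ k)^[T] (ofList κ L) = ofList κ L' ∧
      normalForm L'
        = (((passWord κ.dualVac k)^[T] (Λ ++ List.replicate M' (letter κ.dualVac))).reverse,
          (passWord 1 k)^[T] (X ++ List.replicate M (letter 1))) := by
  have hne := one_ne_dualVac hn κ
  have hΛ' : ∀ a ∈ Λ ++ List.replicate M' (letter κ.dualVac), a.1 1 = 0 := fun a ha => by
    rcases List.mem_append.1 ha with ha | ha
    · exact hΛ a ha
    · rw [List.eq_of_mem_replicate ha, letter_apply, if_neg hne]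
  have hX' : ∀ a ∈ X ++ List.replicate M (letter 1), a.1 κ.dualVac = 0 := fun a ha => by
    rcases List.mem_append.1 ha with ha | ha
    · exact hX a ha
    · rw [List.eq_of_mem_replicate ha, letter_apply, if_neg hne.symm]
  induction T with
  | zero => exact ⟨L, rfl, hL⟩
  | succ T ih =>
    have : (T + 1) * k = T * k + k := by ring
    obtain ⟨L₁, h1, h2⟩ := ih (by omega) (by omega)
    obtain ⟨L₂, h3, h4⟩ := timeEvolution_normalForm hn hk κ h2
      (passWord_iterate_avoids hne hΛ' T) (passWord_iterate_avoids hne.symm hX' T)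
      (runR_iterate_passWord hk 1 T X hM) (runR_iterate_passWord hk _ T Λ hM')
    exact ⟨L₂, by rw [Function.iterate_succ_apply', h1, h3], by
      rw [h4, Function.iterate_succ_apply', Function.iterate_succ_apply']⟩

/-! ### A carrier meets a weakly decreasing word -/

/-- The letter of rank `ρ` with respect to the vacuum letter `e`. Both ranks `0` and `n` stand for
`e` itself. -/
def ranked {n : ℕ} [NeZero n] (e : ZMod n) (ρ : ℕ) : Crystal n 1 := letter (e + (ρ : ZMod n))

theorem ranked_add_self {n : ℕ} [NeZero n] (e : ZMod n) (ρ : ℕ) :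
    ranked e (ρ + n) = ranked e ρ := by simp [ranked]

theorem ranked_zero {n : ℕ} [NeZero n] (e : ZMod n) : ranked e 0 = letter e := by simp [ranked]

theorem ranked_self {n : ℕ} [NeZero n] (e : ZMod n) : ranked e n = letter e := by simp [ranked]

theorem add_natCast_inj {n : ℕ} {e : ZMod n} {a b : ℕ} (h : e + (a : ZMod n) = e + b)
    (h1 : a < b + n) (h2 : b < a + n) : a = b := by
  have h := add_left_cancel h
  rw [ZMod.natCast_eq_natCast_iff] at h
  have h3 : (n : ℤ) ∣ (b : ℤ) - a := Nat.modEq_iff_dvd.1 h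
  have h4 : (b : ℤ) - a = 0 := by
    apply Int.eq_zero_of_abs_lt_dvd h3
    rw [abs_lt]; constructor <;> omega
  omega

/-- A carrier that absorbs the letter `b` releases the first letter `d` that it contains among
`b - 1, b - 2, …, b - n = b`. -/
theorem classicalR_letter_fst {n k : ℕ} [NeZero n] (hk : 1 ≤ k) {v : Crystal n k} {d : ZMod n}
    {t : ℕ} (h1 : 1 ≤ t) (hn : t ≤ n) (hd : 0 < v.1 d)
    (hv : ∀ u : ℕ, 1 ≤ u → u < t → v.1 (d + u) = 0) :
    (classicalR v (letter (d + t))).1 = letter d := by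
  have hn0 : 0 < n := Nat.pos_of_ne_zero (NeZero.ne n)
  set f : ZMod n → ℕ := fun i => if (i - d).val < t then 0 else 1 with hf
  have hrep : ∀ i : ZMod n, ∃ u < n, i = d + u := fun i =>
    ⟨(i - d).val, ZMod.val_lt _, by rw [ZMod.natCast_zmod_val]; ring⟩
  have hval : ∀ u < n, f (d + u) = if u < t then 0 else 1 := fun u hu => by
    simp only [hf, add_sub_cancel_left, ZMod.val_natCast_of_lt hu]
  have hb : ∀ u < n, (letter (d + (t : ZMod n))).1 (d + u)
      = if u = t ∨ (u = 0 ∧ t = n) then 1 else 0 := fun u hu => by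
    rw [letter_apply]
    refine if_congr ⟨fun h => ?_, ?_⟩ rfl rfl
    · rcases hn.lt_or_eq with h2 | h2
      · exact Or.inl (add_natCast_inj h (by omega) (by omega))
      · subst h2
        refine Or.inr ⟨add_natCast_inj (e := d) (b := 0) ?_ (by omega) (by omega), rfl⟩
        simpa using h
    · rintro (rfl | ⟨rfl, rfl⟩)
      · rfl
      · simp
  have hpred : ∀ u < n, f (d + u - 1) = if u = 0 then (if t = n then 0 else 1)
      else if u - 1 < t then 0 else 1 := fun u hu => by
    split_ifs with h h2 h2
    · have : d + (u : ZMod n) - 1 = d + (n - 1 : ℕ) := by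
        rw [h, Nat.cast_sub (by omega)]; simp [sub_eq_add_neg]
      rw [this, hval _ (by omega), if_pos (by omega)]
    · have : d + (u : ZMod n) - 1 = d + (n - 1 : ℕ) := by
        rw [h, Nat.cast_sub (by omega)]; simp [sub_eq_add_neg]
      rw [this, hval _ (by omega), if_neg (by omega)]
    · have : d + (u : ZMod n) - 1 = d + (u - 1 : ℕ) := by
        rw [Nat.cast_sub (by omega)]; simp [add_sub_assoc]
      rw [this, hval _ (by omega), if_pos h2]
    · have : d + (u : ZMod n) - 1 = d + (u - 1 : ℕ) := by
        rw [Nat.cast_sub (by omega)]; simp [add_sub_assoc]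
      rw [this, hval _ (by omega), if_neg h2]
  have hq := eq_crystalQ_of_rec hk v (letter (d + t)) f fun i => by
    obtain ⟨u, hu, rfl⟩ := hrep i
    rw [hpred u hu, hb u hu, hval u hu]
    rcases Nat.eq_zero_or_pos u with rfl | h0
    · rw [Nat.cast_zero, add_zero]
      split_ifs <;> omega
    · rcases lt_or_ge u t with h | h
      · rw [hv u h0 h]
        split_ifs <;> omega
      · split_ifs <;> omega
  refine Crystal.ext fun i => ?_
  have h3 := classicalR_fst v (letter (d + t)) i
  rw [← hq, ← hq] at h3
  obtain ⟨u, hu, rfl⟩ := hrep i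
  rw [hpred u hu, hb u hu, hval u hu] at h3
  rw [letter_apply]
  have : d + (u : ZMod n) = d ↔ u = 0 := by
    refine ⟨fun h => add_natCast_inj (e := d) (b := 0) (by simpa using h) (by omega) (by omega),
      ?_⟩
    rintro rfl; simp
  rw [if_congr this rfl rfl]
  split_ifs at h3 ⊢ <;> omega

theorem classicalR_ranked_fst {n k : ℕ} [NeZero n] (hk : 1 ≤ k) {e : ZMod n} {v : Crystal n k}
    {d b : ℕ} (h1 : d < b) (hn : b ≤ d + n) (hd : 0 < v.1 (e + d))
    (hv : ∀ ρ : ℕ, d < ρ → ρ < b → v.1 (e + ρ) = 0) :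
    (classicalR v (ranked e b)).1 = ranked e d := by
  have := classicalR_letter_fst hk (t := b - d) (by omega) (by omega) hd fun u h2 h3 => by
    rw [add_assoc, ← Nat.cast_add]
    exact hv _ (by omega) (by omega)
  rwa [add_assoc, ← Nat.cast_add, Nat.add_sub_cancel' h1.le] at this

/-- The multiplicity of the letter `i` in a word given by ranks. -/
def content {n : ℕ} [NeZero n] (e : ZMod n) (L : List ℕ) (i : ZMod n) : ℕ :=
  ((L.map (ranked e)).map fun b => b.1 i).sum

theorem content_cons {n : ℕ} [NeZero n] (e : ZMod n) (a : ℕ) (L : List ℕ) (i : ZMod n) :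
    content e (a :: L) i = (ranked e a).1 i + content e L i := by simp [content]

theorem content_append {n : ℕ} [NeZero n] (e : ZMod n) (L L' : List ℕ) (i : ZMod n) :
    content e (L ++ L') i = content e L i + content e L' i := by simp [content]

theorem content_eq_zero {n : ℕ} [NeZero n] {e : ZMod n} {L : List ℕ} {i : ZMod n}
    (h : ∀ a ∈ L, i ≠ e + (a : ZMod n)) : content e L i = 0 := by
  induction L with
  | nil => rfl
  | cons a L ih =>
    rw [content_cons, ranked, letter_apply, if_neg (h a (by simp)), zero_add]
    exact ih fun a ha => h a (by simp [ha])

theorem content_eq_count {n : ℕ} [NeZero n] (e : ZMod n) {L : List ℕ} {ρ : ℕ}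
    (h : ∀ a ∈ L, ρ < a + n ∧ a < ρ + n) : content e L (e + ρ) = L.count ρ := by
  induction L with
  | nil => rfl
  | cons a L ih =>
    have h1 := h a (by simp)
    rw [content_cons, ranked, letter_apply, ih fun a ha => h a (by simp [ha]), List.count_cons,
      add_comm]
    congr 1
    by_cases h2 : a = ρ
    · simp [h2]
    · rw [if_neg fun h3 => h2 (add_natCast_inj h3 h1.1 h1.2).symm, if_neg (by simpa using h2)]

/-- A carrier meeting a weakly decreasing word behaves as a first-in-first-out queue `C`, except for
`x` copies of the vacuum letter that stay in the carrier. -/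
theorem runR_fifo {n k : ℕ} [NeZero n] (hk : 1 ≤ k) (e : ZMod n) (x : ℕ) (R : List ℕ) :
    ∀ (C : List ℕ) (v : Crystal n k), C ≠ [] →
    (∀ i, v.1 i = content e C i + if i = e then x else 0) →
    (C ++ R).Pairwise (· ≥ ·) → (∀ ρ ∈ C ++ R, ρ ≤ n) →
    (∀ j c b : ℕ, (C ++ R)[j]? = some c → R[j]? = some b →
      ¬ (c = n ∧ b = 0) ∧ (0 < x → c = n ∨ b = 0)) →
    (runR v (R.map (ranked e))).1 = ((C ++ R).take R.length).map (ranked e) ∧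
    ∀ i, (runR v (R.map (ranked e))).2.1 i
      = content e ((C ++ R).drop R.length) i + if i = e then x else 0 := by
  induction R with
  | nil => intro C v _ hv _ _ _; simpa [runR] using hv
  | cons b R ih =>
    intro C v hC hv hs hle hw
    obtain ⟨c, C, rfl⟩ := List.exists_cons_of_ne_nil hC
    have hw0 := hw 0 c b (by simp) (by simp)
    have hcb : ∀ a ∈ c :: C, b ≤ a ∧ a ≤ c := fun a ha => by
      rw [List.cons_append, List.pairwise_cons] at hs
      refine ⟨?_, ?_⟩
      · rcases List.mem_cons.1 ha with rfl | ha
        · exact hs.1 b (by simp)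
        · exact (List.pairwise_append.1 hs.2).2.2 a ha b (by simp)
      · rcases List.mem_cons.1 ha with rfl | ha
        · exact le_rfl
        · exact hs.1 a (by simp [ha])
    have hbc := (hcb c (by simp)).1
    have hcn := hle c (by simp)
    have hout : (classicalR v (ranked e b)).1 = ranked e c := by
      rw [← ranked_add_self]
      refine classicalR_ranked_fst hk (by omega) (by omega) ?_ fun ρ h1 h2 => ?_
      · rw [hv, content_cons, ranked, letter_apply, if_pos rfl]; omega
      · rw [hv, content_eq_zero fun a ha h => ?_, zero_add]
        · split_ifs with h
          · have h3 : ρ = n := add_natCast_inj (e := e) (by simpa using h) (by omega) (by omega)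
            omega
          · rfl
        · have h4 := hcb a ha
          have := add_natCast_inj h (by omega) (by omega)
          omega
    have hC' : C ++ b :: R = C ++ [b] ++ R := by simp
    have hcons := classicalR_conserves v (ranked e b)
    rw [hout] at hcons
    obtain ⟨h1, h2⟩ := ih (C ++ [b]) (classicalR v (ranked e b)).2 (by simp) (fun i => by
        have := hcons i
        rw [hv i, content_cons] at this
        rw [content_append, content_cons]
        simp only [content, List.map_nil, List.sum_nil] at this ⊢
        omega)
      (by rw [← hC']; exact (List.pairwise_cons.1 hs).2)
      (by rw [← hC']; exact fun ρ hρ => hle ρ (List.mem_cons_of_mem _ hρ))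
      (fun j c' b' h h' => hw (j + 1) c' b' (by rw [← hC'] at h; simpa using h) (by simpa using h'))
    rw [← hC'] at h1 h2
    simp only [List.map_cons, runR, hout, h1, List.cons_append, List.length_cons,
      List.take_succ_cons, List.drop_succ_cons]
    exact ⟨trivial, h2⟩

/-- A weakly decreasing word is replaced by copies of a single letter `i`, if the carrier contains
sufficiently many of them and no letter between `i` and the letters of the word. -/
theorem runR_const {n k : ℕ} [NeZero n] (hk : 1 ≤ k) (e : ZMod n) {i : ℕ} (hi : i < n)
    (S : List ℕ) : ∀ v : Crystal n k, S.Pairwise (· ≥ ·) → (∀ b ∈ S, i < b ∧ b ≤ n) →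
    (∀ ρ, i < ρ → ρ < n → 0 < v.1 (e + ρ) → ∀ b ∈ S, b ≤ ρ) →
    S.length ≤ v.1 (e + i) + S.count (i + n) →
    (runR v (S.map (ranked e))).1 = (List.replicate S.length i).map (ranked e) := by
  induction S with
  | nil => intros; rfl
  | cons b S ih =>
    intro v hs hS hocc hlen
    rw [List.pairwise_cons] at hs
    have hb := hS b (by simp)
    have hpos : 0 < v.1 (e + i) := by
      rcases eq_or_ne b (i + n) with h | h
      · have hi0 : i = 0 := by omega
        subst hi0
        by_contra h0
        have hz : ∀ j, v.1 j = 0 := fun j => by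
          have hj : j = e + ((j - e).val : ℕ) := by rw [ZMod.natCast_zmod_val]; ring
          rcases Nat.eq_zero_or_pos (j - e).val with h1 | h1
          · rw [hj, h1]; omega
          · by_contra h2
            have h3 := ZMod.val_lt (j - e)
            have := hocc (j - e).val h1 h3 (by rw [← hj]; omega) b (by simp)
            omega
        have := v.2
        rw [Finset.sum_eq_zero fun j _ => hz j] at this
        omega
      · have : (b :: S).count (i + n) = 0 := List.count_eq_zero.2 fun hm => by
          rcases List.mem_cons.1 hm with h1 | h1
          · exact h h1.symm
          · have := hs.1 _ h1; omega
        rw [List.length_cons] at hlen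
        omega
    have hout : (classicalR v (ranked e b)).1 = ranked e i :=
      classicalR_ranked_fst hk hb.1 (by omega) hpos fun ρ h1 h2 => by
        by_contra h0
        have := hocc ρ h1 (by omega) (by omega) b (by simp)
        omega
    have hcons := classicalR_conserves v (ranked e b)
    rw [hout] at hcons
    simp only [List.map_cons, runR, hout, List.length_cons, List.replicate_succ]
    refine congrArg (List.cons _) (ih _ hs.2 (fun a ha => hS a (by simp [ha]))
      (fun ρ h1 h2 h3 a ha => ?_) ?_)
    · by_cases h : ρ = b
      · rw [h]; exact hs.1 a ha
      · refine hocc ρ h1 h2 ?_ a (by simp [ha])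
        have := hcons (e + ρ)
        have h4 : (ranked e b).1 (e + ρ) = 0 := by
          rw [ranked, letter_apply, if_neg fun h3 => h (add_natCast_inj h3 (by omega) (by omega))]
        omega
    · have h1 := hcons (e + i)
      have h2 : (ranked e i).1 (e + i) = 1 := by rw [ranked, letter_apply, if_pos rfl]
      have h3 : (ranked e b).1 (e + i) = if b = i + n then 1 else 0 := by
        rw [ranked, letter_apply]
        refine if_congr ⟨fun h => ?_, ?_⟩ rfl rfl
        · exact add_natCast_inj (e := e) (by rw [← h]; simp) (by omega) (by omega)
        · rintro rfl; simp
      rw [List.count_cons, List.length_cons] at hlen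
      simp only [beq_iff_eq] at hlen
      omega

/-- The weakly decreasing word with letters `i, …, 1` and multiplicities `f`. -/
def descWord (f : ℕ → ℕ) : ℕ → List ℕ
  | 0 => []
  | i + 1 => List.replicate (f (i + 1)) (i + 1) ++ descWord f i

theorem mem_descWord {f : ℕ → ℕ} {i a : ℕ} (h : a ∈ descWord f i) : 1 ≤ a ∧ a ≤ i := by
  induction i with
  | zero => simp [descWord] at h
  | succ i ih =>
    rcases List.mem_append.1 h with h | h
    · rw [List.eq_of_mem_replicate h]; omega
    · have := ih h; omega

theorem pairwise_descWord (f : ℕ → ℕ) (i : ℕ) : (descWord f i).Pairwise (· ≥ ·) := by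
  induction i with
  | zero => exact List.Pairwise.nil
  | succ i ih =>
    refine List.pairwise_append.2 ⟨List.pairwise_replicate.2 (Or.inr le_rfl), ih,
      fun a ha b hb => ?_⟩
    rw [List.eq_of_mem_replicate ha]
    have := mem_descWord hb
    omega

theorem count_descWord (f : ℕ → ℕ) {i ρ : ℕ} (h1 : 1 ≤ ρ) (h2 : ρ ≤ i) :
    (descWord f i).count ρ = f ρ := by
  induction i with
  | zero => omega
  | succ i ih =>
    rw [descWord, List.count_append, List.count_replicate]
    rcases h2.lt_or_eq with h | rfl
    · rw [ih (by omega), if_neg (by simpa using h.ne'), zero_add]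
    · rw [List.count_eq_zero.2 fun h => by have := mem_descWord h; omega]; simp

theorem descWord_congr {f g : ℕ → ℕ} {i : ℕ} (h : ∀ ρ, 1 ≤ ρ → ρ ≤ i → f ρ = g ρ) :
    descWord f i = descWord g i := by
  induction i with
  | zero => rfl
  | succ i ih =>
    rw [descWord, descWord, h (i + 1) (by omega) le_rfl, ih fun ρ h1 h2 => h ρ h1 (by omega)]

theorem length_descWord (f : ℕ → ℕ) (i : ℕ) :
    (descWord f i).length = ∑ ρ ∈ Finset.Icc 1 i, f ρ := by
  induction i with
  | zero => simp [descWord]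
  | succ i ih =>
    rw [descWord, List.length_append, ih, List.length_replicate,
      Finset.sum_Icc_succ_top (by omega), add_comm]

theorem content_of_range {n : ℕ} [NeZero n] (e : ZMod n) {L : List ℕ}
    (h : ∀ a ∈ L, 1 ≤ a ∧ a ≤ n) : content e L e = L.count n := by
  have := content_eq_count e (L := L) (ρ := n) fun a ha => by have := h a ha; omega
  rwa [ZMod.natCast_self, add_zero] at this

/-- A carrier with contents `X` meets a weakly decreasing word. Letters `s i` of the word, all
greater than `i`, are waiting for letters `≤ i` of the carrier; `z i` of them meet a letter `i`. -/
theorem runR_queue {n k : ℕ} [NeZero n] (hk : 1 ≤ k) (e : ZMod n) {X Y z s : ℕ → ℕ} (i : ℕ) :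
    ∀ (P : List ℕ) (v : Crystal n k), i < n → P.Pairwise (· ≥ ·) → (∀ b ∈ P, i < b ∧ b ≤ n) →
    (∀ ρ, 1 ≤ ρ → ρ ≤ i → v.1 (e + ρ) = X ρ) →
    (∀ ρ, i < ρ → ρ < n → 0 < v.1 (e + ρ) → ∀ b ∈ P, b ≤ ρ) →
    P.length = s i →
    (∀ ρ, 1 ≤ ρ → ρ ≤ i → z ρ = min (s ρ) (X ρ) ∧ s (ρ - 1) + z ρ = s ρ + Y ρ) →
    s 0 ≤ v.1 e + P.count n →
    (runR v ((P ++ descWord Y i).map (ranked e))).1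
      = (descWord z i ++ List.replicate (s 0) 0).map (ranked e) := by
  induction i with
  | zero =>
    intro P v hi hP hPi _ hocc hlen _ hE
    rw [descWord, descWord, List.append_nil, List.nil_append, ← hlen]
    refine runR_const hk e hi P v hP hPi hocc ?_
    rw [Nat.cast_zero, add_zero, zero_add, hlen]
    exact hE
  | succ i ih =>
    intro P v hi hP hPi hX hocc hlen hzs hE
    obtain ⟨hz, hs⟩ := hzs (i + 1) (by omega) le_rfl
    rw [Nat.add_sub_cancel] at hs
    have hXi := hX (i + 1) (by omega) le_rfl
    obtain ⟨S, P', rfl, hS⟩ : ∃ S P', P = S ++ P' ∧ S.length = z (i + 1) :=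
      ⟨P.take (z (i + 1)), P.drop (z (i + 1)), (List.take_append_drop _ _).symm, by
        rw [List.length_take]; omega⟩
    obtain ⟨hPS, hPP, hSP⟩ := List.pairwise_append.1 hP
    have hSi : ∀ b ∈ S, i + 1 < b ∧ b ≤ n := fun b hb => hPi b (by simp [hb])
    have hseg := runR_const hk e hi S v hPS hSi
      (fun ρ h1 h2 h3 b hb => hocc ρ h1 h2 h3 b (by simp [hb])) (by omega)
    have hcons : ∀ j, (runR v (S.map (ranked e))).2.1 j
        + content e (List.replicate (z (i + 1)) (i + 1)) j = v.1 j + content e S j := fun j => by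
      have := runR_conserves v (S.map (ranked e)) j
      rwa [hseg, hS] at this
    have hrep : ∀ ρ, ρ < n → content e (List.replicate (z (i + 1)) (i + 1)) (e + ρ)
        = if i + 1 = ρ then z (i + 1) else 0 := fun ρ hρ => by
      rw [content_eq_count e fun a ha => by rw [List.eq_of_mem_replicate ha]; omega,
        List.count_replicate]
      simp
    have hSc : ∀ ρ, 1 ≤ ρ → ρ < n → content e S (e + ρ) = S.count ρ := fun ρ h1 h2 =>
      content_eq_count e fun a ha => by have := hSi a ha; omega
    have hlist : S ++ P' ++ descWord Y (i + 1)
        = S ++ ((P' ++ List.replicate (Y (i + 1)) (i + 1)) ++ descWord Y i) := by simp [descWord]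
    rw [hlist, List.map_append, runR_append, hseg, hS, ih _ _ (by omega)]
    · simp [descWord]
    · refine List.pairwise_append.2 ⟨hPP, List.pairwise_replicate.2 (Or.inr le_rfl),
        fun a ha b hb => ?_⟩
      rw [List.eq_of_mem_replicate hb]
      have := hPi a (by simp [ha])
      omega
    · intro b hb
      rcases List.mem_append.1 hb with hb | hb
      · have := hPi b (by simp [hb]); omega
      · rw [List.eq_of_mem_replicate hb]; omega
    · intro ρ h1 h2
      have h3 := hcons (e + ρ)
      rw [hrep ρ (by omega), hSc ρ h1 (by omega), hX ρ h1 (by omega), if_neg (by omega),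
        List.count_eq_zero.2 fun h => by have := hSi ρ h; omega] at h3
      exact h3
    · intro ρ h1 h2 h3 b hb
      have h4 := hcons (e + ρ)
      rw [hrep ρ h2, hSc ρ (by omega) h2] at h4
      rcases List.mem_append.1 hb with hb | hb
      · rcases Nat.eq_or_lt_of_le (Nat.succ_le_of_lt h1) with h5 | h5
        · -- a letter `i + 1` is left in the carrier only if no letter of the word is waiting
          subst h5
          rw [if_pos rfl, List.count_eq_zero.2 fun h => by have := hSi _ h; omega] at h4
          have := List.length_pos_of_mem hb
          rw [List.length_append] at hlen
          simp only [Nat.succ_eq_add_one] at h3 h4 hXi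
          omega
        · rw [if_neg (by omega)] at h4
          rcases Nat.eq_zero_or_pos (S.count ρ) with h6 | h6
          · exact hocc ρ h5 h2 (by omega) b (by simp [hb])
          · exact hSP ρ (List.count_pos_iff.1 h6) b hb
      · rw [List.eq_of_mem_replicate hb]; omega
    · rw [List.length_append] at hlen
      rw [List.length_append, List.length_replicate]
      omega
    · exact fun ρ h1 h2 => hzs ρ h1 (by omega)
    · have h3 := hcons e
      have h4 := hrep 0 (by omega)
      rw [Nat.cast_zero, add_zero, if_neg (by omega)] at h4
      rw [h4, content_of_range e fun a ha => by have := hSi a ha; omega] at h3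
      rw [List.count_append] at hE ⊢
      omega

/-! ### One step of the box-ball system -/

theorem map_replicate_vac {n : ℕ} [NeZero n] (e : ZMod n) (A : ℕ) :
    (List.replicate A n).map (ranked e) = List.replicate A (letter e) := by simp [ranked_self]

theorem map_replicate_zero {n : ℕ} [NeZero n] (e : ZMod n) (A : ℕ) :
    (List.replicate A 0).map (ranked e) = List.replicate A (letter e) := by simp [ranked_zero]

theorem getElem?_desc_vac {D : List ℕ} {n A j c : ℕ} (h : (List.replicate A n ++ D)[j]? = some c)
    (hj : A ≤ j) : c ∈ D := by
  rw [List.getElem?_append_right (by simpa using hj)] at h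
  exact List.mem_of_getElem? h

theorem passWord_soliton {n k : ℕ} [NeZero n] (hk : 1 ≤ k) (e : ZMod n) {D : List ℕ}
    (hD : ∀ a ∈ D, 1 ≤ a ∧ a < n) (hs : D.Pairwise (· ≥ ·)) (h0 : D ≠ []) (A : ℕ) {M : ℕ}
    (hM : min k D.length ≤ M) :
    runR (multiple k e) (List.replicate A (letter e) ++ D.map (ranked e)
        ++ List.replicate M (letter e))
      = (List.replicate (A + min k D.length) (letter e) ++ D.map (ranked e)
        ++ List.replicate (M - min k D.length) (letter e), multiple k e) := by
  have hl := List.length_pos_iff.2 h0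
  have hn0 : 0 < n := Nat.pos_of_ne_zero (NeZero.ne n)
  set q := min k D.length with hq
  have hpw : ∀ a b, (List.replicate a n ++ D ++ List.replicate b 0).Pairwise (· ≥ ·) :=
    fun a b => by
      refine List.pairwise_append.2 ⟨List.pairwise_append.2
        ⟨List.pairwise_replicate.2 (Or.inr le_rfl), hs, fun x hx y hy => ?_⟩,
        List.pairwise_replicate.2 (Or.inr le_rfl), fun x hx y hy => ?_⟩
      · rw [List.eq_of_mem_replicate hx]; exact (hD y hy).2.le
      · rw [List.eq_of_mem_replicate hy]; exact Nat.zero_le _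
  have hcat : List.replicate q n ++ (List.replicate A n ++ D ++ List.replicate M 0)
      = List.replicate (q + A) n ++ D ++ List.replicate M 0 := by
    simp only [← List.append_assoc, ← List.replicate_add]
  obtain ⟨h1, h2⟩ := runR_fifo hk e (k - q) (List.replicate A n ++ D ++ List.replicate M 0)
    (List.replicate q n) (multiple k e) (by simp; omega) (fun i => by
      rw [multiple_apply]
      split_ifs with hi
      · rw [hi, content_of_range e fun a ha => by rw [List.eq_of_mem_replicate ha]; omega]
        simp; omega
      · rw [content_eq_zero fun a ha h => hi (by rw [h, List.eq_of_mem_replicate ha]; simp)])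
    (by rw [hcat]; exact hpw _ _) (fun ρ hρ => by
      rw [hcat] at hρ
      simp only [List.mem_append, List.mem_replicate] at hρ
      rcases hρ with (⟨-, rfl⟩ | hρ) | ⟨-, rfl⟩
      · exact le_rfl
      · exact (hD ρ hρ).2.le
      · exact Nat.zero_le _)
    (fun j c b hc hb => by
      rw [hcat] at hc
      have hc1 : q + A ≤ j → c ≠ n := fun hj => by
        rw [List.append_assoc] at hc
        have := getElem?_desc_vac hc hj
        rcases List.mem_append.1 this with h | h
        · exact (hD c h).2.ne
        · rw [List.eq_of_mem_replicate h]; omega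
      have hc2 : j < q + A → c = n := fun hj => by
        rw [List.append_assoc, List.getElem?_append_left (by simpa using hj)] at hc
        exact List.eq_of_mem_replicate (List.mem_of_getElem? hc)
      have hb1 : j < A + D.length → b ≠ 0 := fun hj => by
        rw [List.getElem?_append_left (by simpa using hj)] at hb
        rcases List.mem_append.1 (List.mem_of_getElem? hb) with h | h
        · rw [List.eq_of_mem_replicate h]; omega
        · have := hD b h; omega
      have hb2 : A + D.length ≤ j → b = 0 := fun hj => by
        rw [List.getElem?_append_right (by simpa using hj)] at hb
        exact List.eq_of_mem_replicate (List.mem_of_getElem? hb)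
      refine ⟨fun h => ?_, fun hx => ?_⟩
      · by_contra
        by_cases hj : q + A ≤ j
        · exact hc1 hj h.1
        · exact hb1 (by omega) h.2
      · by_cases hj : q + A ≤ j
        · exact Or.inr (hb2 (by omega))
        · exact Or.inl (hc2 (by omega)))
  obtain ⟨M, rfl⟩ := Nat.exists_eq_add_of_le hM
  have hcat' : List.replicate (q + A) n ++ D ++ List.replicate (q + M) 0
      = (List.replicate (A + q) n ++ D ++ List.replicate M 0) ++ List.replicate q 0 := by
    rw [add_comm q A, add_comm q M, List.replicate_add M q]; simp only [List.append_assoc]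
  have hlen : (List.replicate A n ++ D ++ List.replicate (q + M) 0).length
      = (List.replicate (A + q) n ++ D ++ List.replicate M 0).length := by simp; omega
  rw [hcat, hcat', hlen, List.take_left'  rfl] at h1
  rw [hcat, hcat', hlen, List.drop_left' rfl] at h2
  simp only [List.map_append, map_replicate_vac, map_replicate_zero] at h1 h2
  refine Prod.ext (by rw [h1, Nat.add_sub_cancel_left]) (eq_multiple ?_)
  rw [h2, if_pos rfl]
  have := content_eq_count e (L := List.replicate q 0) (ρ := 0) fun a ha => by
    rw [List.eq_of_mem_replicate ha]; omega
  rw [Nat.cast_zero, add_zero, List.count_replicate_self] at this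
  omega

/-- The empty carrier `u_k` absorbs a soliton and releases vacuum letters. -/
theorem runR_fill {n k : ℕ} [NeZero n] (hk : 1 ≤ k) (e : ZMod n) {D : List ℕ}
    (hD : ∀ a ∈ D, 1 ≤ a ∧ a < n) (hs : D.Pairwise (· ≥ ·)) (h0 : D ≠ []) (hDk : D.length ≤ k)
    (A : ℕ) :
    (runR (multiple k e) ((List.replicate A n ++ D).map (ranked e))).1
      = List.replicate (A + D.length) (letter e) ∧
    ∀ i, (runR (multiple k e) ((List.replicate A n ++ D).map (ranked e))).2.1 i
      = content e D i + if i = e then k - D.length else 0 := by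
  have hl := List.length_pos_iff.2 h0
  have hn0 : 0 < n := Nat.pos_of_ne_zero (NeZero.ne n)
  have hcat : List.replicate D.length n ++ (List.replicate A n ++ D)
      = List.replicate (A + D.length) n ++ D := by
    rw [add_comm, List.replicate_add, List.append_assoc]
  have hlen : (List.replicate A n ++ D).length
      = (List.replicate (A + D.length) n).length := by simp
  obtain ⟨h1, h2⟩ := runR_fifo hk e (k - D.length) (List.replicate A n ++ D)
    (List.replicate D.length n) (multiple k e) (by simp; omega) (fun i => by
      rw [multiple_apply]
      split_ifs with hi
      · rw [hi, content_of_range e fun a ha => by rw [List.eq_of_mem_replicate ha]; omega]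
        simp; omega
      · rw [content_eq_zero fun a ha h => hi (by rw [h, List.eq_of_mem_replicate ha]; simp)])
    (by
      rw [hcat]
      refine List.pairwise_append.2
        ⟨List.pairwise_replicate.2 (Or.inr le_rfl), hs, fun x hx y hy => ?_⟩
      rw [List.eq_of_mem_replicate hx]; exact (hD y hy).2.le)
    (fun ρ hρ => by
      rw [hcat] at hρ
      rcases List.mem_append.1 hρ with h | h
      · exact (List.eq_of_mem_replicate h).le
      · exact (hD ρ h).2.le)
    (fun j c b hc hb => by
      rw [hcat] at hc
      have hj : j < A + D.length := by
        simpa using (List.getElem?_eq_some_iff.1 hb).1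
      rw [List.getElem?_append_left (by simpa using hj)] at hc
      have hcn := List.eq_of_mem_replicate (List.mem_of_getElem? hc)
      refine ⟨fun h => ?_, fun _ => Or.inl hcn⟩
      rcases List.mem_append.1 (List.mem_of_getElem? hb) with h' | h'
      · rw [List.eq_of_mem_replicate h'] at h; exact NeZero.ne n h.2
      · have := hD b h'; omega)
  rw [hcat, hlen, List.take_left' rfl, map_replicate_vac] at h1
  rw [hcat, hlen, List.drop_left' rfl] at h2
  exact ⟨h1, h2⟩

/-- A carrier that contains a soliton releases it, in weakly decreasing order, when it meets vacuum
letters. -/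
theorem runR_empty {n k : ℕ} [NeZero n] (hk : 1 ≤ k) (e : ZMod n) {D : List ℕ}
    (hD : ∀ a ∈ D, 1 ≤ a ∧ a < n) (hs : D.Pairwise (· ≥ ·)) (h0 : D ≠ []) {v : Crystal n k}
    (hv : ∀ i, v.1 i = content e D i + if i = e then k - D.length else 0) {M : ℕ}
    (hM : D.length ≤ M) :
    (runR v (List.replicate M (letter e))).1
      = D.map (ranked e) ++ List.replicate (M - D.length) (letter e) := by
  obtain ⟨h1, -⟩ := runR_fifo hk e (k - D.length) (List.replicate M 0) D v h0 hv
    (List.pairwise_append.2 ⟨hs, List.pairwise_replicate.2 (Or.inr le_rfl),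
      fun x hx y hy => by rw [List.eq_of_mem_replicate hy]; exact Nat.zero_le _⟩)
    (fun ρ hρ => by
      rcases List.mem_append.1 hρ with h | h
      · exact (hD ρ h).2.le
      · rw [List.eq_of_mem_replicate h]; exact Nat.zero_le _)
    (fun j c b hc hb => by
      have hb0 := List.eq_of_mem_replicate (List.mem_of_getElem? hb)
      refine ⟨fun h => ?_, fun _ => Or.inr hb0⟩
      rcases List.mem_append.1 (List.mem_of_getElem? hc) with h' | h'
      · have := hD c h'; omega
      · rw [List.eq_of_mem_replicate h'] at h; exact NeZero.ne n h.1.symm)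
  obtain ⟨M, rfl⟩ := Nat.exists_eq_add_of_le hM
  have hcat : D ++ List.replicate (D.length + M) 0
      = (D ++ List.replicate M 0) ++ List.replicate D.length 0 := by
    rw [add_comm, List.replicate_add, List.append_assoc]
  have hlen : (List.replicate (D.length + M) 0).length = (D ++ List.replicate M 0).length := by
    simp
  rw [hcat, hlen, List.take_left' rfl, List.map_append, map_replicate_zero,
    map_replicate_zero] at h1
  rw [h1, Nat.add_sub_cancel_left]

/-- One time step of two solitons, when the carrier `u_k` can absorb the left one. The gap `g` is
arbitrary, and `s`, `z` are as in `runR_queue`. -/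
theorem passWord_two_solitons {n k : ℕ} [NeZero n] (hk : 1 ≤ k) (e : ZMod n)
    {X Y z s W : ℕ → ℕ} {N : ℕ} (hN : N + 1 = n)
    (hX : (descWord X N).length ≤ k) (hX0 : descWord X N ≠ [])
    (hW0 : descWord W N ≠ [])
    (hzs : ∀ ρ, 1 ≤ ρ → ρ ≤ N → z ρ = min (s ρ) (X ρ) ∧ s (ρ - 1) + z ρ = s ρ + Y ρ)
    (hWz : ∀ ρ, 1 ≤ ρ → ρ ≤ N → W ρ + z ρ = X ρ + Y ρ)
    (hs0 : s 0 + (descWord X N).length ≤ k + s N) (A : ℕ) {M : ℕ}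
    (hM : (descWord W N).length ≤ M) :
    passWord e k (List.replicate A (letter e) ++ (descWord X N).map (ranked e)
        ++ List.replicate (s N) (letter e) ++ (descWord Y N).map (ranked e)
        ++ List.replicate M (letter e))
      = List.replicate (A + (descWord X N).length) (letter e) ++ (descWord z N).map (ranked e)
        ++ List.replicate (s 0) (letter e) ++ (descWord W N).map (ranked e)
        ++ List.replicate (M - (descWord W N).length) (letter e) := by
  have hr : ∀ f : ℕ → ℕ, ∀ a ∈ descWord f N, 1 ≤ a ∧ a < n := fun f a ha => by
    have := mem_descWord ha; omega
  obtain ⟨h1, h2⟩ := runR_fill hk e (hr X) (pairwise_descWord X N) hX0 hX A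
  set v := (runR (multiple k e) ((List.replicate A n ++ descWord X N).map (ranked e))).2 with hv
  have hcount : ∀ f : ℕ → ℕ, ∀ ρ, 1 ≤ ρ → ρ ≤ N → content e (descWord f N) (e + ρ) = f ρ :=
    fun f ρ h3 h4 => by
      rw [content_eq_count e fun a ha => by have := hr f a ha; omega, count_descWord f h3 h4]
  have hcount0 : ∀ f : ℕ → ℕ, content e (descWord f N) e = 0 := fun f => by
    rw [content_of_range e fun a ha => by have := hr f a ha; omega]
    exact List.count_eq_zero.2 fun h => by have := hr f n h; omega
  have hne : ∀ ρ : ℕ, 1 ≤ ρ → ρ ≤ N → e + (ρ : ZMod n) ≠ e := fun ρ h3 h4 h5 => by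
    have := add_natCast_inj (e := e) (b := 0) (by simpa using h5) (by omega) (by omega)
    omega
  have hvX : ∀ ρ, 1 ≤ ρ → ρ ≤ N → v.1 (e + ρ) = X ρ := fun ρ h3 h4 => by
    rw [h2, hcount X ρ h3 h4, if_neg (hne ρ h3 h4), add_zero]
  have hve : v.1 e = k - (descWord X N).length := by rw [h2, hcount0, if_pos rfl, zero_add]
  have h3 := runR_queue hk e N (List.replicate (s N) n) v (by omega)
    (List.pairwise_replicate.2 (Or.inr le_rfl))
    (fun b hb => by rw [List.eq_of_mem_replicate hb]; omega) hvX
    (fun ρ _ _ => by omega) (by simp) hzs (by rw [List.count_replicate_self]; omega)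
  set v' := (runR v ((List.replicate (s N) n ++ descWord Y N).map (ranked e))).2 with hv'
  have h4 := length_runR v ((List.replicate (s N) n ++ descWord Y N).map (ranked e))
  rw [h3] at h4
  simp only [List.length_map, List.length_append, List.length_replicate] at h4
  have hWl : (descWord W N).length + (descWord z N).length
      = (descWord X N).length + (descWord Y N).length := by
    simp only [length_descWord, ← Finset.sum_add_distrib]
    refine Finset.sum_congr rfl fun ρ hρ => ?_
    rw [Finset.mem_Icc] at hρ
    exact hWz ρ hρ.1 hρ.2
  have hcons : ∀ i, v'.1 i + (content e (descWord z N) i + content e (List.replicate (s 0) 0) i)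
      = v.1 i + (content e (List.replicate (s N) n) i + content e (descWord Y N) i) := fun i => by
    have := runR_conserves v ((List.replicate (s N) n ++ descWord Y N).map (ranked e)) i
    rw [h3] at this
    rw [← content_append, ← content_append]
    exact this
  have hrep : ∀ a b, (a = 0 ∨ a = n) → content e (List.replicate b a) e = b := fun a b ha => by
    have : (ranked e a).1 e = 1 := by
      rcases ha with rfl | rfl
      · rw [ranked_zero, letter_apply, if_pos rfl]
      · rw [ranked_self, letter_apply, if_pos rfl]
    simp [content, this]
  have hrep' : ∀ a b i, (a = 0 ∨ a = n) → i ≠ e → content e (List.replicate b a) i = 0 :=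
    fun a b i ha hi => content_eq_zero fun c hc h => hi (by
      rw [h, List.eq_of_mem_replicate hc]
      rcases ha with rfl | rfl <;> simp)
  have hv'W : ∀ i, v'.1 i
      = content e (descWord W N) i + if i = e then k - (descWord W N).length else 0 := fun i => by
    have h5 := hcons i
    by_cases hi : i = e
    · subst hi
      rw [hcount0, hcount0, hrep 0 _ (Or.inl rfl), hrep n _ (Or.inr rfl), hve] at h5
      rw [hcount0, if_pos rfl]
      omega
    · obtain ⟨ρ, h6, h7, rfl⟩ : ∃ ρ : ℕ, 1 ≤ ρ ∧ ρ ≤ N ∧ i = e + ρ := by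
        have hval := ZMod.val_lt (i - e)
        refine ⟨(i - e).val, ?_, by omega, by rw [ZMod.natCast_zmod_val]; ring⟩
        exact Nat.pos_of_ne_zero fun h => hi (sub_eq_zero.1 ((ZMod.val_eq_zero _).1 h))
      rw [hrep' 0 _ _ (Or.inl rfl) hi, hrep' n _ _ (Or.inr rfl) hi, hcount z ρ h6 h7,
        hcount Y ρ h6 h7, hvX ρ h6 h7] at h5
      have := hWz ρ h6 h7
      rw [hcount W ρ h6 h7, if_neg hi]
      omega
  have h5 := runR_empty hk e (hr W) (pairwise_descWord W N) hW0 hv'W hM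
  have hin : List.replicate A (letter e) ++ (descWord X N).map (ranked e)
        ++ List.replicate (s N) (letter e) ++ (descWord Y N).map (ranked e)
        ++ List.replicate M (letter e)
      = (List.replicate A n ++ descWord X N).map (ranked e)
        ++ ((List.replicate (s N) n ++ descWord Y N).map (ranked e)
        ++ List.replicate M (letter e)) := by
    simp only [List.map_append, map_replicate_vac, List.append_assoc]
  rw [hin, passWord, runR_append, runR_append, h1, ← hv, h3, ← hv', h5]
  simp only [List.map_append, map_replicate_zero, List.append_assoc]

/-! ### Solitons labelled by crystals -/

/-- The multiplicities of the ranks `1, …, r + 1` in a soliton with label `x`, if the letter `i` of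
the label has rank `i + δ` (`δ = 0, 1`). -/
def labelRank {r l : ℕ} [NeZero r] (δ : ℕ) (x : Crystal r l) (ρ : ℕ) : ℕ :=
  if δ < ρ ∧ ρ ≤ r + δ then x.1 ((ρ - δ : ℕ) : ZMod r) else 0

/-- The weakly decreasing word of ranks of a soliton. -/
def labelWord {r l : ℕ} [NeZero r] (δ : ℕ) (x : Crystal r l) : List ℕ :=
  descWord (labelRank δ x) (r + 1)

theorem descWord_eq_flatMap (f : ℕ → ℕ) (N : ℕ) :
    descWord f N = ((List.range' 1 N).flatMap fun i => List.replicate (f i) i).reverse := by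
  induction N with
  | zero => rfl
  | succ N ih =>
    rw [List.range'_concat, List.flatMap_append, List.reverse_append, ← ih, descWord]
    simp [add_comm]

theorem descWord_succ_eq_map {f g : ℕ → ℕ} (h1 : f 1 = 0) (h : ∀ i, 1 ≤ i → f (i + 1) = g i)
    (N : ℕ) : descWord f (N + 1) = (descWord g N).map (· + 1) := by
  induction N with
  | zero => simp [descWord, h1]
  | succ N ih => rw [descWord, ih, descWord, h _ (by omega)]; simp

theorem labelWord_eq {r l : ℕ} [NeZero r] {δ : ℕ} (hδ : δ ≤ 1) (x : Crystal r l) :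
    labelWord δ x = (word x).reverse.map (· + δ) := by
  have hw : (word x).reverse = descWord (fun i : ℕ => x.1 (i : ZMod r)) r :=
    (descWord_eq_flatMap _ r).symm
  rw [hw, labelWord]
  interval_cases δ
  · rw [descWord, labelRank, if_neg (by omega)]
    simp only [List.replicate_zero, List.nil_append, add_zero, List.map_id']
    refine descWord_congr fun ρ h1 h2 => ?_
    rw [labelRank, if_pos (by omega), Nat.sub_zero]
  · rw [descWord_succ_eq_map (g := fun i => if i ≤ r then x.1 (i : ZMod r) else 0)]
    · congr 1
      exact descWord_congr fun ρ h1 h2 => if_pos h2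
    · rw [labelRank, if_neg (by omega)]
    · intro i hi
      rw [labelRank, Nat.add_sub_cancel]
      exact if_congr (by omega) rfl rfl

theorem length_word {r l : ℕ} [NeZero r] (x : Crystal r l) : (word x).length = l := by
  have h := length_descWord (fun i : ℕ => x.1 (i : ZMod r)) r
  rw [descWord_eq_flatMap, List.length_reverse] at h
  have h2 := sum_shift_eq x.1 0
  simp only [zero_add] at h2
  rw [word, h, h2, x.2]

theorem length_labelWord {r l : ℕ} [NeZero r] {δ : ℕ} (hδ : δ ≤ 1) (x : Crystal r l) :
    (labelWord δ x).length = l := by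
  rw [labelWord_eq hδ, List.length_map, List.length_reverse, length_word]

theorem labelWord_ne_nil {r l : ℕ} [NeZero r] {δ : ℕ} (hδ : δ ≤ 1) (hl : 1 ≤ l)
    (x : Crystal r l) : labelWord δ x ≠ [] := by
  rw [← List.length_pos_iff, length_labelWord hδ]
  exact hl

/-- Two solitons `x`, `y` with a gap of `g` vacuum letters, preceded by `A` and followed by `M`
vacuum letters. -/
def twoSolitons {r l m : ℕ} [NeZero r] (e : ZMod (r + 2)) (δ A : ℕ) (x : Crystal r l) (g : ℕ)
    (y : Crystal r m) (M : ℕ) : List (Crystal (r + 2) 1) :=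
  List.replicate A (letter e) ++ (labelWord δ x).map (ranked e) ++ List.replicate g (letter e)
    ++ (labelWord δ y).map (ranked e) ++ List.replicate M (letter e)

theorem range_labelWord {r l : ℕ} [NeZero r] (δ : ℕ) (x : Crystal r l) :
    ∀ a ∈ labelWord δ x, 1 ≤ a ∧ a < r + 2 := fun a ha => by
  have := mem_descWord ha; omega

theorem passWord_two_free {r l m k : ℕ} [NeZero r] (hk : 1 ≤ k) (e : ZMod (r + 2)) {δ : ℕ}
    (hδ : δ ≤ 1) (hl : 1 ≤ l) (hm : 1 ≤ m) (x : Crystal r l) (y : Crystal r m) (A g M : ℕ) :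
    passWord e k (twoSolitons e δ A x (g + min k l) y (M + min k m))
      = twoSolitons e δ (A + min k l) x (g + min k m) y M := by
  have hx := length_labelWord hδ x
  have hy := length_labelWord hδ y
  have h1 := passWord_soliton hk e (range_labelWord δ x) (pairwise_descWord _ _)
    (labelWord_ne_nil hδ hl x) A (M := min k l) (by rw [hx])
  have h2 := passWord_soliton hk e (range_labelWord δ y) (pairwise_descWord _ _)
    (labelWord_ne_nil hδ hm y) g (M := M + min k m) (by rw [hy]; omega)
  rw [hx, Nat.sub_self] at h1
  rw [hy, Nat.add_sub_cancel] at h2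
  have hin : twoSolitons e δ A x (g + min k l) y (M + min k m)
      = (List.replicate A (letter e) ++ (labelWord δ x).map (ranked e)
          ++ List.replicate (min k l) (letter e))
        ++ (List.replicate g (letter e) ++ (labelWord δ y).map (ranked e)
          ++ List.replicate (M + min k m) (letter e)) := by
    rw [twoSolitons, add_comm g, List.replicate_add]; simp only [List.append_assoc]
  rw [hin, passWord, runR_append, h1, h2, twoSolitons]
  simp only [List.append_assoc, List.replicate_zero, List.nil_append]

theorem iterate_two_free {r l m k : ℕ} [NeZero r] (hk : 1 ≤ k) (e : ZMod (r + 2)) {δ : ℕ}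
    (hδ : δ ≤ 1) (hl : 1 ≤ l) (hm : 1 ≤ m) (x : Crystal r l) (y : Crystal r m) (t : ℕ) :
    ∀ {A g M A' g' M' : ℕ}, A' = A + t * min k l → g' + t * min k l = g + t * min k m →
    M' + t * min k m = M → min k l ≤ g → min k m ≤ g' →
    (passWord e k)^[t] (twoSolitons e δ A x g y M) = twoSolitons e δ A' x g' y M' := by
  induction t with
  | zero =>
    intro A g M A' g' M' hA hg hM _ _
    simp only [zero_mul, add_zero] at hA hg hM
    rw [hA, hg, hM]; rfl
  | succ t ih =>
    intro A g M A' g' M' hA hg hM h1 h2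
    rw [Nat.succ_mul] at hA hM
    rw [Nat.succ_mul, Nat.succ_mul] at hg
    obtain ⟨g, rfl⟩ := Nat.exists_eq_add_of_le' h1
    obtain ⟨M, rfl⟩ := Nat.exists_eq_add_of_le' (show min k m ≤ M by omega)
    rw [Function.iterate_succ_apply, passWord_two_free hk e hδ hl hm]
    have h3 : t = 0 ∨ min k l ≤ g + min k m := by
      rcases le_total (min k l) (min k m) with h | h
      · exact Or.inr (by omega)
      · rcases Nat.eq_zero_or_pos t with h0 | h0
        · exact Or.inl h0
        · obtain ⟨t, rfl⟩ := Nat.exists_eq_add_of_le' h0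
          have : t * min k m ≤ t * min k l := Nat.mul_le_mul le_rfl h
          rw [Nat.succ_mul, Nat.succ_mul] at hg
          exact Or.inr (by omega)
    rcases h3 with rfl | h3
    · simp only [zero_mul, zero_add] at hA hg hM
      rw [hA]
      have e1 : g' = g + min k m := by omega
      have e2 : M' = M := by omega
      rw [e1, e2]; rfl
    · exact ih (by omega) (by omega) (by omega) h3 h2

/-- One time step of two solitons, when the carrier can absorb the left one, in terms of labels.
`S` is the queue of `runR_queue`. -/
theorem passWord_labels {r l m l' m' k : ℕ} [NeZero r] (hk : l ≤ k) (e : ZMod (r + 2)) {δ : ℕ}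
    (hδ : δ ≤ 1) (hl : 1 ≤ l) (hm : 1 ≤ m') {x : Crystal r l} {y : Crystal r m}
    {z : Crystal r l'} {w : Crystal r m'} {S : ℕ → ℕ}
    (hz : ∀ i : ℕ, 1 ≤ i → i ≤ r → z.1 i = min (S i) (x.1 i) ∧ S (i - 1) + z.1 i = S i + y.1 i)
    (hw : ∀ i : ℕ, 1 ≤ i → i ≤ r → w.1 i + z.1 i = x.1 i + y.1 i)
    (hS : S 0 + l ≤ k + S r) (A M : ℕ) :
    passWord e k (twoSolitons e δ A x (S r) y (M + m'))
      = twoSolitons e δ (A + l) z (S 0) w M := by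
  have hlab : ∀ {l : ℕ} (x : Crystal r l), (descWord (labelRank δ x) (r + 1)).length = l :=
    fun x => length_labelWord hδ x
  have hs0 : S (min (0 - δ) r) = S 0 := by simp
  have hsN : S (min (r + 1 - δ) r) = S r := by
    rw [min_eq_right (by omega)]
  have := passWord_two_solitons (k := k) (by omega) e (X := labelRank δ x) (Y := labelRank δ y)
    (z := labelRank δ z) (W := labelRank δ w) (s := fun ρ => S (min (ρ - δ) r)) (N := r + 1) rfl
    (by rw [hlab]; exact hk) (labelWord_ne_nil hδ hl x) (labelWord_ne_nil hδ hm w)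
    (fun ρ h1 h2 => by
      simp only [labelRank]
      by_cases h : δ < ρ ∧ ρ ≤ r + δ
      · simp only [if_pos h]
        have e1 : min (ρ - δ) r = ρ - δ := by omega
        have e2 : min (ρ - 1 - δ) r = ρ - δ - 1 := by omega
        rw [e1, e2]
        exact hz (ρ - δ) (by omega) (by omega)
      · simp only [if_neg h]
        have e1 : min (ρ - 1 - δ) r = min (ρ - δ) r := by omega
        rw [e1]; simp)
    (fun ρ h1 h2 => by
      simp only [labelRank]
      by_cases h : δ < ρ ∧ ρ ≤ r + δ
      · simp only [if_pos h]
        exact hw (ρ - δ) (by omega) (by omega)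
      · simp only [if_neg h])
    (by rw [hlab, hs0, hsN]; exact hS) A (M := M + m') (by rw [hlab]; omega)
  rw [hs0, hsN] at this
  rw [hlab, hlab, Nat.add_sub_cancel] at this
  exact this

theorem sum_Icc_add_sum_Icc {r l : ℕ} [NeZero r] (x : Crystal r l) {i : ℕ} (h : i ≤ r) :
    ∑ j ∈ Finset.Icc 1 i, x.1 (j : ZMod r) + ∑ j ∈ Finset.Icc (i + 1) r, x.1 (j : ZMod r) = l := by
  have h1 := sum_shift_eq x.1 0
  simp only [zero_add] at h1
  have h2 : ∀ a b : ℕ, Finset.Icc (a + 1) b = Finset.Ioc a b := fun a b => by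
    ext; simp
  have h3 := h2 0 i
  have h4 := h2 0 r
  rw [zero_add] at h3 h4
  rw [h4] at h1
  rw [h3, h2, Finset.sum_Ioc_consecutive _ (Nat.zero_le i) h, h1, x.2]

/-- The solitons keep their labels as long as their gap is not too small, even if the carrier
contains both of them at the same time. -/
theorem passWord_two_near {r l m k : ℕ} [NeZero r] (hk : l ≤ k) (hmk : m ≤ k) (e : ZMod (r + 2))
    {δ : ℕ} (hδ : δ ≤ 1) (hl : 1 ≤ l) (hm : 1 ≤ m) (x : Crystal r l) (y : Crystal r m) (A : ℕ)
    {g g' : ℕ} (M : ℕ) (hg : l ≤ g + crystalQ 0 x.1 y.1) (hg' : g' + l = g + m) :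
    passWord e k (twoSolitons e δ A x g y (M + m)) = twoSolitons e δ (A + l) x g' y M := by
  set S : ℕ → ℕ := fun i => g + (∑ j ∈ Finset.Icc (i + 1) r, y.1 (j : ZMod r))
    - ∑ j ∈ Finset.Icc (i + 1) r, x.1 (j : ZMod r) with hS
  have hsum : ∀ {l : ℕ} (x : Crystal r l) (i : ℕ), 1 ≤ i → i ≤ r →
      ∑ j ∈ Finset.Icc (i - 1 + 1) r, x.1 (j : ZMod r)
        = x.1 i + ∑ j ∈ Finset.Icc (i + 1) r, x.1 (j : ZMod r) := fun x i h1 h2 => by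
    have h3 := sum_Icc_add_sum_Icc x (show i - 1 ≤ r by omega)
    have h4 := sum_Icc_add_sum_Icc x h2
    obtain ⟨i, rfl⟩ := Nat.exists_eq_add_of_le' h1
    rw [Finset.sum_Icc_succ_top (by omega)] at h4
    simp only [Nat.add_sub_cancel] at h3 ⊢
    omega
  have hle : ∀ i : ℕ, 1 ≤ i → i ≤ r → ∑ j ∈ Finset.Icc (i - 1 + 1) r, x.1 (j : ZMod r)
      ≤ g + ∑ j ∈ Finset.Icc (i + 1) r, y.1 (j : ZMod r) := fun i h1 h2 => by
    have h3 := crystalQ_le 0 x.1 y.1 h1 h2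
    simp only [zero_add] at h3
    have h4 := sum_Icc_add_sum_Icc x (show i - 1 ≤ r by omega)
    omega
  have hSr : S r = g := by simp [hS]
  have hS0 : S 0 = g' := by
    have h3 := sum_Icc_add_sum_Icc x (Nat.zero_le r)
    have h4 := sum_Icc_add_sum_Icc y (Nat.zero_le r)
    simp only [Finset.Icc_eq_empty (show ¬ (1 ≤ 0) by omega), Finset.sum_empty, zero_add] at h3 h4
    simp only [hS, zero_add, h3, h4]
    omega
  have := passWord_labels hk e hδ hl hm (x := x) (y := y) (z := x) (w := y) (S := S)
    (fun i h1 h2 => by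
      have h3 := hle i h1 h2
      have h4 := hsum x i h1 h2
      have h5 := hsum y i h1 h2
      simp only [hS]
      omega) (fun i _ _ => add_comm _ _) (by omega) A M
  rwa [hSr, hS0] at this

/-- At the smallest possible gap, the time step by `u_l` exchanges the two solitons. -/
theorem passWord_collision {r l m : ℕ} [NeZero r] (hml : m ≤ l) (hm : 1 ≤ m) (e : ZMod (r + 2))
    {δ : ℕ} (hδ : δ ≤ 1) (x : Crystal r l) (y : Crystal r m) (A M : ℕ) :
    passWord e l (twoSolitons e δ A x (m - crystalQ 0 x.1 y.1) y (M + l))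
      = twoSolitons e δ (A + l) (classicalR x y).1 (m - crystalQ 0 x.1 y.1) (classicalR x y).2
        M := by
  have hrec := crystalQ_rec_of_le x y hml
  have := passWord_labels le_rfl e hδ (hm.trans hml) (hm.trans hml) (x := x) (y := y)
    (z := (classicalR x y).1) (w := (classicalR x y).2)
    (S := fun i => m - crystalQ (i : ZMod r) x.1 y.1)
    (fun i h1 h2 => by
      have h3 := hrec i
      have h5 := hrec (i + 1)
      rw [add_sub_cancel_right] at h5
      have h4 := classicalR_fst x y i
      rw [Nat.cast_sub h1, Nat.cast_one]
      omega)
    (fun i _ _ => by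
      have h3 := classicalR_fst x y i
      have h4 := classicalR_snd x y i
      omega) (by simp; omega) A M
  simpa using this

theorem iterate_two_near {r l m k : ℕ} [NeZero r] (hk : l ≤ k) (hmk : m ≤ k) (e : ZMod (r + 2))
    {δ : ℕ} (hδ : δ ≤ 1) (hl : 1 ≤ l) (hm : 1 ≤ m) (x : Crystal r l) (y : Crystal r m) (t : ℕ) :
    ∀ {A g M A' g' M' : ℕ}, A' = A + t * l → g' + t * l = g + t * m → M' + t * m = M →
    l ≤ g + crystalQ 0 x.1 y.1 → m ≤ g' + crystalQ 0 x.1 y.1 → m ≤ g' + l →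
    (passWord e k)^[t] (twoSolitons e δ A x g y M) = twoSolitons e δ A' x g' y M' := by
  induction t with
  | zero =>
    intro A g M A' g' M' hA hg hM _ _ _
    simp only [zero_mul, add_zero] at hA hg hM
    rw [hA, hg, hM]; rfl
  | succ t ih =>
    intro A g M A' g' M' hA hg hM h1 h2 h3
    rw [Nat.succ_mul] at hA hM
    rw [Nat.succ_mul, Nat.succ_mul] at hg
    obtain ⟨M, rfl⟩ := Nat.exists_eq_add_of_le' (show m ≤ M by omega)
    have hgl : l ≤ g + m ∧ (t = 0 ∨ l + l ≤ g + m + crystalQ 0 x.1 y.1) := by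
      rcases le_total l m with h | h
      · exact ⟨by omega, Or.inr (by omega)⟩
      · rcases Nat.eq_zero_or_pos t with rfl | h0
        · simp only [zero_mul, zero_add] at hA hg hM
          exact ⟨by omega, Or.inl rfl⟩
        · obtain ⟨t, rfl⟩ := Nat.exists_eq_add_of_le' h0
          have : t * m ≤ t * l := Nat.mul_le_mul le_rfl h
          rw [Nat.succ_mul, Nat.succ_mul] at hg
          exact ⟨by omega, Or.inr (by omega)⟩
    obtain ⟨g₁, hg₁⟩ := Nat.exists_eq_add_of_le' hgl.1
    rw [Function.iterate_succ_apply, passWord_two_near hk hmk e hδ hl hm x y A M h1 hg₁.symm]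
    rcases hgl.2 with rfl | h4
    · simp only [zero_mul, zero_add] at hA hg hM
      rw [hA]
      have e1 : g' = g₁ := by omega
      have e2 : M' = M := by omega
      rw [e1, e2]; rfl
    · exact ih (by omega) (by omega) (by omega) (by omega) h2 h3

set_option maxHeartbeats 1000000 in
/-- Collision of two solitons, far from the end: a longer soliton `x` overtakes a shorter soliton
`y`. Since all the time evolutions commute, the initial state may be replaced by its image under
powers of the evolutions by `u_{m+1}` and `u_l` before, and the same powers are applied at the end;
in between, the number of steps with `u_l` and `u_{m+1}` is such that the solitons reach precisely
the gap `m - Q_0` where `passWord_collision` applies. -/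
theorem iterate_collision {r l m k : ℕ} [NeZero r] (hm : 1 ≤ m) (hml : m < l) (hmk : m < k)
    (e : ZMod (r + 2)) {δ : ℕ} (hδ : δ ≤ 1) (x : Crystal r l) (y : Crystal r m)
    {t A g M A' g' M' : ℕ} (hg : l ≤ g)
    (ht : g + 3 * l ≤ t * (min k l - m))
    (hA : (l - m) * (m + 1) + (t * (min k l - m) + 3 * l) * l ≤ A)
    (hM' : M' + t * min k l + m = M + g + crystalQ 0 x.1 y.1)
    (hg' : g' + g + l + 2 * crystalQ 0 x.1 y.1 = 3 * m + t * (min k l - m))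
    (hA' : A' + 2 * m = A + g + l + crystalQ 0 x.1 y.1 + t * m) :
    (passWord e k)^[t] (twoSolitons e δ A x g y M)
      = twoSolitons e δ A' (classicalR x y).1 g' (classicalR x y).2 M' := by
  have hQ : crystalQ 0 x.1 y.1 ≤ m := by
    have := crystalQ_rec_of_le x y hml.le (0 + 1)
    rw [add_sub_cancel_right] at this
    omega
  have hQ' := crystalQ_classicalR hml.ne' (i := 0) x y
  set Q := crystalQ 0 x.1 y.1 with hQdef
  obtain ⟨w, hw⟩ := Nat.exists_eq_add_of_le hQ
  obtain ⟨D, hD⟩ := Nat.exists_eq_add_of_le hml.le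
  obtain ⟨d, hd⟩ := Nat.exists_eq_add_of_le (show m ≤ min k l by omega)
  have e1 : l - m = D := by omega
  have e2 : min k l - m = d := by omega
  rw [e2] at ht hg' hA
  rw [e1] at hA
  have hkm : min k m = m := by omega
  have hm1 : min (m + 1) l = m + 1 := by omega
  have hm2 : min (m + 1) m = m := by omega
  -- `J` is so large that the gap of the first state below exceeds the distance covered in time `t`
  set J := t * d + 3 * l with hJ
  have hDpos : 1 ≤ D := by omega
  have hJD : J ≤ J * D := Nat.le_mul_of_pos_right J hDpos
  obtain ⟨R, hR⟩ := Nat.exists_eq_add_of_le (show t * d + w ≤ g + D + J * D by omega)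
  have hi := Nat.mod_lt R hDpos
  have hR' := Nat.div_add_mod' R D
  set i := R % D
  set j := R / D
  obtain ⟨i', hi'⟩ := Nat.exists_eq_add_of_le hi.le
  have hj : j + 1 ≤ J := by
    by_contra h
    have : J * D ≤ j * D := Nat.mul_le_mul (by omega) le_rfl
    omega
  obtain ⟨J', hJ'⟩ := Nat.exists_eq_add_of_le hj
  have hJ'D : J * D = j * D + D + J' * D := by rw [hJ']; ring
  obtain ⟨A₀, hA₀⟩ := Nat.exists_eq_add_of_le hA
  have m1 : D * (m + 1) = D * m + D := by ring
  have m2 : i * (m + 1) = i * m + i := by ring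
  have m3 : i' * (m + 1) = i' * m + i' := by ring
  have m4 : D * m = i * m + i' * m := by rw [hi']; ring
  have m5 : J * m = j * m + m + J' * m := by rw [hJ']; ring
  have m6 : J * l = J * m + J * D := by rw [hD]; ring
  have m7 : j * l = j * m + j * D := by rw [hD]; ring
  have m8 : J' * l = J' * m + J' * D := by rw [hD]; ring
  have m9 : t * min k l = t * m + t * d := by rw [hd]; ring
  clear_value i j J
  have hsplit1 : (passWord (n := r + 2) e (m + 1))^[D]
      = (passWord e (m + 1))^[i'] ∘ (passWord e (m + 1))^[i] := by
    rw [← Function.iterate_add, hi', Nat.add_comm i]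
  have hsplit2 : (passWord (n := r + 2) e l)^[J]
      = (passWord e l)^[J'] ∘ (passWord e l) ∘ (passWord e l)^[j] := by
    rw [← Function.iterate_succ', ← Function.iterate_add, hJ', Nat.add_comm (j + 1)]
  have hc1 := (passWord_comm (n := r + 2) (show 1 ≤ k by omega) (show 1 ≤ m + 1 by omega)
    e).iterate_iterate t D
  have hc2 := (passWord_comm (n := r + 2) (show 1 ≤ k by omega) (show 1 ≤ l by omega)
    e).iterate_iterate t J
  have hc3 := (passWord_comm (n := r + 2) (show 1 ≤ m + 1 by omega) (show 1 ≤ l by omega)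
    e).iterate_iterate i J
  -- the initial state comes from a state with a larger gap
  have hst : twoSolitons e δ A x g y M = (passWord e (m + 1))^[D] ((passWord e l)^[J]
      (twoSolitons e δ A₀ x (g + D + J * D) y (M + D * m + J * m))) := by
    rw [iterate_two_near le_rfl hml.le e hδ (by omega) hm x y J (A' := A₀ + J * l)
      (g' := g + D) (M' := M + D * m) rfl (by omega) rfl (by omega) (by omega) (by omega),
      iterate_two_free (k := m + 1) (by omega) e hδ (by omega) hm x y D (A' := A) (g' := g)
        (M' := M) (by rw [hm1]; omega) (by rw [hm1, hm2]; omega) (by rw [hm2])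
        (by omega) (by omega)]
  -- from there the solitons do not collide up to time `t`
  have h1 := iterate_two_free (k := k) (by omega) e hδ (by omega) hm x y t (A := A₀)
    (g := g + D + J * D) (M := M + D * m + J * m) (A' := A₀ + t * min k l)
    (g' := R + w) (M' := M' + i * m + j * m + l + J' * l + i' * m + i') rfl
    (by rw [hkm]; omega) (by rw [hkm]; omega) (by omega) (by omega)
  -- `u_{m+1}` makes the gap congruent to `w` modulo `D`, then `u_l` lowers it to `w`
  have h2 := iterate_two_free (k := m + 1) (by omega) e hδ (by omega) hm x y i
    (A := A₀ + t * min k l) (g := R + w) (M := M' + i * m + j * m + l + J' * l + i' * m + i')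
    (A' := A₀ + t * min k l + i * (m + 1)) (g' := j * D + w)
    (M' := M' + j * m + l + J' * l + i' * m + i')
    (by rw [hm1]) (by rw [hm1, hm2]; omega) (by rw [hm2]; omega) (by omega) (by omega)
  have h3 := iterate_two_near le_rfl hml.le e hδ (by omega) hm x y j
    (A := A₀ + t * min k l + i * (m + 1)) (g := j * D + w)
    (M := M' + j * m + l + J' * l + i' * m + i')
    (A' := A₀ + t * min k l + i * (m + 1) + j * l) (g' := w)
    (M' := M' + J' * l + i' * m + i' + l) rfl (by omega) (by omega) (by omega) (by omega)
    (by omega)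
  -- the collision, after which the remaining powers of `u_l` and `u_{m+1}` widen the gap
  have h4 := passWord_collision hml.le hm e hδ x y (A₀ + t * min k l + i * (m + 1) + j * l)
    (M' + J' * l + i' * m + i')
  rw [← hQdef, show m - Q = w by omega] at h4
  have h5 := iterate_two_near hml.le le_rfl e hδ hm (by omega) (classicalR x y).1
    (classicalR x y).2 J' (A := A₀ + t * min k l + i * (m + 1) + j * l + l) (g := w)
    (M := M' + J' * l + i' * m + i')
    (A' := A₀ + t * min k l + i * (m + 1) + j * l + l + J' * m) (g' := w + J' * D)
    (M' := M' + i' * m + i') rfl (by omega) (by omega) (by omega) (by omega)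
    (by omega)
  have h6 := iterate_two_free (k := m + 1) (by omega) e hδ hm (by omega) (classicalR x y).1
    (classicalR x y).2 i' (A := A₀ + t * min k l + i * (m + 1) + j * l + l + J' * m)
    (g := w + J' * D) (M := M' + i' * m + i')
    (A' := A') (g' := g') (M' := M') (by rw [hm2]; omega) (by rw [hm1, hm2]; omega)
    (by rw [hm1]; omega) (by omega) (by omega)
  rw [hst, hc1.eq, hc2.eq, h1, hsplit1, Function.comp_apply, hc3.eq, h2, hsplit2,
    Function.comp_apply, Function.comp_apply, h3, h4, h5, h6]

/-! ### Crossing of right and left solitons -/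

/-- A letter `v` of `B_1` crosses a word of letters of `B_1^∨`: when it meets the same letter, both
turn into `v - 1`. -/
def crossLetter {n : ℕ} (v : ZMod n) : List (ZMod n) → List (ZMod n) × ZMod n
  | [] => ([], v)
  | a :: Λ => if a = v then ((v - 1) :: (crossLetter (v - 1) Λ).1, (crossLetter (v - 1) Λ).2)
      else (a :: (crossLetter v Λ).1, (crossLetter v Λ).2)

/-- A word of letters of `B_1` crosses a word of letters of `B_1^∨`. -/
def crossWord {n : ℕ} : List (ZMod n) → List (ZMod n) → List (ZMod n) × List (ZMod n)
  | [], Λ => (Λ, [])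
  | v :: V, Λ => ((crossLetter v (crossWord V Λ).1).1,
      (crossLetter v (crossWord V Λ).1).2 :: (crossWord V Λ).2)

theorem classicalRv_letter_self {n : ℕ} [NeZero n] (hn : 3 ≤ n) (v : ZMod n) :
    classicalRv (letter v) (letter v) = (letter (v - 1), letter (v - 1)) := by
  have h1 : ∀ i : ZMod n, i ≠ i + 1 := fun i => (one_two_ne hn i).1
  have key : ∀ i, crystalP i (letter v).1 (letter v).1 = if i = v - 1 then 1 else 0 := fun i => by
    simp only [crystalP, letter_apply, min_self, eq_sub_iff_add_eq]
  have hv : v - 1 ≠ v := fun h => h1 (v - 1) (by rw [sub_add_cancel, h])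
  have heq : ∀ i, (classicalRv (letter v) (letter v)).1.1 i = (letter (v - 1)).1 i ∧
      (classicalRv (letter v) (letter v)).2.1 i = (letter (v - 1)).1 i := fun i => by
    have h2 := classicalRv_fst (letter v) (letter v) i
    have h3 := classicalRv_snd (letter v) (letter v) i
    rw [key, key] at h2 h3
    have h4 : (letter v).1 i = if i - 1 = v - 1 then 1 else 0 := by
      rw [letter_apply]; exact if_congr sub_left_inj.symm rfl rfl
    rw [letter_apply (v - 1)]
    omega
  exact Prod.ext (Crystal.ext fun i => (heq i).1) (Crystal.ext fun i => (heq i).2)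

theorem min_letter_eq_zero {n : ℕ} [NeZero n] {a b : ZMod n} (h : a ≠ b) (i : ZMod n) :
    min ((letter a).1 i) ((letter b).1 i) = 0 := by
  rw [letter_apply, letter_apply]
  by_cases h1 : i = a
  · rw [if_neg fun h2 => h (h1.symm.trans h2), Nat.min_zero]
  · rw [if_neg h1, Nat.zero_min]

theorem cross_letter {n : ℕ} [NeZero n] (hn : 3 ≤ n) (Λ : List (ZMod n)) : ∀ v : ZMod n,
    cross (letter v) (Λ.map letter)
      = ((crossLetter v Λ).1.map letter, letter (crossLetter v Λ).2) := by
  induction Λ with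
  | nil => intro v; rfl
  | cons a Λ ih =>
    intro v
    by_cases h : a = v
    · subst h
      simp [crossLetter, cross, classicalRv_letter_self hn, ih]
    · simp [crossLetter, cross, h,
        classicalRv_of_disjoint (min_letter_eq_zero (Ne.symm h)), ih]

theorem crossLetter_of_notMem {n : ℕ} {v : ZMod n} {Λ : List (ZMod n)} (h : v ∉ Λ) :
    crossLetter v Λ = (Λ, v) := by
  induction Λ with
  | nil => rfl
  | cons a Λ ih =>
    simp only [List.mem_cons, not_or] at h
    simp [crossLetter, ih h.2, Ne.symm h.1]

theorem crossLetter_append {n : ℕ} (Λ Λ' : List (ZMod n)) : ∀ v : ZMod n,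
    crossLetter v (Λ ++ Λ') = ((crossLetter v Λ).1 ++ (crossLetter (crossLetter v Λ).2 Λ').1,
      (crossLetter (crossLetter v Λ).2 Λ').2) := by
  induction Λ with
  | nil => intro v; rfl
  | cons a Λ ih =>
    intro v
    by_cases h : a = v <;> simp [crossLetter, h, ih]

theorem crossWord_append {n : ℕ} (V V' Λ : List (ZMod n)) :
    crossWord (V ++ V') Λ = ((crossWord V (crossWord V' Λ).1).1,
      (crossWord V (crossWord V' Λ).1).2 ++ (crossWord V' Λ).2) := by
  induction V with
  | nil => rfl
  | cons v V ih => simp [crossWord, ih]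

/-- Letters that do not occur in an initial part of a word ignore it. -/
theorem crossWord_append_right {n : ℕ} {V Λ : List (ZMod n)} (h : ∀ v ∈ V, v ∉ Λ)
    (Λ' : List (ZMod n)) :
    crossWord V (Λ ++ Λ') = (Λ ++ (crossWord V Λ').1, (crossWord V Λ').2) := by
  induction V with
  | nil => rfl
  | cons v V ih =>
    simp only [crossWord, ih fun a ha => h a (by simp [ha]), crossLetter_append,
      crossLetter_of_notMem (h v (by simp))]

theorem notMem_replicate {n : ℕ} {a b : ZMod n} (h : a ≠ b) (q : ℕ) : a ∉ List.replicate q b :=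
  fun h' => h (List.eq_of_mem_replicate h')

/-- A block of equal letters `v` meets a block of letters `v` and finds no letter `v - 1` behind
it. -/
theorem crossWord_replicate {n : ℕ} (hn : 3 ≤ n) {v : ZMod n} {Λ₁ Λ₂ : List (ZMod n)}
    (h1 : v ∉ Λ₁) (h2 : v ∉ Λ₂) (h3 : v - 1 ∉ Λ₂) (a b : ℕ) :
    crossWord (List.replicate a v) (Λ₁ ++ List.replicate b v ++ Λ₂)
      = (Λ₁ ++ List.replicate (min a b) (v - 1) ++ List.replicate (b - min a b) v ++ Λ₂,
        List.replicate (a - min a b) v ++ List.replicate (min a b) (v - 1)) := by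
  have hv : v ≠ v - 1 := fun h => (one_two_ne hn (v - 1)).1 (by rw [sub_add_cancel, ← h])
  induction a with
  | zero => simp [crossWord]
  | succ a ih =>
    rw [List.replicate_succ, crossWord, ih]
    simp only [crossLetter_append, crossLetter_of_notMem h1,
      crossLetter_of_notMem (notMem_replicate hv _)]
    rcases lt_or_ge a b with h | h
    · obtain ⟨d, rfl⟩ := Nat.exists_eq_add_of_lt h
      have e1 : a + d + 1 - min a (a + d + 1) = d + 1 := by omega
      have e2 : min (a + 1) (a + d + 1) = a + 1 := by omega
      have e3 : min a (a + d + 1) = a := by omega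
      have e4 : a + d + 1 - (a + 1) = d := by omega
      rw [e1, e2, e3, e4, Nat.sub_self, Nat.sub_self, List.replicate_succ, crossLetter,
        if_pos rfl, crossLetter_of_notMem (notMem_replicate hv.symm _),
        crossLetter_of_notMem h3]
      simp only [List.append_assoc, List.nil_append, List.cons_append, List.replicate_zero]
      rw [← List.replicate_succ, List.replicate_succ']
      simp
    · have e1 : min a b = b := by omega
      have e2 : min (a + 1) b = b := by omega
      have e3 : a + 1 - b = a - b + 1 := by omega
      rw [e1, e2, e3, Nat.sub_self]
      simp [crossLetter, crossLetter_of_notMem h2, List.replicate_succ]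

/-- A block of equal letters `v` meets a block of letters `v`, and then, as letters `v - 1`, a block
of letters `v - 1`. -/
theorem crossWord_replicate_twice {n : ℕ} (hn : 3 ≤ n) {v : ZMod n} {Λ₁ Λ₂ : List (ZMod n)}
    (h1 : v ∉ Λ₁) (h2 : v ∉ Λ₂) (h3 : v - 1 ∉ Λ₂) (a b M : ℕ) :
    crossWord (List.replicate a v)
        (Λ₁ ++ List.replicate b v ++ Λ₂ ++ List.replicate (M + min a b) (v - 1))
      = (Λ₁ ++ List.replicate (min a b) (v - 1) ++ List.replicate (b - min a b) v ++ Λ₂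
          ++ List.replicate (min a b) (v - 1 - 1) ++ List.replicate M (v - 1),
        List.replicate (a - min a b) v ++ List.replicate (min a b) (v - 1 - 1)) := by
  have hv : v ≠ v - 1 := fun h => (one_two_ne hn (v - 1)).1 (by rw [sub_add_cancel, ← h])
  have hv1 : v - 1 ≠ v - 1 - 1 := fun h =>
    (one_two_ne hn (v - 1 - 1)).1 (by rw [sub_add_cancel, ← h])
  have hv2 : v ≠ v - 1 - 1 := fun h =>
    (one_two_ne hn (v - 1 - 1)).2.1 (by rw [sub_add_cancel, sub_add_cancel, ← h])
  induction a generalizing M with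
  | zero => simp [crossWord]
  | succ a ih =>
    rw [List.replicate_succ, crossWord]
    rcases lt_or_ge a b with h | h
    · obtain ⟨d, rfl⟩ := Nat.exists_eq_add_of_lt h
      have e1 : a + d + 1 - min a (a + d + 1) = d + 1 := by omega
      have e2 : min (a + 1) (a + d + 1) = a + 1 := by omega
      have e3 : min a (a + d + 1) = a := by omega
      have e4 : a + d + 1 - (a + 1) = d := by omega
      have e5 : M + (a + 1) = M + 1 + a := by omega
      have ih := ih (M + 1)
      rw [e1, e3] at ih
      rw [e2, e4, e5, ih]
      simp only [crossLetter_append, crossLetter_of_notMem h1,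
        crossLetter_of_notMem (notMem_replicate hv _)]
      rw [Nat.sub_self, Nat.sub_self, List.replicate_succ, crossLetter,
        if_pos rfl, crossLetter_of_notMem (notMem_replicate hv.symm _),
        crossLetter_of_notMem h3]
      simp only
      rw [crossLetter_of_notMem (notMem_replicate hv1 _), List.replicate_succ, crossLetter,
        if_pos rfl, crossLetter_of_notMem (notMem_replicate hv1.symm _)]
      simp only [List.append_assoc, List.nil_append, List.replicate_zero]
      rw [← List.replicate_succ, List.replicate_succ', List.replicate_succ']
      simp
    · have e1 : min a b = b := by omega
      have e2 : min (a + 1) b = b := by omega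
      have e3 : a + 1 - b = a - b + 1 := by omega
      have ih := ih M
      rw [e1] at ih
      rw [e2, e3, ih]
      rw [Nat.sub_self, List.replicate_zero, List.append_nil]
      simp only [crossLetter_append, crossLetter_of_notMem h1, crossLetter_of_notMem h2,
        crossLetter_of_notMem (notMem_replicate hv _),
        crossLetter_of_notMem (notMem_replicate hv2 _)]
      simp [List.replicate_succ]

/-- The multiplicities of the letters `≤ N` in `x` after the letters `2, …, N` of `x` and `y` that
meet each other have been replaced by `1, …, N - 1`, and the letters `1` that meet each other have
been removed. -/
def exchanged (x y : ℕ → ℕ) (N j : ℕ) : ℕ :=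
  x j - min (x j) (y j) + if j < N then min (x (j + 1)) (y (j + 1)) else 0

theorem descWord_exchanged (x y : ℕ → ℕ) {N : ℕ} (hN : 1 ≤ N) :
    descWord (exchanged x y (N + 1)) N
      = List.replicate (min (x (N + 1)) (y (N + 1))) N ++ descWord (exchanged x y N) N := by
  obtain ⟨N, rfl⟩ := Nat.exists_eq_add_of_le' hN
  rw [descWord, descWord, exchanged, exchanged, if_pos (by omega), if_neg (by omega),
    add_zero, add_comm (x (N + 1) - _), List.replicate_add, List.append_assoc,
    descWord_congr (f := exchanged x y (N + 1 + 1)) (g := exchanged x y (N + 1))]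
  intro ρ h1 h2
  rw [exchanged, exchanged, if_pos (by omega), if_pos (by omega)]

/-- The words of two solitons with multiplicities `x`, `y` cross each other. The hypothesis `hbase`
says what happens to the letters `1`, which depends on the boundary. -/
theorem crossWord_labels {n r : ℕ} (hn : 3 ≤ n) {L : ℕ → ZMod n} {e : ZMod n} {x y : ℕ → ℕ}
    {pre post post' : List (ZMod n)}
    (hL : ∀ j, 1 ≤ j → j < r → L (j + 1) - 1 = L j)
    (hinj : ∀ i j, 1 ≤ i → i ≤ r → 1 ≤ j → j ≤ r → L i = L j → i = j)
    (hpre : ∀ j, 1 ≤ j → j ≤ r → L j ∉ pre) (hpost : ∀ j, 1 ≤ j → j ≤ r → L j ∉ post')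
    (hbase : ∀ U : List (ZMod n), (∀ u ∈ U, ∃ j, 1 < j ∧ j ≤ r ∧ u = L j) →
      crossWord (List.replicate (x 1) (L 1)) (List.replicate (y 1) (L 1) ++ U ++ post)
        = (pre ++ List.replicate (y 1 - min (x 1) (y 1)) (L 1) ++ U ++ post',
          List.replicate (x 1 - min (x 1) (y 1)) (L 1) ++ List.replicate (min (x 1) (y 1)) e))
    {N : ℕ} (hN : 1 ≤ N) : N ≤ r → ∀ U : List (ZMod n), (∀ u ∈ U, ∃ j, N < j ∧ j ≤ r ∧ u = L j) →
      crossWord ((descWord x N).map L) ((descWord y N).reverse.map L ++ U ++ post)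
        = (pre ++ (descWord (exchanged y x N) N).reverse.map L ++ U ++ post',
          (descWord (exchanged x y N) N).map L ++ List.replicate (min (x 1) (y 1)) e) := by
  induction N, hN using Nat.le_induction with
  | base =>
    intro _ U hU
    have := hbase U hU
    simpa [descWord, exchanged, min_comm (y 1)] using this
  | succ N hN ih =>
    intro hNr U hU
    have hU' : ∀ u ∈ List.replicate (y (N + 1)) (L (N + 1)) ++ U,
        ∃ j, N < j ∧ j ≤ r ∧ u = L j := fun u hu => by
      rcases List.mem_append.1 hu with h | h
      · exact ⟨N + 1, by omega, hNr, List.eq_of_mem_replicate h⟩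
      · obtain ⟨j, h1, h2, h3⟩ := hU u h
        exact ⟨j, by omega, h2, h3⟩
    have ih := ih (by omega) _ hU'
    have hw : (descWord y (N + 1)).reverse.map L ++ U ++ post
        = (descWord y N).reverse.map L ++ (List.replicate (y (N + 1)) (L (N + 1)) ++ U)
          ++ post := by simp [descWord]
    have hv1 : L (N + 1) ∉ pre ++ (descWord (exchanged y x N) N).reverse.map L := fun h => by
      rcases List.mem_append.1 h with h | h
      · exact hpre _ (by omega) hNr h
      · obtain ⟨j, h1, h2⟩ := List.mem_map.1 h
        have h3 := mem_descWord (List.mem_reverse.1 h1)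
        have := hinj _ _ h3.1 (by omega) (by omega) hNr h2
        omega
    have hv2 : ∀ i, 1 ≤ i → i ≤ N + 1 → L i ∉ U ++ post' := fun i h1 h2 h => by
      rcases List.mem_append.1 h with h | h
      · obtain ⟨j, h3, h4, h5⟩ := hU _ h
        have := hinj _ _ h1 (by omega) (by omega) h4 h5
        omega
      · exact hpost _ h1 (by omega) h
    have hstep := crossWord_replicate hn hv1 (hv2 (N + 1) (by omega) le_rfl)
      (by rw [hL N hN (by omega)]; exact hv2 N hN (by omega)) (x (N + 1)) (y (N + 1))
    have hΛ : pre ++ (descWord (exchanged y x N) N).reverse.map L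
          ++ (List.replicate (y (N + 1)) (L (N + 1)) ++ U) ++ post'
        = pre ++ (descWord (exchanged y x N) N).reverse.map L
          ++ List.replicate (y (N + 1)) (L (N + 1)) ++ (U ++ post') := by
      simp only [List.append_assoc]
    rw [hw, descWord, List.map_append, crossWord_append, ih, hΛ, List.map_replicate, hstep,
      hL N hN (by omega)]
    simp only [descWord, descWord_exchanged _ _ hN, min_comm (y (N + 1))]
    simp [exchanged, min_comm (y (N + 1))]

/-- The multiplicities of the letters `1, …, r` in a label. -/
def labelMult {r l : ℕ} [NeZero r] (x : Crystal r l) (i : ℕ) : ℕ := x.1 (i : ZMod r)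

theorem descWord_labelMult {r l : ℕ} [NeZero r] (x : Crystal r l) :
    descWord (labelMult x) r = (word x).reverse :=
  descWord_eq_flatMap _ r

theorem descWord_of_add {f g : ℕ → ℕ} {r p : ℕ} (hr : 1 ≤ r) (h : g r = f r + p)
    (h' : ∀ i, 1 ≤ i → i < r → g i = f i) :
    descWord g r = List.replicate p r ++ descWord f r := by
  obtain ⟨r, rfl⟩ := Nat.exists_eq_add_of_le' hr
  rw [descWord, descWord, h, add_comm, List.replicate_add, List.append_assoc,
    descWord_congr fun ρ h1 h2 => h' ρ h1 (by omega)]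

/-- The letter of `U_q(ŝl_{r+2})` for the letter `i` of a label. -/
def Boundary.solitonLetter {r : ℕ} (κ : Boundary (r + 2)) (i : ℕ) : ZMod (r + 2) :=
  ((i + κ.shift : ℕ) : ZMod (r + 2))

theorem natCast_eq_iff {n a b : ℕ} (h1 : a < b + n) (h2 : b < a + n) :
    (a : ZMod n) = b ↔ a = b :=
  ⟨fun h => add_natCast_inj (e := 0) (by rw [h]) h1 h2, fun h => by rw [h]⟩

theorem Boundary.cases_shift {r : ℕ} (κ : Boundary (r + 2)) :
    (κ.shift = 1 ∧ κ.dualVac = 0) ∨ (κ.shift = 2 ∧ κ.dualVac = 2) := by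
  cases κ <;> simp [Boundary.shift, Boundary.dualVac]

theorem solitonLetter_inj {r : ℕ} (κ : Boundary (r + 2)) (i j : ℕ) (h1 : 1 ≤ i) (h2 : i ≤ r)
    (h3 : 1 ≤ j) (h4 : j ≤ r) (h : κ.solitonLetter i = κ.solitonLetter j) : i = j := by
  have := (natCast_eq_iff (by omega) (by omega)).1 h
  omega

theorem solitonLetter_ne_one {r : ℕ} (κ : Boundary (r + 2)) {i : ℕ} (h1 : 1 ≤ i) (h2 : i ≤ r) :
    κ.solitonLetter i ≠ 1 := fun h => by
  rw [Boundary.solitonLetter, ← Nat.cast_one] at h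
  rcases κ.cases_shift with hs | hs
  all_goals
    have := (natCast_eq_iff (by omega) (by omega)).1 h
    omega

theorem solitonLetter_ne_dualVac {r : ℕ} (κ : Boundary (r + 2)) {i : ℕ} (h1 : 1 ≤ i)
    (h2 : i ≤ r) : κ.solitonLetter i ≠ κ.dualVac := fun h => by
  rw [Boundary.solitonLetter] at h
  rcases κ.cases_shift with hs | hs
  · rw [hs.2, ← Nat.cast_zero] at h
    have := (natCast_eq_iff (by omega) (by omega)).1 h
    omega
  · rw [hs.2] at h
    have := (natCast_eq_iff (n := r + 2) (a := i + κ.shift) (b := 2) (by omega) (by omega)).1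
      (by exact_mod_cast h)
    omega

theorem solitonLetter_succ {r : ℕ} (κ : Boundary (r + 2)) (i : ℕ) :
    κ.solitonLetter (i + 1) - 1 = κ.solitonLetter i := by
  simp only [Boundary.solitonLetter]; push_cast; ring

theorem natCast_neg_two {r : ℕ} : (r : ZMod (r + 2)) = -2 := by
  have h : ((r + 2 : ℕ) : ZMod (r + 2)) = 0 := ZMod.natCast_self _
  push_cast at h
  exact eq_neg_of_add_eq_zero_left h

/-- A right soliton `x`, preceded by vacuum letters, crosses a left soliton `y`, followed by vacuum
letters. -/
theorem crossWord_solitons {r l m : ℕ} [NeZero r] (κ : Boundary (r + 2)) (x : Crystal r l)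
    (y : Crystal r m) (A M : ℕ) :
    crossWord (List.replicate (A + crystalP 0 x.1 y.1) 1
        ++ (word x).reverse.map κ.solitonLetter)
      ((word y).map κ.solitonLetter ++ List.replicate (M + crystalP 0 x.1 y.1) κ.dualVac)
      = (List.replicate (crystalP 0 x.1 y.1) κ.dualVac
          ++ (word (classicalRv x y).1).map κ.solitonLetter ++ List.replicate M κ.dualVac,
        List.replicate A 1 ++ (word (classicalRv x y).2).reverse.map κ.solitonLetter
          ++ List.replicate (crystalP 0 x.1 y.1) 1) := by
  have hr : 1 ≤ r := Nat.pos_of_ne_zero (NeZero.ne r)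
  have hn : 3 ≤ r + 2 := by omega
  have hp : crystalP 0 x.1 y.1 = min (labelMult x 1) (labelMult y 1) := by
    simp [crystalP, labelMult]
  set p := crystalP 0 x.1 y.1
  have hlast : ∀ i : ℕ, i = r → crystalP (i : ZMod r) x.1 y.1 = p := fun i hi => by
    rw [hi, ZMod.natCast_self]
  have hx' : descWord (labelMult (classicalRv x y).2) r
      = List.replicate p r ++ descWord (exchanged (labelMult x) (labelMult y) r) r := by
    have key : ∀ i : ℕ, labelMult (classicalRv x y).2 i + min (labelMult x i) (labelMult y i)
        = labelMult x i + crystalP (i : ZMod r) x.1 y.1 := fun i => by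
      have := classicalRv_snd x y i
      rwa [crystalP_pred] at this
    refine descWord_of_add hr ?_ fun i h1 h2 => ?_
    · have := key r
      rw [hlast r rfl] at this
      rw [exchanged, if_neg (by omega)]
      omega
    · have := key i
      rw [exchanged, if_pos h2]
      simp only [crystalP] at this
      simp only [labelMult, Nat.cast_add, Nat.cast_one] at this ⊢
      omega
  have hy' : descWord (labelMult (classicalRv x y).1) r
      = List.replicate p r ++ descWord (exchanged (labelMult y) (labelMult x) r) r := by
    have key : ∀ i : ℕ, labelMult (classicalRv x y).1 i + min (labelMult x i) (labelMult y i)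
        = labelMult y i + crystalP (i : ZMod r) x.1 y.1 := fun i => by
      have := classicalRv_fst x y i
      rwa [crystalP_pred] at this
    refine descWord_of_add hr ?_ fun i h1 h2 => ?_
    · have := key r
      rw [hlast r rfl] at this
      rw [exchanged, if_neg (by omega)]
      omega
    · have := key i
      rw [exchanged, if_pos h2]
      simp only [crystalP] at this
      simp only [labelMult, Nat.cast_add, Nat.cast_one] at this ⊢
      omega
  have hwy : ∀ {k : ℕ} (z : Crystal r k), (descWord (labelMult z) r).reverse = word z :=
    fun z => by rw [descWord_labelMult, List.reverse_reverse]
  have hone : (1 : ZMod (r + 2)) ≠ κ.dualVac := one_ne_dualVac hn κ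
  -- the letters `1` of the label
  have hU : ∀ U : List (ZMod (r + 2)), (∀ u ∈ U, ∃ j, 1 < j ∧ j ≤ r ∧ u = κ.solitonLetter j) →
      ∀ a : ZMod (r + 2), (a = 1 ∨ a = κ.dualVac ∨ a = κ.solitonLetter 1) → a ∉ U :=
    fun U hU a ha h => by
      obtain ⟨j, h1, h2, rfl⟩ := hU a h
      rcases ha with ha | ha | ha
      · exact solitonLetter_ne_one κ (by omega) h2 ha
      · exact solitonLetter_ne_dualVac κ (by omega) h2 ha
      · have := solitonLetter_inj κ _ _ (by omega) h2 le_rfl hr ha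
        omega
  have hl1 := solitonLetter_ne_one κ le_rfl hr
  have hl2 := solitonLetter_ne_dualVac κ le_rfl hr
  have hw : ∀ f : ℕ → ℕ, ∀ a : ZMod (r + 2), (a = 1 ∨ a = κ.dualVac) →
      a ∉ (descWord f r).reverse.map κ.solitonLetter := fun f a ha h => by
    obtain ⟨j, h1, h2⟩ := List.mem_map.1 h
    have h3 := mem_descWord (List.mem_reverse.1 h1)
    rcases ha with ha | ha
    · exact solitonLetter_ne_one κ h3.1 h3.2 (h2.trans ha)
    · exact solitonLetter_ne_dualVac κ h3.1 h3.2 (h2.trans ha)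
  have hmin : min (A + p) p = p := by omega
  rcases κ.cases_shift with ⟨hs, hc⟩ | ⟨hs, hc⟩
  · have d1 : κ.solitonLetter 1 - 1 = 1 := by
      rw [Boundary.solitonLetter, hs]; push_cast; ring
    have d2 : κ.dualVac = 1 - 1 := by rw [hc, sub_self]
    have d3 : κ.dualVac - 1 = κ.solitonLetter r := by
      rw [hc, Boundary.solitonLetter, hs]; push_cast; rw [natCast_neg_two]; ring
    have h1 := crossWord_labels hn (L := κ.solitonLetter) (e := 1) (x := labelMult x)
      (y := labelMult y) (r := r) (pre := List.replicate p 1)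
      (post := List.replicate (M + p) κ.dualVac)
      (post' := List.replicate (M + p) κ.dualVac) (fun j _ _ => solitonLetter_succ κ j)
      (solitonLetter_inj κ) (fun j h2 h3 => notMem_replicate (solitonLetter_ne_one κ h2 h3) _)
      (fun j h2 h3 => notMem_replicate (solitonLetter_ne_dualVac κ h2 h3) _)
      (fun U h2 => by
        have h4 : ∀ a, (a = 1 ∨ a = κ.solitonLetter 1) →
            a ∉ U ++ List.replicate (M + p) κ.dualVac := fun a ha h => by
          rcases List.mem_append.1 h with h | h
          · exact hU U h2 a (by tauto) h
          · rcases ha with ha | ha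
            · exact hone (ha.symm.trans (List.eq_of_mem_replicate h))
            · exact hl2 (ha.symm.trans (List.eq_of_mem_replicate h))
        have := crossWord_replicate hn (v := κ.solitonLetter 1) (Λ₁ := []) List.not_mem_nil
          (h4 _ (Or.inr rfl)) (h4 _ (Or.inl d1)) (labelMult x 1) (labelMult y 1)
        rw [d1, ← hp] at this
        rw [← hp]
        simpa using this) hr le_rfl [] (by simp)
    have h2 := crossWord_replicate_twice hn (v := 1) (Λ₁ := [])
      (Λ₂ := (descWord (exchanged (labelMult y) (labelMult x) r) r).reverse.map κ.solitonLetter)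
      List.not_mem_nil (hw _ 1 (Or.inl rfl)) (hw _ _ (Or.inr d2.symm)) (A + p) p M
    rw [← d2, d3, hmin, Nat.add_sub_cancel, Nat.sub_self] at h2
    rw [← hp] at h1
    simp only [List.append_nil, List.nil_append, List.replicate_zero] at h1 h2
    rw [crossWord_append, ← hwy y, ← descWord_labelMult x, h1, h2, ← hwy, ← descWord_labelMult,
      hx', hy']
    simp
  · have d1 : κ.solitonLetter 1 - 1 = κ.dualVac := by
      rw [hc, Boundary.solitonLetter, hs]; push_cast; ring
    have d2 : κ.dualVac - 1 = 1 := by rw [hc]; ring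
    have d3 : (1 : ZMod (r + 2)) - 1 = κ.solitonLetter r := by
      rw [Boundary.solitonLetter, hs]; push_cast; rw [natCast_neg_two]; ring
    have h1 := crossWord_labels hn (L := κ.solitonLetter) (e := 1) (x := labelMult x)
      (y := labelMult y) (r := r) (pre := List.replicate p κ.dualVac)
      (post := List.replicate (M + p) κ.dualVac)
      (post' := List.replicate p 1 ++ List.replicate M κ.dualVac)
      (fun j _ _ => solitonLetter_succ κ j)
      (solitonLetter_inj κ)
      (fun j h2 h3 => notMem_replicate (solitonLetter_ne_dualVac κ h2 h3) _)
      (fun j h2 h3 h => by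
        rcases List.mem_append.1 h with h | h
        · exact solitonLetter_ne_one κ h2 h3 (List.eq_of_mem_replicate h)
        · exact solitonLetter_ne_dualVac κ h2 h3 (List.eq_of_mem_replicate h))
      (fun U h2 => by
        have := crossWord_replicate_twice hn (v := κ.solitonLetter 1) (Λ₁ := []) (Λ₂ := U)
          List.not_mem_nil (hU U h2 _ (by tauto)) (hU U h2 _ (by tauto)) (labelMult x 1)
          (labelMult y 1) M
        rw [d1, d2, ← hp] at this
        rw [← hp]
        simpa using this) hr le_rfl [] (by simp)
    have h2 := crossWord_replicate hn (v := 1) (Λ₁ := List.replicate p κ.dualVac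
        ++ (descWord (exchanged (labelMult y) (labelMult x) r) r).reverse.map κ.solitonLetter)
      (Λ₂ := List.replicate M κ.dualVac) (fun h => by
        rcases List.mem_append.1 h with h | h
        · exact hone (List.eq_of_mem_replicate h)
        · exact hw _ 1 (Or.inl rfl) h) (notMem_replicate hone _)
      (notMem_replicate (by rw [d3]; exact solitonLetter_ne_dualVac κ hr le_rfl) _) (A + p) p
    rw [d3, hmin, Nat.add_sub_cancel, Nat.sub_self] at h2
    rw [← hp] at h1
    simp only [List.append_nil, List.replicate_zero] at h1 h2
    simp only [List.append_assoc] at h1 h2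
    rw [crossWord_append, ← hwy y, ← descWord_labelMult x, h1]
    simp only [List.append_assoc]
    rw [h2, ← hwy, ← descWord_labelMult, hx', hy']
    simp

/-! ### Time evolution of states with two solitons -/

theorem soliton_right {r l : ℕ} [NeZero r] (κ : Boundary (r + 2)) (x : Crystal r l) :
    soliton κ .right x = ((word x).reverse.map κ.solitonLetter).map
      fun v => (letter v, (vac κ).2) := by
  rw [List.map_map]; rfl

theorem soliton_left {r l : ℕ} [NeZero r] (κ : Boundary (r + 2)) (x : Crystal r l) :
    soliton κ .left x = ((word x).map κ.solitonLetter).map fun v => (letter 1, letter v) := by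
  rw [List.map_map]; rfl

/-- The normal form of a word that begins with local states whose component in `B_1^∨` is the
vacuum letter. -/
theorem normalForm_right_append {n : ℕ} [NeZero n] (hn : 3 ≤ n) {c : ZMod n} {V Λ : List (ZMod n)}
    {S : List (LocalState n)} {X : List (Crystal n 1)} (hV : ∀ v ∈ V, v ≠ c)
    (hS : normalForm S = (Λ.map letter, X)) :
    normalForm (V.map (fun v => ((letter v, letter c) : LocalState n)) ++ S)
      = ((List.replicate V.length c ++ (crossWord V Λ).1).map letter,
        (crossWord V Λ).2.map letter ++ X) := by
  induction V with
  | nil => simpa [crossWord] using hS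
  | cons v V ih =>
    have hv := hV v (by simp)
    have ih := ih fun a ha => hV a (by simp [ha])
    rw [List.map_cons, List.cons_append, normalForm, ih]
    dsimp only
    rw [← List.map_cons, cross_letter hn, ← List.cons_append, ← List.replicate_succ,
      crossLetter_append,
      crossLetter_of_notMem (notMem_replicate hv _)]
    rfl

/-- The normal form of a word that begins with local states whose component in `B_1` is the vacuum
letter. -/
theorem normalForm_left_append {n : ℕ} [NeZero n] (hn : 3 ≤ n) {e : ZMod n} {Λ' Λ : List (ZMod n)}
    {S : List (LocalState n)} {X : List (Crystal n 1)} (hΛ' : e ∉ Λ') (hΛ : e ∉ Λ)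
    (hS : normalForm S = (Λ.map letter, X)) :
    normalForm (Λ'.map (fun a => ((letter e, letter a) : LocalState n)) ++ S)
      = ((Λ' ++ Λ).map letter, List.replicate Λ'.length (letter e) ++ X) := by
  induction Λ' with
  | nil => simpa using hS
  | cons a Λ' ih =>
    have ih := ih fun ha => hΛ' (by simp [ha])
    rw [List.map_cons, List.cons_append, normalForm, ih]
    dsimp only
    rw [← List.map_cons, cross_letter hn, ← List.cons_append, crossLetter_of_notMem fun h => by
      rcases List.mem_append.1 h with h | h
      · exact hΛ' h
      · exact hΛ h]
    rfl

/-- The list of local states of a state with two solitons. -/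
def solitonPair {r l m : ℕ} [NeZero r] (κ : Boundary (r + 2)) (σ τ : Direction) (x : Crystal r l)
    (g : ℕ) (y : Crystal r m) (M : ℕ) : List (LocalState (r + 2)) :=
  soliton κ σ x ++ List.replicate g (vac κ) ++ soliton κ τ y ++ List.replicate M (vac κ)


theorem replicate_vac_left {n : ℕ} [NeZero n] (hn : 3 ≤ n) (κ : Boundary n) (A : ℕ) :
    List.replicate A (vac κ)
      = (List.replicate A κ.dualVac).map fun v => ((letter 1, letter v) : LocalState n) := by
  rw [List.map_replicate, vac_eq hn]

theorem map_ranked_labelWord {r l : ℕ} [NeZero r] (κ : Boundary (r + 2)) {e : ZMod (r + 2)} {δ : ℕ}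
    (hδ : δ ≤ 1) (he : e + (δ : ZMod (r + 2)) = κ.shift) (x : Crystal r l) :
    (labelWord δ x).map (ranked e) = ((word x).reverse.map κ.solitonLetter).map letter := by
  rw [labelWord_eq hδ, List.map_map, List.map_map]
  refine List.map_congr_left fun i _ => ?_
  simp only [Function.comp_apply, ranked, Boundary.solitonLetter]
  rw [Nat.cast_add, Nat.cast_add, ← he, add_left_comm]

theorem mem_word {r l : ℕ} [NeZero r] {x : Crystal r l} {i : ℕ} (h : i ∈ word x) :
    1 ≤ i ∧ i ≤ r := by
  obtain ⟨j, h1, h2⟩ := List.mem_flatMap.1 h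
  rw [List.eq_of_mem_replicate h2]
  rw [List.mem_range'_1] at h1
  omega

theorem ne_one_of_mem {r l : ℕ} [NeZero r] {κ : Boundary (r + 2)} {x : Crystal r l}
    {v : ZMod (r + 2)} (h : v ∈ (word x).map κ.solitonLetter) : v ≠ 1 := by
  obtain ⟨i, h1, rfl⟩ := List.mem_map.1 h
  exact solitonLetter_ne_one κ (mem_word h1).1 (mem_word h1).2

theorem ne_dualVac_of_mem {r l : ℕ} [NeZero r] {κ : Boundary (r + 2)} {x : Crystal r l}
    {v : ZMod (r + 2)} (h : v ∈ (word x).map κ.solitonLetter) : v ≠ κ.dualVac := by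
  obtain ⟨i, h1, rfl⟩ := List.mem_map.1 h
  exact solitonLetter_ne_dualVac κ (mem_word h1).1 (mem_word h1).2

theorem three_le {r : ℕ} [NeZero r] : 3 ≤ r + 2 := by
  have := Nat.pos_of_ne_zero (NeZero.ne r); omega

theorem shift_cases {r : ℕ} (κ : Boundary (r + 2)) :
    ∃ δ δ' : ℕ, δ ≤ 1 ∧ δ' ≤ 1 ∧ (1 : ZMod (r + 2)) + (δ : ZMod (r + 2)) = κ.shift ∧
      κ.dualVac + (δ' : ZMod (r + 2)) = κ.shift := by
  rcases κ.cases_shift with ⟨h1, h2⟩ | ⟨h1, h2⟩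
  · exact ⟨0, 1, by omega, le_rfl, by simp [h1], by simp [h1, h2]⟩
  · exact ⟨1, 0, le_rfl, by omega, by rw [h1]; norm_num, by rw [h1, h2]; norm_num⟩

theorem normalForm_right_right {r l m : ℕ} [NeZero r] (κ : Boundary (r + 2)) {δ : ℕ} (hδ : δ ≤ 1)
    (he : (1 : ZMod (r + 2)) + (δ : ZMod (r + 2)) = κ.shift) (x : Crystal r l) (y : Crystal r m)
    (A g M : ℕ) :
    normalForm (List.replicate A (vac κ) ++ solitonPair κ .right .right x g y M)
      = (List.replicate (A + l + g + m + M) (letter κ.dualVac),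
        twoSolitons 1 δ A x g y M) := by
  have hone := one_ne_dualVac three_le κ
  have h := normalForm_right_append three_le (c := κ.dualVac) (Λ := []) (S := []) (X := [])
    (V := List.replicate A 1 ++ (word x).reverse.map κ.solitonLetter ++ List.replicate g 1
      ++ (word y).reverse.map κ.solitonLetter ++ List.replicate M 1) (fun v hv => by
      simp only [List.mem_append, List.mem_replicate, List.map_reverse, List.mem_reverse] at hv
      rcases hv with (((⟨-, rfl⟩ | hv) | ⟨-, rfl⟩) | hv) | ⟨-, rfl⟩
      · exact hone
      · exact ne_dualVac_of_mem hv
      · exact hone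
      · exact ne_dualVac_of_mem hv
      · exact hone) rfl
  have hnil : ∀ V : List (ZMod (r + 2)), crossWord V [] = ([], V) := fun V => by
    induction V with
    | nil => rfl
    | cons v V ih => simp [crossWord, ih, crossLetter]
  have hin : List.replicate A (vac κ) ++ solitonPair κ .right .right x g y M
      = (List.replicate A 1 ++ (word x).reverse.map κ.solitonLetter ++ List.replicate g 1
      ++ (word y).reverse.map κ.solitonLetter ++ List.replicate M 1).map
        (fun v => ((letter v, letter κ.dualVac) : LocalState (r + 2))) ++ [] := by
    simp only [solitonPair, soliton_right, vac_eq three_le, List.map_replicate,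
      List.map_append, List.append_assoc, List.append_nil]
  rw [hin, h, hnil, twoSolitons, map_ranked_labelWord κ hδ he, map_ranked_labelWord κ hδ he]
  simp only [List.map_append, List.map_replicate, List.append_nil, List.length_append,
    List.length_replicate, List.length_map, List.length_reverse, length_word]

theorem normalForm_left_left {r l m : ℕ} [NeZero r] (κ : Boundary (r + 2)) {δ : ℕ} (hδ : δ ≤ 1)
    (he : κ.dualVac + (δ : ZMod (r + 2)) = κ.shift) (x : Crystal r l) (y : Crystal r m)
    (A g M : ℕ) :
    normalForm (List.replicate A (vac κ) ++ solitonPair κ .left .left x g y M)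
      = ((twoSolitons κ.dualVac δ M y g x A).reverse,
        List.replicate (A + l + g + m + M) (letter 1)) := by
  have hone := one_ne_dualVac three_le κ
  have h := normalForm_left_append three_le (e := 1) (Λ := []) (S := []) (X := [])
    (Λ' := List.replicate A κ.dualVac ++ (word x).map κ.solitonLetter
      ++ List.replicate g κ.dualVac
      ++ (word y).map κ.solitonLetter ++ List.replicate M κ.dualVac) (fun hv => by
      simp only [List.mem_append, List.mem_replicate] at hv
      rcases hv with (((⟨-, hv⟩ | hv) | ⟨-, hv⟩) | hv) | ⟨-, hv⟩
      · exact hone hv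
      · exact ne_one_of_mem hv rfl
      · exact hone hv
      · exact ne_one_of_mem hv rfl
      · exact hone hv) List.not_mem_nil rfl
  have hin : List.replicate A (vac κ) ++ solitonPair κ .left .left x g y M
      = (List.replicate A κ.dualVac ++ (word x).map κ.solitonLetter
        ++ List.replicate g κ.dualVac
      ++ (word y).map κ.solitonLetter ++ List.replicate M κ.dualVac).map
        (fun v => ((letter 1, letter v) : LocalState (r + 2))) ++ [] := by
    simp only [solitonPair, soliton_left, replicate_vac_left three_le,
      List.map_append, List.append_assoc, List.append_nil]
  rw [hin, h, twoSolitons, map_ranked_labelWord κ hδ he, map_ranked_labelWord κ hδ he]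
  simp only [List.map_append, List.map_replicate, List.append_nil, List.length_append,
    List.length_replicate, List.length_map, length_word, List.reverse_append,
    List.reverse_replicate, List.map_reverse, List.reverse_reverse, List.append_assoc,
    Nat.add_assoc]

theorem labelWord_avoids {r l : ℕ} [NeZero r] (κ : Boundary (r + 2)) {e a : ZMod (r + 2)} {δ : ℕ}
    (hδ : δ ≤ 1) (he : e + (δ : ZMod (r + 2)) = κ.shift) (ha : a = 1 ∨ a = κ.dualVac)
    (x : Crystal r l) : ∀ b ∈ (labelWord δ x).map (ranked e), b.1 a = 0 := by
  rw [map_ranked_labelWord κ hδ he]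
  intro b hb
  obtain ⟨v, hv, rfl⟩ := List.mem_map.1 hb
  rw [List.map_reverse, List.mem_reverse] at hv
  rw [letter_apply, if_neg]
  rcases ha with rfl | rfl
  · exact (ne_one_of_mem hv).symm
  · exact (ne_dualVac_of_mem hv).symm

theorem passWord_iterate_replicate {n k : ℕ} [NeZero n] (hk : 1 ≤ k) (e : ZMod n) (M T : ℕ) :
    (passWord e k)^[T] (List.replicate M (letter e)) = List.replicate M (letter e) := by
  induction T with
  | zero => rfl
  | succ T ih => rw [Function.iterate_succ_apply, passWord_replicate hk, ih]

/-- A longer right soliton overtakes a shorter one. -/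
theorem timeEvolution_right_right {r l m k : ℕ} [NeZero r] (hm : 1 ≤ m) (hml : m < l)
    (hmk : m < k) (κ : Boundary (r + 2)) (x : Crystal r l) (y : Crystal r m) {T g M g' M' : ℕ}
    (hg : l ≤ g) (hT : g + 3 * l ≤ T * (min k l - m)) (hM : T * k ≤ M)
    (hM' : M' + T * min k l + m = M + g + crystalQ 0 x.1 y.1)
    (hg' : g' + g + l + 2 * crystalQ 0 x.1 y.1 = 3 * m + T * (min k l - m)) :
    (timeEvolution κ k)^[T] (ofList κ (solitonPair κ .right .right x g y M))
      = ofList κ (solitonPair κ .right .right (classicalR x y).1 g' (classicalR x y).2 M') := by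
  obtain ⟨δ, -, hδ, -, he, -⟩ := shift_cases κ
  have hone := one_ne_dualVac three_le κ
  have hk : 1 ≤ k := by omega
  have hmul : T * min k l = T * m + T * (min k l - m) := by
    rw [← Nat.mul_add, Nat.add_sub_cancel' (by omega)]
  -- the number of vacuum letters in front is at our disposal; it has to be large enough for
  -- `iterate_collision`
  set A := T * k + ((l - m) * (m + 1) + (T * (min k l - m) + 3 * l) * l) + 2 * m with hA
  obtain ⟨A', hA'⟩ := Nat.exists_eq_add_of_le (show 2 * m ≤ A + g + l + crystalQ 0 x.1 y.1 + T * m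
    by omega)
  have hcol := iterate_collision hm hml hmk 1 hδ x y (A := A) (A' := A') hg hT (by omega) hM' hg'
    (by omega)
  have hX : twoSolitons 1 δ A x g y M = (List.replicate A (letter 1)
      ++ (labelWord δ x).map (ranked 1) ++ List.replicate g (letter 1)
      ++ (labelWord δ y).map (ranked 1)) ++ List.replicate M (letter 1) := rfl
  have hnf := normalForm_right_right κ hδ he x y A g M
  rw [hX] at hnf
  obtain ⟨L', h1, h2⟩ := timeEvolution_iterate three_le hk κ (T := T) (Λ := [])
    (X := List.replicate A (letter 1) ++ (labelWord δ x).map (ranked 1)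
      ++ List.replicate g (letter 1) ++ (labelWord δ y).map (ranked 1))
    (M := M) (M' := A + l + g + m + M) (by rw [hnf, List.nil_append, List.reverse_replicate])
    (by simp) (fun b hb => by
      simp only [List.mem_append, List.mem_replicate] at hb
      rcases hb with ((⟨-, rfl⟩ | hb) | ⟨-, rfl⟩) | hb
      · rw [letter_apply, if_neg hone.symm]
      · exact labelWord_avoids κ hδ he (Or.inr rfl) x b hb
      · rw [letter_apply, if_neg hone.symm]
      · exact labelWord_avoids κ hδ he (Or.inr rfl) y b hb) hM (by omega)
  rw [← hX, hcol, List.nil_append, passWord_iterate_replicate hk, List.reverse_replicate] at h2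
  have h3 := normalForm_right_right κ hδ he (classicalR x y).1 (classicalR x y).2 A' g' M'
  rw [show A' + m + g' + l + M' = A + l + g + m + M by omega, ← h2] at h3
  rw [← ofList_vac_append κ _ A, h1, ← normalForm_injective h3, ofList_vac_append]

/-- A longer left soliton overtakes a shorter one. -/
theorem timeEvolution_left_left {r l m k : ℕ} [NeZero r] (hl : 1 ≤ l) (hlm : l < m)
    (hlk : l < k) (κ : Boundary (r + 2)) (x : Crystal r l) (y : Crystal r m) {T g M g' M' : ℕ}
    (hg : m ≤ g) (hT : g + 3 * m ≤ T * (min k m - l))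
    (hM : T * k + ((m - l) * (l + 1) + (T * (min k m - l) + 3 * m) * m) ≤ M)
    (hM' : M' + 2 * l = M + g + m + crystalQ 0 y.1 x.1 + T * l)
    (hg' : g' + g + m + 2 * crystalQ 0 y.1 x.1 = 3 * l + T * (min k m - l)) :
    (timeEvolution κ k)^[T] (ofList κ (solitonPair κ .left .left x g y M))
      = ofList κ (solitonPair κ .left .left (classicalRvv x y).1 g' (classicalRvv x y).2 M') := by
  obtain ⟨-, δ, -, hδ, -, he⟩ := shift_cases κ
  have hone := one_ne_dualVac three_le κ
  have hk : 1 ≤ k := by omega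
  have hmul : T * min k m = T * l + T * (min k m - l) := by
    rw [← Nat.mul_add, Nat.add_sub_cancel' (by omega)]
  have hle : T * min k m ≤ T * k := Nat.mul_le_mul le_rfl (min_le_left _ _)
  set A := T * k + l with hA
  obtain ⟨A', hA'⟩ := Nat.exists_eq_add_of_le (show T * min k m + l ≤ A + g + crystalQ 0 y.1 x.1
    by omega)
  have hcol := iterate_collision hl hlm hlk κ.dualVac hδ y x (A := M) (A' := M') (M := A)
    (M' := A') hg hT (by omega) (by omega) hg' hM'
  have hX : twoSolitons κ.dualVac δ M y g x A = (List.replicate M (letter κ.dualVac)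
      ++ (labelWord δ y).map (ranked κ.dualVac) ++ List.replicate g (letter κ.dualVac)
      ++ (labelWord δ x).map (ranked κ.dualVac)) ++ List.replicate A (letter κ.dualVac) := rfl
  have hnf := normalForm_left_left κ hδ he x y A g M
  rw [hX] at hnf
  obtain ⟨L', h1, h2⟩ := timeEvolution_iterate three_le hk κ (T := T) (X := [])
    (Λ := List.replicate M (letter κ.dualVac) ++ (labelWord δ y).map (ranked κ.dualVac)
      ++ List.replicate g (letter κ.dualVac) ++ (labelWord δ x).map (ranked κ.dualVac))
    (M := A + l + g + m + M) (M' := A) (by rw [hnf, List.nil_append]) (fun b hb => by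
      simp only [List.mem_append, List.mem_replicate] at hb
      rcases hb with ((⟨-, rfl⟩ | hb) | ⟨-, rfl⟩) | hb
      · rw [letter_apply, if_neg hone]
      · exact labelWord_avoids κ hδ he (Or.inl rfl) y b hb
      · rw [letter_apply, if_neg hone]
      · exact labelWord_avoids κ hδ he (Or.inl rfl) x b hb) (by simp) (by omega) (by omega)
  rw [← hX, hcol, List.nil_append, passWord_iterate_replicate hk] at h2
  have h3 := normalForm_left_left κ hδ he (classicalRvv x y).1 (classicalRvv x y).2 A' g' M'
  rw [show A' + m + g' + l + M' = A + l + g + m + M by omega] at h3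
  rw [← ofList_vac_append κ _ A, h1, ← normalForm_injective (h3.trans h2.symm),
    ofList_vac_append]

theorem iterate_soliton {r l k : ℕ} [NeZero r] (hk : 1 ≤ k) (hl : 1 ≤ l) (κ : Boundary (r + 2))
    {e : ZMod (r + 2)} {δ : ℕ} (hδ : δ ≤ 1) (he : e + (δ : ZMod (r + 2)) = κ.shift)
    (x : Crystal r l) (M T : ℕ) : ∀ A : ℕ,
    (passWord e k)^[T] ((List.replicate A e ++ (word x).reverse.map κ.solitonLetter
        ++ List.replicate (M + T * min k l) e).map letter)
      = (List.replicate (A + T * min k l) e ++ (word x).reverse.map κ.solitonLetter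
        ++ List.replicate M e).map letter := by
  induction T with
  | zero => intro A; simp
  | succ T ih =>
    intro A
    have h := passWord_soliton hk e (range_labelWord δ x) (pairwise_descWord _ _)
      (labelWord_ne_nil hδ hl x) A (M := M + (T + 1) * min k l)
      (by rw [length_labelWord hδ, Nat.succ_mul]; omega)
    rw [map_ranked_labelWord κ hδ he, length_labelWord hδ] at h
    have h := congrArg Prod.fst h
    have e1 : M + (T + 1) * min k l - min k l = M + T * min k l := by
      rw [Nat.succ_mul]; omega
    have e2 : A + (T + 1) * min k l = A + min k l + T * min k l := by
      rw [Nat.succ_mul]; omega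
    rw [e1] at h
    rw [Function.iterate_succ_apply, e2, ← ih]
    simp only [List.map_append, List.map_replicate]
    exact congrArg _ h

/-- In the normal form of a state before the collision the two solitons have crossed each other: the
labels are changed by `R^∨`, and both words are shifted by `P_0(x, y)`. -/
theorem normalForm_right_left {r l m : ℕ} [NeZero r] (κ : Boundary (r + 2)) (x : Crystal r l)
    (y : Crystal r m) (A g M : ℕ) :
    normalForm (List.replicate (A + crystalP 0 x.1 y.1) (vac κ)
        ++ solitonPair κ .right .left x g y (M + crystalP 0 x.1 y.1))
      = ((List.replicate (A + l + g + 2 * crystalP 0 x.1 y.1) κ.dualVac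
          ++ (word (classicalRv x y).1).map κ.solitonLetter
          ++ List.replicate M κ.dualVac).map letter,
        (List.replicate A 1 ++ (word (classicalRv x y).2).reverse.map κ.solitonLetter
          ++ List.replicate (M + m + g + 2 * crystalP 0 x.1 y.1) 1).map letter) := by
  have hone := one_ne_dualVac three_le κ
  have hS := normalForm_left_append three_le (e := 1) (Λ := []) (S := []) (X := [])
    (Λ' := List.replicate g κ.dualVac
      ++ ((word y).map κ.solitonLetter ++ List.replicate (M + crystalP 0 x.1 y.1) κ.dualVac))
    (fun hv => by
      simp only [List.mem_append, List.mem_replicate] at hv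
      rcases hv with ⟨-, hv⟩ | hv | ⟨-, hv⟩
      · exact hone hv
      · exact ne_one_of_mem hv rfl
      · exact hone hv) List.not_mem_nil rfl
  have hV : ∀ v ∈ List.replicate (A + crystalP 0 x.1 y.1) 1
      ++ (word x).reverse.map κ.solitonLetter, v ≠ κ.dualVac := fun v hv => by
    simp only [List.mem_append, List.mem_replicate, List.map_reverse, List.mem_reverse] at hv
    rcases hv with ⟨-, rfl⟩ | hv
    · exact hone
    · exact ne_dualVac_of_mem hv
  have h := normalForm_right_append three_le (c := κ.dualVac) hV (by rw [hS, List.append_nil])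
  rw [crossWord_append_right fun v hv => notMem_replicate (hV v hv) _, crossWord_solitons] at h
  have hin : List.replicate (A + crystalP 0 x.1 y.1) (vac κ)
        ++ solitonPair κ .right .left x g y (M + crystalP 0 x.1 y.1)
      = (List.replicate (A + crystalP 0 x.1 y.1) 1 ++ (word x).reverse.map κ.solitonLetter).map
          (fun v => ((letter v, letter κ.dualVac) : LocalState (r + 2)))
        ++ ((List.replicate g κ.dualVac ++ ((word y).map κ.solitonLetter
          ++ List.replicate (M + crystalP 0 x.1 y.1) κ.dualVac)).map
            (fun v => ((letter 1, letter v) : LocalState (r + 2))) ++ []) := by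
    simp only [solitonPair, soliton_right, soliton_left, vac_eq three_le, List.map_replicate,
      List.map_append, List.append_assoc, List.append_nil]
  have e1 : A + l + g + 2 * crystalP 0 x.1 y.1
      = A + crystalP 0 x.1 y.1 + (l + (g + crystalP 0 x.1 y.1)) := by omega
  have e2 : M + m + g + 2 * crystalP 0 x.1 y.1
      = crystalP 0 x.1 y.1 + (g + (m + (M + crystalP 0 x.1 y.1))) := by omega
  rw [hin, h, e1, e2]
  simp only [List.map_append, List.map_replicate, List.append_nil, List.length_append,
    List.length_replicate, List.length_map, List.length_reverse, length_word, List.append_assoc,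
    List.replicate_add]

/-- In a state after the collision the solitons do not meet in the course of computing the normal
form. -/
theorem normalForm_left_right {r l m : ℕ} [NeZero r] (κ : Boundary (r + 2)) (x : Crystal r l)
    (y : Crystal r m) (A g M : ℕ) :
    normalForm (List.replicate A (vac κ) ++ solitonPair κ .left .right y g x M)
      = ((List.replicate A κ.dualVac ++ (word y).map κ.solitonLetter
          ++ List.replicate (g + l + M) κ.dualVac).map letter,
        (List.replicate (A + m + g) 1 ++ (word x).reverse.map κ.solitonLetter
          ++ List.replicate M 1).map letter) := by
  have hone := one_ne_dualVac three_le κ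
  have hnil : ∀ V : List (ZMod (r + 2)), crossWord V [] = ([], V) := fun V => by
    induction V with
    | nil => rfl
    | cons v V ih => simp [crossWord, ih, crossLetter]
  have hS := normalForm_right_append three_le (c := κ.dualVac) (Λ := []) (S := []) (X := [])
    (V := List.replicate g 1 ++ (word x).reverse.map κ.solitonLetter ++ List.replicate M 1)
    (fun v hv => by
      simp only [List.mem_append, List.mem_replicate, List.map_reverse, List.mem_reverse] at hv
      rcases hv with (⟨-, rfl⟩ | hv) | ⟨-, rfl⟩
      · exact hone
      · exact ne_dualVac_of_mem hv
      · exact hone) rfl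
  simp only [hnil, List.append_nil] at hS
  have h := normalForm_left_append three_le (e := 1)
    (Λ' := List.replicate A κ.dualVac ++ (word y).map κ.solitonLetter) (fun hv => by
      simp only [List.mem_append, List.mem_replicate] at hv
      rcases hv with ⟨-, hv⟩ | hv
      · exact hone hv
      · exact ne_one_of_mem hv rfl) (notMem_replicate hone _) hS
  have hin : List.replicate A (vac κ) ++ solitonPair κ .left .right y g x M
      = (List.replicate A κ.dualVac ++ (word y).map κ.solitonLetter).map
          (fun v => ((letter 1, letter v) : LocalState (r + 2)))
        ++ ((List.replicate g 1 ++ (word x).reverse.map κ.solitonLetter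
          ++ List.replicate M 1).map
            (fun v => ((letter v, letter κ.dualVac) : LocalState (r + 2)))) := by
    simp only [solitonPair, soliton_right, soliton_left, vac_eq three_le, List.map_replicate,
      List.map_append, List.append_assoc]
  rw [hin, h]
  simp only [List.map_append, List.map_replicate, List.length_append,
    List.length_replicate, List.length_map, List.length_reverse, length_word, List.append_assoc,
    List.replicate_add]

/-- A right soliton and a left soliton pass through each other. -/
theorem timeEvolution_right_left {r l m k : ℕ} [NeZero r] (hk : 1 ≤ k) (hl : 1 ≤ l) (hm : 1 ≤ m)
    (κ : Boundary (r + 2)) (x : Crystal r l) (y : Crystal r m) {T g M g' M' : ℕ}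
    (hM : T * k + l ≤ M)
    (hM' : M' + T * min k l = M + g + m + crystalP 0 x.1 y.1)
    (hg' : g' + g + l + m + 2 * crystalP 0 x.1 y.1 = T * min k l + T * min k m) :
    (timeEvolution κ k)^[T] (ofList κ (solitonPair κ .right .left x g y M))
      = ofList κ (solitonPair κ .left .right (classicalRv x y).1 g' (classicalRv x y).2 M') := by
  obtain ⟨δ, δ', hδ, hδ', he, he'⟩ := shift_cases κ
  have hone := one_ne_dualVac three_le κ
  have hp : crystalP 0 x.1 y.1 ≤ l := (min_le_left _ _).trans (apply_le x _)
  set p := crystalP 0 x.1 y.1 with hpdef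
  have hl' : T * min k l ≤ T * k := Nat.mul_le_mul le_rfl (min_le_left _ _)
  have hm' : T * min k m ≤ T * k := Nat.mul_le_mul le_rfl (min_le_left _ _)
  obtain ⟨M, rfl⟩ := Nat.exists_eq_add_of_le' (show p ≤ M by omega)
  set A := T * k with hA
  have hnf := normalForm_right_left κ x y A g M
  rw [← hpdef] at hnf
  obtain ⟨A', hA'⟩ := Nat.exists_eq_add_of_le' (show T * min k m ≤ A + l + g + 2 * p by omega)
  obtain ⟨L', h1, h2⟩ := timeEvolution_iterate three_le hk κ (T := T)
    (Λ := (List.replicate M κ.dualVac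
      ++ (word (classicalRv x y).1).reverse.map κ.solitonLetter).map letter)
    (X := (List.replicate A 1 ++ (word (classicalRv x y).2).reverse.map κ.solitonLetter).map
      letter) (M := M + m + g + 2 * p) (M' := A + l + g + 2 * p)
    (by
      rw [hnf]
      simp only [List.map_append, List.map_replicate, List.reverse_append, List.reverse_replicate,
        List.map_reverse, List.reverse_reverse, List.append_assoc])
    (fun b hb => by
      obtain ⟨v, hv, rfl⟩ := List.mem_map.1 hb
      simp only [List.mem_append, List.mem_replicate, List.map_reverse, List.mem_reverse] at hv
      rw [letter_apply, if_neg]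
      rcases hv with ⟨-, rfl⟩ | hv
      · exact hone
      · exact (ne_one_of_mem hv).symm)
    (fun b hb => by
      obtain ⟨v, hv, rfl⟩ := List.mem_map.1 hb
      simp only [List.mem_append, List.mem_replicate, List.map_reverse, List.mem_reverse] at hv
      rw [letter_apply, if_neg]
      rcases hv with ⟨-, rfl⟩ | hv
      · exact hone.symm
      · exact (ne_dualVac_of_mem hv).symm) (by omega) (by omega)
  have h3 := iterate_soliton hk hl κ hδ he (classicalRv x y).2 M' T A
  have h4 := iterate_soliton hk hm κ hδ' he' (classicalRv x y).1 A' T M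
  have h5 := normalForm_left_right κ (classicalRv x y).2 (classicalRv x y).1 A' g' M'
  rw [show M' + T * min k l = M + m + g + 2 * p by omega,
    List.map_append, List.map_replicate] at h3
  rw [← hA', List.map_append, List.map_replicate] at h4
  rw [h3, h4] at h2
  have h6 : normalForm L'
      = normalForm (List.replicate A' (vac κ)
        ++ solitonPair κ .left .right (classicalRv x y).1 g' (classicalRv x y).2 M') := by
    rw [h2, h5, show A' + m + g' = A + T * min k l by omega,
      show g' + l + M' = M + T * min k m by omega]
    simp only [List.map_append, List.map_replicate, List.reverse_append, List.reverse_replicate,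
      List.map_reverse, List.reverse_reverse, List.append_assoc]
  rw [← ofList_vac_append κ _ (A + p), h1, normalForm_injective h6, ofList_vac_append]

/-! ### Scattering data are determined by the state -/

theorem map_injOn {α β : Type*} {f : α → β} : ∀ {L L' : List α},
    (∀ a ∈ L, ∀ b ∈ L', f a = f b → a = b) → L.map f = L'.map f → L = L'
  | [], [], _, _ => rfl
  | [], _ :: _, _, h => by simp at h
  | _ :: _, [], _, h => by simp at h
  | a :: L, b :: L', hf, h => by
    rw [List.map_cons, List.map_cons, List.cons.injEq] at h
    rw [hf a (by simp) b (by simp) h.1,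
      map_injOn (fun a ha b hb => hf a (by simp [ha]) b (by simp [hb])) h.2]

theorem letter_injective {n : ℕ} [NeZero n] {a b : ZMod n} (h : letter a = letter b) : a = b := by
  by_contra hab
  have h1 := letter_apply a a
  rw [h, letter_apply, if_neg hab, if_pos rfl] at h1
  omega

theorem word_injective {r l : ℕ} [NeZero r] {x y : Crystal r l} (h : word x = word y) : x = y := by
  have hr : 0 < r := Nat.pos_of_ne_zero (NeZero.ne r)
  have key : ∀ ρ : ℕ, 1 ≤ ρ → ρ ≤ r → x.1 (ρ : ZMod r) = y.1 (ρ : ZMod r) := fun ρ h1 h2 => by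
    have hx := count_descWord (labelMult x) h1 h2
    have hy := count_descWord (labelMult y) h1 h2
    rw [descWord_labelMult, h, ← descWord_labelMult, hy] at hx
    exact hx.symm
  refine Crystal.ext fun i => ?_
  rcases Nat.eq_zero_or_pos i.val with h0 | h0
  · have := key r hr le_rfl
    rwa [ZMod.natCast_self, ← (ZMod.val_eq_zero i).1 h0] at this
  · have := key i.val h0 (ZMod.val_lt i).le
    rwa [ZMod.natCast_zmod_val] at this

theorem soliton_injective {r l : ℕ} [NeZero r] {κ : Boundary (r + 2)} {σ : Direction}
    {x y : Crystal r l} (h : soliton κ σ x = soliton κ σ y) : x = y := by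
  refine word_injective ?_
  cases σ with
  | right =>
    refine List.reverse_injective (map_injOn (fun i hi j hj hij => ?_) h)
    rw [List.mem_reverse] at hi hj
    exact solitonLetter_inj κ i j (mem_word hi).1 (mem_word hi).2 (mem_word hj).1 (mem_word hj).2
      (letter_injective (congrArg Prod.fst hij))
  | left =>
    refine map_injOn (fun i hi j hj hij => ?_) h
    exact solitonLetter_inj κ i j (mem_word hi).1 (mem_word hi).2 (mem_word hj).1 (mem_word hj).2
      (letter_injective (congrArg Prod.snd hij))

theorem length_soliton {r l : ℕ} [NeZero r] (κ : Boundary (r + 2)) (σ : Direction)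
    (x : Crystal r l) : (soliton κ σ x).length = l := by
  cases σ <;> simp [soliton, length_word]

theorem ne_vac_of_mem_soliton {r l : ℕ} [NeZero r] {κ : Boundary (r + 2)} {σ : Direction}
    {x : Crystal r l} {s : LocalState (r + 2)} (h : s ∈ soliton κ σ x) : s ≠ vac κ := by
  rintro rfl
  cases σ with
  | right =>
    rw [soliton_right] at h
    obtain ⟨v, hv, h⟩ := List.mem_map.1 h
    rw [List.map_reverse, List.mem_reverse] at hv
    exact ne_one_of_mem hv (letter_injective (congrArg Prod.fst h))
  | left =>
    rw [soliton_left, vac_eq three_le] at h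
    obtain ⟨v, hv, h⟩ := List.mem_map.1 h
    exact ne_dualVac_of_mem hv (letter_injective (congrArg Prod.snd h))

theorem exists_soliton_eq_cons {r l : ℕ} [NeZero r] (κ : Boundary (r + 2)) (σ : Direction)
    (hl : 1 ≤ l) (x : Crystal r l) : ∃ s L, soliton κ σ x = s :: L ∧ s ≠ vac κ := by
  cases h : soliton κ σ x with
  | nil =>
    have := length_soliton κ σ x
    rw [h, List.length_nil] at this
    omega
  | cons s L => exact ⟨s, L, rfl, ne_vac_of_mem_soliton (σ := σ) (x := x) (by rw [h]; simp)⟩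

theorem length_le_of_ofList_eq {n : ℕ} [NeZero n] {κ : Boundary n} {s s' : LocalState n}
    {L L' : List (LocalState n)} (hs : s' ≠ vac κ) (h : ofList κ (s :: L) = ofList κ (s' :: L')) :
    L'.length ≤ L.length := by
  by_contra hlt
  have h1 := congrFun h L'.length
  rw [ofList_cons_length, ofList_of_le κ (by rw [List.length_cons]; omega)] at h1
  exact hs h1.symm

theorem eq_of_ofList_eq {n : ℕ} [NeZero n] {κ : Boundary n} {L L' : List (LocalState n)}
    (hlen : L.length = L'.length) (h : ofList κ L = ofList κ L') : L = L' := by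
  refine List.reverse_injective (List.ext_getElem (by simp [hlen]) fun j h1 h2 => ?_)
  have := congrFun h j
  rwa [ofList, ofList, List.getD_eq_getElem _ _ h1, List.getD_eq_getElem _ _ h2] at this

theorem replicate_append_inj {α : Type*} {a b b' : α} (hb : b ≠ a) (hb' : b' ≠ a) {L L' : List α} :
    ∀ {g g' : ℕ}, List.replicate g a ++ b :: L = List.replicate g' a ++ b' :: L' → g = g'
  | 0, 0, _ => rfl
  | 0, g' + 1, h => by
    rw [List.replicate_succ] at h
    exact absurd (List.cons.inj h).1 hb
  | g + 1, 0, h => by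
    rw [List.replicate_succ] at h
    exact absurd (List.cons.inj h).1.symm hb'
  | g + 1, g' + 1, h => by
    rw [List.replicate_succ, List.replicate_succ] at h
    rw [replicate_append_inj hb hb' (List.cons.inj h).2]

theorem solitonPair_injective {r l m : ℕ} [NeZero r] {κ : Boundary (r + 2)} {σ τ : Direction}
    (hl : 1 ≤ l) (hm : 1 ≤ m) {x x' : Crystal r l} {y y' : Crystal r m} {g M g' M' : ℕ}
    (h : ofList κ (solitonPair κ σ τ x g y M) = ofList κ (solitonPair κ σ τ x' g' y' M')) :
    x = x' ∧ y = y' ∧ g = g' ∧ M = M' := by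
  obtain ⟨s, S, hS, hs⟩ := exists_soliton_eq_cons κ σ hl x
  obtain ⟨s', S', hS', hs'⟩ := exists_soliton_eq_cons κ σ hl x'
  obtain ⟨u, U, hU, hu⟩ := exists_soliton_eq_cons κ τ hm y
  obtain ⟨u', U', hU', hu'⟩ := exists_soliton_eq_cons κ τ hm y'
  have hlen : (solitonPair κ σ τ x g y M).length = (solitonPair κ σ τ x' g' y' M').length := by
    simp only [solitonPair, hS, hS', List.cons_append] at h ⊢
    rw [List.length_cons, List.length_cons]
    exact congrArg (· + 1)
      (le_antisymm (length_le_of_ofList_eq hs h.symm) (length_le_of_ofList_eq hs' h))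
  have heq := eq_of_ofList_eq hlen h
  simp only [solitonPair, List.length_append, length_soliton, List.length_replicate] at hlen
  simp only [solitonPair, List.append_assoc] at heq
  obtain ⟨h1, h2⟩ := List.append_inj heq (by rw [length_soliton, length_soliton])
  have hg : g = g' := by
    rw [hU, hU', List.cons_append, List.cons_append] at h2
    exact replicate_append_inj hu hu' h2
  obtain ⟨-, h3⟩ := List.append_inj h2 (by rw [List.length_replicate, List.length_replicate, hg])
  obtain ⟨h4, -⟩ := List.append_inj h3 (by rw [length_soliton, length_soliton])
  exact ⟨soliton_injective h1, soliton_injective h4, hg, by omega⟩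

theorem phase_injective {σ : Direction} {d d' : ℤ} (h : phase σ d = phase σ d') : d = d' := by
  cases σ <;> simp only [phase] at h <;> omega

theorem hasScatteringData_unique {r l m : ℕ} [NeZero r] {κ : Boundary (r + 2)} {k : ℕ} {t : ℤ}
    {σ τ : Direction} (hl : 1 ≤ l) (hm : 1 ≤ m) {a a' : Aff (Crystal r l)}
    {b b' : Aff (Crystal r m)} {p : Config (r + 2)} (h : HasScatteringData κ k t σ τ a b p)
    (h' : HasScatteringData κ k t σ τ a' b' p) : a = a' ∧ b = b' := by
  obtain ⟨g, M, -, hp, h1, h2⟩ := h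
  obtain ⟨g', M', -, hp', h1', h2'⟩ := h'
  obtain ⟨h3, h4, rfl, rfl⟩ := solitonPair_injective hl hm (hp.symm.trans hp')
  rw [h1] at h1'
  rw [h2] at h2'
  exact ⟨Aff.ext (phase_injective (add_left_cancel h1')) h3,
    Aff.ext (phase_injective (add_left_cancel h2')) h4⟩

/-- There is at most one outcome of a scattering, since initial states exist. -/
theorem scatters_iff {r l m : ℕ} [NeZero r] {κ : Boundary (r + 2)} {k : ℕ} {σ τ : Direction}
    (hl : 1 ≤ l) (hm : 1 ≤ m) {a : Aff (Crystal r l)} {b : Aff (Crystal r m)}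
    {F : Aff (Crystal r m) × Aff (Crystal r l)} (hF : Scatters κ k σ τ a b F)
    (hex : ∃ t₁ : ℤ, ∀ᶠ c : ℤ in Filter.atTop, ∃ p : Config (r + 2),
      HasScatteringData κ k t₁ σ τ (a.translate c) (b.translate c) p)
    (out : Aff (Crystal r m) × Aff (Crystal r l)) :
    Scatters κ k σ τ a b out ↔ out = F := by
  refine ⟨fun h => ?_, fun h => h ▸ hF⟩
  obtain ⟨t₁, ht₁⟩ := hex
  obtain ⟨t₂, h1, h2⟩ := ((h t₁).and (hF t₁)).exists
  obtain ⟨c, ⟨h1, h2⟩, p, hp⟩ := ((h1.and h2).and ht₁).exists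
  obtain ⟨h3, h4⟩ := hasScatteringData_unique hm hl (h1 p hp) (h2 p hp)
  have key : ∀ {X : Type} {a a' : Aff X}, a.translate c = a'.translate c → a = a' :=
    fun {X a a'} h => Aff.ext (add_right_cancel (congrArg Aff.deg h)) (congrArg Aff.elt h :)
  exact Prod.ext (key h3) (key h4)

/-! ### The scattering operators -/

theorem crystalQ_le_right {n l m : ℕ} [NeZero n] (h : m ≤ l) (x : Crystal n l) (y : Crystal n m)
    (i : ZMod n) : crystalQ i x.1 y.1 ≤ m := by
  have := crystalQ_rec_of_le x y h (i + 1)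
  rw [add_sub_cancel_right] at this
  omega

theorem scatters_right_right {r l m k : ℕ} [NeZero r] (κ : Boundary (r + 2)) (hm : 1 ≤ m)
    (hml : m < l) (hmk : m < k) (a : Aff (Crystal r l)) (b : Aff (Crystal r m)) :
    Scatters κ k .right .right a b (modifiedR a b) := by
  have hQ := crystalQ_le_right hml.le a.elt b.elt 0
  obtain ⟨d, hd⟩ := Nat.exists_eq_add_of_le (show m ≤ min k l by omega)
  have hd1 : 1 ≤ d := by omega
  have hmk' : min k m = m := by omega
  have hlm' : min (l : ℤ) m = m := by omega
  intro t₁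
  -- the number in parentheses is the gap at time `t₁`; the difference of the velocities is `d ≥ 1`
  filter_upwards [Filter.eventually_ge_atTop
    (t₁ + (-(d * t₁) + a.deg - b.deg - m) + 3 * l)] with t₂ ht₂
  filter_upwards [Filter.eventually_ge_atTop
    (((t₂ - t₁).toNat * k : ℕ) + m + 1 + m * t₁ - b.deg
      + ((t₂ - t₁).toNat * min k l : ℕ))] with c hc
  rintro p ⟨g, M, hg, rfl, h1, h2⟩
  simp only [position, phase, Aff.translate, ← Nat.cast_min, hmk', hd, minGap] at h1 h2 hg
  push_cast at h1 h2
  have hT : (((t₂ - t₁).toNat : ℕ) : ℤ) = t₂ - t₁ := by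
    rw [Int.toNat_of_nonneg]
    linarith
  set T := (t₂ - t₁).toNat with hTdef
  have hg3 : g + 3 * l ≤ T := by
    have : (g : ℤ) + 3 * l ≤ T := by rw [hT]; linarith
    exact_mod_cast this
  have hTd : T ≤ T * d := Nat.le_mul_of_pos_right T hd1
  have e2 : min k l - m = d := by omega
  have hM : T * k + T * min k l + m ≤ M := by
    have : ((T * k : ℕ) : ℤ) + (T * min k l : ℕ) + m ≤ M := by linarith
    exact_mod_cast this
  -- the position and the gap at time `t₂`, written without subtraction
  obtain ⟨M', hM'⟩ := Nat.exists_eq_add_of_le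
    (show T * min k l + m ≤ M + g + crystalQ 0 a.elt.1 b.elt.1 by omega)
  obtain ⟨g', hg'⟩ := Nat.exists_eq_add_of_le
    (show g + l + 2 * crystalQ 0 a.elt.1 b.elt.1 ≤ 3 * m + T * d by omega)
  have hev := timeEvolution_right_right hm hml hmk κ a.elt b.elt (T := T) (M := M) (M' := M')
    (g' := g') hg (by rw [e2]; omega) (by omega) (by omega) (by rw [e2]; omega)
  refine ⟨g', M', by simp only [minGap]; omega, hev, ?_, ?_⟩
  · simp only [position, phase, Aff.translate, modifiedR, affinize, ← Nat.cast_min, hmk']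
    rw [hd] at hM'
    zify at hM' hg'
    rw [hT] at hM' hg'
    push_cast
    rw [hlm']
    linear_combination h2 - hM' - hg'
  · simp only [position, phase, Aff.translate, modifiedR, affinize, ← Nat.cast_min, hd]
    rw [hd] at hM'
    zify at hM'
    rw [hT] at hM'
    push_cast
    rw [hlm']
    linear_combination h1 - hM'

theorem exists_right_right {r l m k : ℕ} [NeZero r] (κ : Boundary (r + 2))
    (hml : m < l) (hmk : m < k) (a : Aff (Crystal r l)) (b : Aff (Crystal r m)) :
    ∃ t₁ : ℤ, ∀ᶠ c : ℤ in Filter.atTop, ∃ p : Config (r + 2),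
      HasScatteringData κ k t₁ .right .right (a.translate c) (b.translate c) p := by
  obtain ⟨d, hd⟩ := Nat.exists_eq_add_of_le (show m ≤ min k l by omega)
  have hmk' : min k m = m := by omega
  -- at time `-K` the gap is `a.deg - b.deg - m + K * d`, which is at least `l`
  set K : ℕ := l + (b.deg - a.deg + m).toNat with hK
  have hKd : K ≤ K * d := Nat.le_mul_of_pos_right K (by omega)
  have hKd' : (K : ℤ) ≤ K * d := by exact_mod_cast hKd
  have hb := Int.self_le_toNat (b.deg - a.deg + m)
  have hKz : (K : ℤ) = l + (b.deg - a.deg + m).toNat := by rw [hK]; push_cast; ring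
  obtain ⟨g, hg⟩ := Int.eq_ofNat_of_zero_le
    (show 0 ≤ a.deg - b.deg - m + K * d by omega)
  refine ⟨-K, ?_⟩
  filter_upwards [Filter.eventually_ge_atTop (1 - b.deg - m * K)] with c hc
  obtain ⟨M, hM⟩ := Int.eq_ofNat_of_zero_le (show 0 ≤ c + b.deg + m * K - 1 by linarith)
  refine ⟨_, g, M, ?_, rfl, ?_, ?_⟩
  · simp only [minGap]
    omega
  · simp only [position, phase, Aff.translate, ← Nat.cast_min, hd]
    push_cast
    linear_combination -hM - hg
  · simp only [position, phase, Aff.translate, ← Nat.cast_min, hmk']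
    linear_combination -hM

theorem scatters_left_left {r l m k : ℕ} [NeZero r] (κ : Boundary (r + 2)) (hl : 1 ≤ l)
    (hlm : l < m) (hlk : l < k) (a : Aff (Crystal r l)) (b : Aff (Crystal r m)) :
    Scatters κ k .left .left a b (modifiedRvv a b) := by
  have hQ := crystalQ_le_right hlm.le b.elt a.elt 0
  obtain ⟨d, hd⟩ := Nat.exists_eq_add_of_le (show l ≤ min k m by omega)
  have hd1 : 1 ≤ d := by omega
  have hlk' : min k l = l := by omega
  have hlm' : min (l : ℤ) m = l := by omega
  intro t₁
  filter_upwards [Filter.eventually_ge_atTop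
    (t₁ + (-(d * t₁) + a.deg - b.deg - l) + 3 * m)] with t₂ ht₂
  filter_upwards [Filter.eventually_ge_atTop
    (m - (l + d) * t₁ - b.deg + ((t₂ - t₁).toNat * k + ((m - l) * (l + 1)
      + ((t₂ - t₁).toNat * (min k m - l) + 3 * m) * m) + 2 * l : ℕ))] with c hc
  rintro p ⟨g, M, hg, rfl, h1, h2⟩
  simp only [position, phase, Aff.translate, ← Nat.cast_min, hlk', hd, minGap] at h1 h2 hg
  push_cast at h1 h2
  have hT : (((t₂ - t₁).toNat : ℕ) : ℤ) = t₂ - t₁ := by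
    rw [Int.toNat_of_nonneg]
    linarith
  set T := (t₂ - t₁).toNat with hTdef
  have hg3 : g + 3 * m ≤ T := by
    have : (g : ℤ) + 3 * m ≤ T := by rw [hT]; linarith
    exact_mod_cast this
  have hTd : T ≤ T * d := Nat.le_mul_of_pos_right T hd1
  have e2 : min k m - l = d := by omega
  have hM : T * k + ((m - l) * (l + 1) + (T * (min k m - l) + 3 * m) * m) + 2 * l ≤ M := by
    have : ((T * k + ((m - l) * (l + 1) + (T * (min k m - l) + 3 * m) * m) + 2 * l : ℕ) : ℤ)
        ≤ M := by linarith
    exact_mod_cast this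
  obtain ⟨M', hM'⟩ := Nat.exists_eq_add_of_le
    (show 2 * l ≤ M + g + m + crystalQ 0 b.elt.1 a.elt.1 + T * l by omega)
  obtain ⟨g', hg'⟩ := Nat.exists_eq_add_of_le
    (show g + m + 2 * crystalQ 0 b.elt.1 a.elt.1 ≤ 3 * l + T * d by omega)
  have hev := timeEvolution_left_left hl hlm hlk κ a.elt b.elt (T := T) (M := M) (M' := M')
    (g' := g') hg (by rw [e2]; omega) (by omega) (by omega) (by rw [e2]; omega)
  refine ⟨g', M', by simp only [minGap]; omega, hev, ?_, ?_⟩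
  · simp only [position, phase, Aff.translate, modifiedRvv, affinize, ← Nat.cast_min, hd]
    zify at hM' hg'
    rw [hT] at hM' hg'
    push_cast
    rw [hlm']
    linear_combination h2 + hM' + hg'
  · simp only [position, phase, Aff.translate, modifiedRvv, affinize, ← Nat.cast_min, hlk']
    zify at hM'
    rw [hT] at hM'
    push_cast
    rw [hlm']
    linear_combination h1 + hM'

theorem exists_left_left {r l m k : ℕ} [NeZero r] (κ : Boundary (r + 2))
    (hlm : l < m) (hlk : l < k) (a : Aff (Crystal r l)) (b : Aff (Crystal r m)) :
    ∃ t₁ : ℤ, ∀ᶠ c : ℤ in Filter.atTop, ∃ p : Config (r + 2),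
      HasScatteringData κ k t₁ .left .left (a.translate c) (b.translate c) p := by
  obtain ⟨d, hd⟩ := Nat.exists_eq_add_of_le (show l ≤ min k m by omega)
  have hlk' : min k l = l := by omega
  -- at time `-K` the gap is `a.deg - b.deg - l + K * d`, which is at least `m`
  set K : ℕ := m + (b.deg - a.deg + l).toNat with hK
  have hKd : K ≤ K * d := Nat.le_mul_of_pos_right K (by omega)
  have hKd' : (K : ℤ) ≤ K * d := by exact_mod_cast hKd
  have hb := Int.self_le_toNat (b.deg - a.deg + l)
  have hKz : (K : ℤ) = m + (b.deg - a.deg + l).toNat := by rw [hK]; push_cast; ring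
  obtain ⟨g, hg⟩ := Int.eq_ofNat_of_zero_le
    (show 0 ≤ a.deg - b.deg - l + K * d by omega)
  refine ⟨-K, ?_⟩
  filter_upwards [Filter.eventually_ge_atTop ((l + d) * K - b.deg + m)] with c hc
  obtain ⟨M, hM⟩ := Int.eq_ofNat_of_zero_le (show 0 ≤ c + b.deg - (l + d) * K + 1 - m by linarith)
  refine ⟨_, g, M, ?_, rfl, ?_, ?_⟩
  · simp only [minGap]
    omega
  · simp only [position, phase, Aff.translate, ← Nat.cast_min, hlk']
    push_cast
    linear_combination hM + hg
  · simp only [position, phase, Aff.translate, ← Nat.cast_min, hd]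
    push_cast
    linear_combination hM

theorem scatters_right_left {r l m k : ℕ} [NeZero r] (κ : Boundary (r + 2)) (hk : 1 ≤ k)
    (hl : 1 ≤ l) (hm : 1 ≤ m) (a : Aff (Crystal r l)) (b : Aff (Crystal r m)) :
    Scatters κ k .right .left a b (modifiedRv a b) := by
  have hp : crystalP 0 a.elt.1 b.elt.1 ≤ l := (min_le_left _ _).trans (apply_le a.elt _)
  have hkl : 1 ≤ min k l := by omega
  generalize hql : min k l = ql at hkl
  generalize hqm : min k m = qm
  intro t₁
  filter_upwards [Filter.eventually_ge_atTop
    (t₁ + (-((ql + qm) * t₁) + a.deg - b.deg) + 4 * l + m), Filter.eventually_ge_atTop t₁]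
    with t₂ ht₂ ht₂'
  filter_upwards [Filter.eventually_ge_atTop
    (m - qm * t₁ - b.deg + ((t₂ - t₁).toNat * k + l + (t₂ - t₁).toNat * ql : ℕ))] with c hc
  rintro p ⟨g, M, hg, rfl, h1, h2⟩
  simp only [position, phase, Aff.translate, ← Nat.cast_min, hql, hqm, minGap] at h1 h2 hg
  push_cast at h1 h2
  have hT : (((t₂ - t₁).toNat : ℕ) : ℤ) = t₂ - t₁ := Int.toNat_of_nonneg (by linarith)
  set T := (t₂ - t₁).toNat with hTdef
  have hg3 : g + 3 * l + m ≤ T := by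
    have : (g : ℤ) + 3 * l + m ≤ T := by rw [hT]; linarith
    exact_mod_cast this
  have hTd : T ≤ T * ql := Nat.le_mul_of_pos_right T hkl
  have hM : T * k + l + T * ql ≤ M := by
    have : ((T * k + l + T * ql : ℕ) : ℤ) ≤ M := by linarith
    exact_mod_cast this
  obtain ⟨M', hM'⟩ := Nat.exists_eq_add_of_le
    (show T * ql ≤ M + g + m + crystalP 0 a.elt.1 b.elt.1 by omega)
  obtain ⟨g', hg'⟩ := Nat.exists_eq_add_of_le
    (show g + l + m + 2 * crystalP 0 a.elt.1 b.elt.1 ≤ T * ql + T * qm by omega)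
  have hev := timeEvolution_right_left hk hl hm κ a.elt b.elt (T := T) (M := M) (M' := M')
    (g := g) (g' := g') (by omega) (by rw [hql]; omega) (by rw [hql, hqm]; omega)
  refine ⟨g', M', by simp only [minGap]; omega, hev, ?_, ?_⟩
  · simp only [position, phase, Aff.translate, modifiedRv, affinize, ← Nat.cast_min, hqm]
    zify at hM' hg'
    rw [hT] at hM' hg'
    push_cast
    linear_combination h2 + hM' + hg'
  · simp only [position, phase, Aff.translate, modifiedRv, affinize, ← Nat.cast_min, hql]
    zify at hM'
    rw [hT] at hM'
    linear_combination h1 - hM'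

theorem exists_right_left {r l m k : ℕ} [NeZero r] (κ : Boundary (r + 2)) (hk : 1 ≤ k)
    (hl : 1 ≤ l) (a : Aff (Crystal r l)) (b : Aff (Crystal r m)) :
    ∃ t₁ : ℤ, ∀ᶠ c : ℤ in Filter.atTop, ∃ p : Config (r + 2),
      HasScatteringData κ k t₁ .right .left (a.translate c) (b.translate c) p := by
  have hkl : 1 ≤ min k l := by omega
  generalize hql : min k l = ql at hkl
  generalize hqm : min k m = qm
  set K : ℕ := l + m + 2 + (b.deg - a.deg).toNat with hK
  have hKd : K ≤ K * (ql + qm) := Nat.le_mul_of_pos_right K (by omega)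
  have hKd' : (K : ℤ) ≤ K * (ql + qm) := by exact_mod_cast hKd
  have hb := Int.self_le_toNat (b.deg - a.deg)
  have hKz : (K : ℤ) = l + m + 2 + (b.deg - a.deg).toNat := by rw [hK]; push_cast; ring
  obtain ⟨g, hg⟩ := Int.eq_ofNat_of_zero_le
    (show 0 ≤ a.deg - b.deg + K * (ql + qm) - 2 by omega)
  refine ⟨-K, ?_⟩
  filter_upwards [Filter.eventually_ge_atTop (qm * K - b.deg + m)] with c hc
  obtain ⟨M, hM⟩ := Int.eq_ofNat_of_zero_le (show 0 ≤ c + b.deg - qm * K + 1 - m by linarith)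
  refine ⟨_, g, M, ?_, rfl, ?_, ?_⟩
  · simp only [minGap]
    omega
  · simp only [position, phase, Aff.translate, ← Nat.cast_min, hql]
    push_cast
    linear_combination -hM - hg
  · simp only [position, phase, Aff.translate, ← Nat.cast_min, hqm]
    linear_combination hM

theorem theorem4p5 {r : ℕ} [NeZero r] (κ : Boundary (r + 2)) {l m : ℕ}
    (hl : 1 ≤ l) (hm : 1 ≤ m) (a : Aff (Crystal r l)) (b : Aff (Crystal r m))
    (out : Aff (Crystal r m) × Aff (Crystal r l)) :
    (l ≠ m → ∀ k, min l m < k → (ScattersRR κ k a b out ↔ out = modifiedR a b)) ∧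
    (∀ k, 1 ≤ k → (ScattersRL κ k a b out ↔ out = modifiedRv a b)) ∧
    (l ≠ m → ∀ k, min l m < k → (ScattersLL κ k a b out ↔ out = modifiedRvv a b)) := by
  refine ⟨fun hlm k hk => ?_, fun k hk => ?_, fun hlm k hk => ?_⟩
  · rw [ScattersRR]
    rcases lt_or_gt_of_ne hlm with h | h
    · have hk' : l < k := by omega
      rw [scatters_iff hm hl (scatters_right_right κ hl h hk' out.1 out.2)
        (exists_right_right κ h hk' out.1 out.2)]
      refine ⟨?_, fun h' => Or.inr ⟨h, ?_⟩⟩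
      · rintro (⟨h', -⟩ | ⟨-, h'⟩)
        · omega
        · have h1 : a = _ := congrArg Prod.fst h'
          have h2 : b = _ := congrArg Prod.snd h'
          rw [h1, h2]
          exact (modifiedR_involutive hlm.symm out.1 out.2).symm
      · rw [h']
        exact (modifiedR_involutive hlm a b).symm
    · have hk' : m < k := by omega
      rw [scatters_iff hl hm (scatters_right_right κ hm h hk' a b)
        (exists_right_right κ h hk' a b)]
      exact ⟨fun h' => h'.elim (·.2) fun h' => by omega, fun h' => Or.inl ⟨h, h'⟩⟩
  · exact scatters_iff hl hm (scatters_right_left κ hk hl hm a b)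
      (exists_right_left κ hk hl a b) out
  · rw [ScattersLL]
    rcases lt_or_gt_of_ne hlm with h | h
    · have hk' : l < k := by omega
      rw [scatters_iff hl hm (scatters_left_left κ hl h hk' a b)
        (exists_left_left κ h hk' a b)]
      exact ⟨fun h' => h'.elim (·.2) fun h' => by omega, fun h' => Or.inl ⟨h, h'⟩⟩
    · have hk' : m < k := by omega
      rw [scatters_iff hm hl (scatters_left_left κ hm h hk' out.1 out.2)
        (exists_left_left κ h hk' out.1 out.2)]
      refine ⟨?_, fun h' => Or.inr ⟨h, ?_⟩⟩
      · rintro (⟨h', -⟩ | ⟨-, h'⟩)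
        · omega
        · have h1 : a = _ := congrArg Prod.fst h'
          have h2 : b = _ := congrArg Prod.snd h'
          rw [h1, h2]
          exact (modifiedRvv_involutive hlm.symm out.1 out.2).symm
      · rw [h']
        exact (modifiedRvv_involutive hlm a b).symm
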